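/- All graphs are finite, simple and undirected. For vertices $u,v$ of a graph $G=(V,E)$, the geodesic interval $I_G[u,v]$ is the set of vertices that belong to at least one shortest $u$–$v$ path in $G$ (so $I_G[u,v]=\emptyset$ if there is no $u$–$v$ path). The problem Hitting Geodesic Intervals asks, given a graph $G=(V,E)$, a set $T$ of vertex pairs and an integer $k\ge 0$, whether there is a set $S\subseteq V$ with $|S|\le k$ such that $S\cap I_G[u,v]\neq\emptyset$ for every $\{u,v\}\in T$. A set $M\subseteq V$ is a module of $G$ if $N_G(u)\setminus M=N_G(v)\setminus M$ for all $u,v\in M$. The modular-width $\mathrm{mw}(G)$ is the minimum integer $\mu$ such that $|V|\le\mu$, or $V$ can be partitioned into nonempty modules $M_1,\dots,M_{\mu'}$ of $G$ with $2\le\mu'\le\mu$ and $\mathrm{mw}(G[M_i])\le\mu$ for each $i$. Let $p(G)$ be the least integer $p \ge 0$ such that the vertex set of every connected component $C$ of $G$ with at least two vertices can be partitioned into at least $2$ and at most $p$ nonempty modules of $C$. Running times are counted on a random access machine with addition, truncated subtraction and halving under the uniform cost measure, with $G$ and $T$ given as $0$-$1$ matrices; $O^*$ hides factors polynomial in the input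 length. Theorem. Hitting Geodesic Intervals is fixed-parameter tractable parameterized by $k+\mathrm{mw}(G)$: for some computable function $f$ it is decided in time $O^*(f(k+\mathrm{mw}(G)))$. More precisely, it can be decided in time $O^*(2^{p(G)+k})$, and $p(G)\le\mathrm{mw}(G)$ for every graph $G$. -/

import Mathlib

/-! ### Random access machines

A random access machine has registers `reg 0, reg 1, …` and memory banks `mem 0, mem 1, …`, each
an indirectly addressable sequence of cells; all hold natural numbers. The arithmetic operations
are addition, truncated subtraction and halving (rounded down), under the uniform cost measure.
A program is a finite text, so it uses finitely many registers and memory banks. -/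

namespace RAM

/-- Arithmetic expressions: constants, registers, memory cells `mem a [i]`, sum, truncated
difference and halving. -/
inductive Expr where
  | const (c : ℕ)
  | reg (x : ℕ)
  | read (a : ℕ) (i : Expr)
  | add (e₁ e₂ : Expr)
  | sub (e₁ e₂ : Expr)
  | half (e : Expr)

/-- Programs. A condition `e` counts as true when its value is nonzero. -/
inductive Program where
  | assign (x : ℕ) (e : Expr)
  | write (a : ℕ) (i e : Expr)
  | seq (P Q : Program)
  | ite (e : Expr) (P Q : Program)
  | loop (e : Expr) (P : Program)

/-- The contents of the registers and of the memory banks. -/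
structure State where
  reg : ℕ → ℕ
  mem : ℕ → ℕ → ℕ

/-- The value of an expression. -/
def Expr.eval (s : State) : Expr → ℕ
  | const c => c
  | reg x => s.reg x
  | read a i => s.mem a (i.eval s)
  | add e₁ e₂ => e₁.eval s + e₂.eval s
  | sub e₁ e₂ => e₁.eval s - e₂.eval s
  | half e => e.eval s / 2

/-- The number of steps needed to evaluate an expression: one for each operation or access. -/
def Expr.cost : Expr → ℕ
  | const _ => 1
  | reg _ => 1
  | read _ i => i.cost + 1
  | add e₁ e₂ => e₁.cost + e₂.cost + 1
  | sub e₁ e₂ => e₁.cost + e₂.cost + 1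
  | half e => e.cost + 1

/-- Overwrite register `x` by `v`. -/
def State.setReg (s : State) (x v : ℕ) : State :=
  { s with reg := Function.update s.reg x v }

/-- Overwrite cell `i` of memory bank `a` by `v`. -/
def State.setMem (s : State) (a i v : ℕ) : State :=
  { s with mem := Function.update s.mem a (Function.update (s.mem a) i v) }

/-- `Exec P s t s'`: started in state `s`, the program `P` halts after exactly `t` steps, in
state `s'`. The rules are directed by the syntax and by the values of the conditions, so that the
machine is deterministic; a run that does not halt has no derivation. -/
inductive Exec : Program → State → ℕ → State → Prop where
  | assign (x : ℕ) (e : Expr) (s : State) :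
      Exec (.assign x e) s (e.cost + 1) (s.setReg x (e.eval s))
  | write (a : ℕ) (i e : Expr) (s : State) :
      Exec (.write a i e) s (i.cost + e.cost + 1) (s.setMem a (i.eval s) (e.eval s))
  | seq {P Q : Program} {s s' s'' : State} {t t' : ℕ} :
      Exec P s t s' → Exec Q s' t' s'' → Exec (.seq P Q) s (t + t') s''
  | iteTrue {e : Expr} {P Q : Program} {s s' : State} {t : ℕ} :
      e.eval s ≠ 0 → Exec P s t s' → Exec (.ite e P Q) s (e.cost + 1 + t) s'
  | iteFalse {e : Expr} {P Q : Program} {s s' : State} {t : ℕ} :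
      e.eval s = 0 → Exec Q s t s' → Exec (.ite e P Q) s (e.cost + 1 + t) s'
  | loopDone {e : Expr} {P : Program} {s : State} :
      e.eval s = 0 → Exec (.loop e P) s (e.cost + 1) s
  | loopStep {e : Expr} {P : Program} {s s' s'' : State} {t t' : ℕ} :
      e.eval s ≠ 0 → Exec P s t s' → Exec (.loop e P) s' t' s'' →
        Exec (.loop e P) s (e.cost + 1 + t + t') s''

end RAM

/-! ### Modules and modular-width -/

/-- `M` is a module of `G`: its members have the same neighbours outside `M`. -/
def IsModule {V : Type} (G : SimpleGraph V) (M : Set V) : Prop :=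
  ∀ u ∈ M, ∀ v ∈ M, G.neighborSet u \ M = G.neighborSet v \ M

/-- `P` is a partition of the vertex set of `G` into (nonempty) modules of `G`. -/
def IsModulePartition {V : Type} (G : SimpleGraph V) (P : Set (Set V)) : Prop :=
  Setoid.IsPartition P ∧ ∀ M ∈ P, IsModule G M

/-- The recursive condition that defines `mw(G) ≤ μ` for a finite graph `G`. -/
inductive ModularWidthLE (μ : ℕ) : {V : Type} → SimpleGraph V → Prop where
  | small {V : Type} (G : SimpleGraph V) :
      Finite V → Nat.card V ≤ μ → ModularWidthLE μ G
  | partition {V : Type} (G : SimpleGraph V) (P : Set (Set V)) :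
      IsModulePartition G P → 2 ≤ P.ncard → P.ncard ≤ μ →
      (∀ M ∈ P, ModularWidthLE μ (G.induce M)) → ModularWidthLE μ G

/-- The modular-width of a finite graph. -/
noncomputable def modularWidth {V : Type} (G : SimpleGraph V) : ℕ :=
  sInf {μ | ModularWidthLE μ G}

/-- The number `p` of top-level modules: the least `p` such that every connected component of `G`
with at least two vertices can be partitioned into at least two and at most `p` modules. -/
noncomputable def topModuleNumber {V : Type} (G : SimpleGraph V) : ℕ :=
  sInf {p | ∀ C : G.ConnectedComponent, C.supp.Nontrivial →
    ∃ P : Set (Set C.supp), IsModulePartition (G.induce C.supp) P ∧ 2 ≤ P.ncard ∧ P.ncard ≤ p}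

/-! ### Hitting geodesic intervals -/

/-- The set of the vertices on at least one shortest `u`-`v` path (empty if there is no
`u`-`v` path). -/
def geodesicInterval {V : Type} (G : SimpleGraph V) (u v : V) : Set V :=
  {w | ∃ q : G.Walk u v, q.IsPath ∧ q.length = G.dist u v ∧ w ∈ q.support}

/-- An instance `⟨G, T, k⟩`, where `G` has vertex set `{0, …, n - 1}`. -/
structure HGIInstance where
  n : ℕ
  G : SimpleGraph (Fin n)
  T : Set (Sym2 (Fin n))
  k : ℕ

/-- The question: at most `k` vertices hit the geodesic intervals of all pairs in `T`. -/
def HittingGeodesicIntervals (I : HGIInstance) : Prop :=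
  ∃ S : Finset (Fin I.n), S.card ≤ I.k ∧
    ∀ u v : Fin I.n, s(u, v) ∈ I.T → ((S : Set (Fin I.n)) ∩ geodesicInterval I.G u v).Nonempty

/-- The length of the input: the adjacency matrix of `G`, the matrix of `T`, and the binary
representations of `n` and `k`. -/
def HGIInstance.size (I : HGIInstance) : ℕ :=
  2 * I.n ^ 2 + Nat.size I.n + Nat.size I.k

open Classical in
/-- The row-by-row 0-1 matrix of a binary relation on `{0, …, n - 1}`. -/
noncomputable def matrixOf {n : ℕ} (r : Fin n → Fin n → Prop) (m : ℕ) : ℕ :=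
  if ∃ i j : Fin n, m = i * n + j ∧ r i j then 1 else 0

/-- The initial state on input `I`: `n` and `k` are in registers 0 and 1, the adjacency matrix of
`G` and the matrix of `T` are in memory banks 0 and 1, and all else is 0. -/
noncomputable def HGIInstance.input (I : HGIInstance) : RAM.State where
  reg := fun x => if x = 0 then I.n else if x = 1 then I.k else 0
  mem := fun a => if a = 0 then matrixOf I.G.Adj
    else if a = 1 then matrixOf (fun u v => s(u, v) ∈ I.T) else fun _ => 0

open Classical in
/-- On input `I`, the program halts within `t` steps, with the correct answer to the question `Q`
(1 for yes, 0 for no) in register 0. -/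
def DecidesWithin (Q : HGIInstance → Prop) (prog : RAM.Program) (I : HGIInstance) (t : ℕ) : Prop :=
  ∃ (t' : ℕ) (s : RAM.State), t' ≤ t ∧ RAM.Exec prog I.input t' s ∧
    s.reg 0 = if Q I then 1 else 0

/-- `Q` can be decided in time `O*(g)`: one program decides every instance `I` within
`g(I)` times a polynomial in the length of the input. -/
def SolvableInOStar (Q : HGIInstance → Prop) (g : HGIInstance → ℕ) : Prop :=
  ∃ (prog : RAM.Program) (c : ℕ), ∀ I : HGIInstance,
    DecidesWithin Q prog I (c * g I * (I.size + 1) ^ c)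

/-- `Q` is fixed-parameter tractable parameterized by `κ`. -/
def IsFixedParameterTractable (Q : HGIInstance → Prop) (κ : HGIInstance → ℕ) : Prop :=
  ∃ f : ℕ → ℕ, Computable f ∧ SolvableInOStar Q (fun I => f (κ I))

/-! Shortest paths interact with modules in a simple way: a vertex outside a module is equidistant
from all its members (`IsModRel.dt_eq`). Hence, once it is known which modules of a component a
solution meets, the pairs hit from a module other than those of `u` and `v` are known as well
(`Sat`). Any other pair must be hit inside the module of one of its ends. If the ends lie in
different modules, are adjacent or coincide, this forces an end itself into the solution
(`Setup.hard_hit`), so these pairs pose a vertex cover problem. What remains are nonadjacent pairs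
within one module. They are at distance two, and every outside neighbour of the module hits all of
them (`Setup.soft_nbr`).

The key is an exchange argument (`Setup.exists_better`). Let a solution contain the guessed cover,
and suppose that a vertex outside the cover shares its module with another solution vertex. It can
be deleted if its module has no remaining pair, and otherwise replaced by an outside neighbour of
the module, which lies in a module not met before. So in a smallest solution that meets as many
vertices as possible through its modules, every module has either only cover vertices or exactly one
solution vertex (`Setup.exists_good_solution`). Completing the cover then means choosing one vertex
separately in each met module that the cover misses, which takes polynomial time. Conversely,
whatever passes the check gives a solution (`Setup.exists_solves_of_valid`). The guesses cost one
bit per module and one bit per unit of budget.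

Few modules are found as follows. In a component with connected complement, overlapping proper
modules have a proper union (`ProperMod.union`), so the maximal ones partition the component, and
every partition into at least two modules refines this one. If the complement is disconnected, one
co-component and the rest are two modules. Either way there are at most `p(G) + 1` classes
(`isModRel_same`, `card_modReps_le`), where the extra one accounts for single vertices. Components
are independent and share the budget (`comps_prefix`, `hittingGeodesicIntervals_iff`). The bound by
the modular-width comes from descending through the recursive decomposition to where a set of
vertices is split (`exists_partition_of_modularWidthLE`).

On the machine side, `Def`, `DefP` and `Poly` compile expressions, predicates and updates
compositionally, so that instance search supplies the programs. Only the loop over guesses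
(`Timed.whileLt`) takes exponential time. -/

open RAM

namespace HGI

/-! ### Running programs with a time bound -/

/-- Started in state `s`, the program `P` halts within `T` steps in a state that satisfies `Q`. -/
def Runs (P : Program) (s : State) (T : ℕ) (Q : State → Prop) : Prop :=
  ∃ t s', t ≤ T ∧ Exec P s t s' ∧ Q s'

theorem Runs.mono {P : Program} {s : State} {T T' : ℕ} {Q Q' : State → Prop}
    (h : Runs P s T Q) (hT : T ≤ T') (hQ : ∀ s', Q s' → Q' s') : Runs P s T' Q' := by
  obtain ⟨t, s', ht, hE, hs⟩ := h
  exact ⟨t, s', ht.trans hT, hE, hQ _ hs⟩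

theorem Runs.assign {x : ℕ} {e : Expr} {s : State} {Q : State → Prop}
    (h : Q (s.setReg x (e.eval s))) : Runs (.assign x e) s (e.cost + 1) Q :=
  ⟨_, _, le_rfl, .assign x e s, h⟩

theorem Runs.write {a : ℕ} {i e : Expr} {s : State} {Q : State → Prop}
    (h : Q (s.setMem a (i.eval s) (e.eval s))) :
    Runs (.write a i e) s (i.cost + e.cost + 1) Q :=
  ⟨_, _, le_rfl, .write a i e s, h⟩

theorem Runs.seq {P P' : Program} {s : State} {T T' : ℕ} {Q : State → Prop}
    (h : Runs P s T fun s' => Runs P' s' T' Q) : Runs (.seq P P') s (T + T') Q := by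
  obtain ⟨t, s', ht, hE, t', s'', ht', hE', hQ⟩ := h
  exact ⟨t + t', s'', by omega, .seq hE hE', hQ⟩

theorem Runs.ite {e : Expr} {P P' : Program} {s : State} {T T' : ℕ} {Q : State → Prop}
    (h : e.eval s ≠ 0 → Runs P s T Q) (h' : e.eval s = 0 → Runs P' s T' Q) :
    Runs (.ite e P P') s (e.cost + 1 + (T + T')) Q := by
  by_cases he : e.eval s = 0
  · obtain ⟨t, s', ht, hE, hQ⟩ := h' he
    exact ⟨_, s', by omega, .iteFalse he hE, hQ⟩
  · obtain ⟨t, s', ht, hE, hQ⟩ := h he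
    exact ⟨_, s', by omega, .iteTrue he hE, hQ⟩

/-- The invariant carries the number of rounds done, and the condition fails exactly after `N`
rounds. The factor is `N + 1` because the last, failing test is also charged. -/
theorem Runs.loop {e : Expr} {P : Program} {N T : ℕ} (I : ℕ → State → Prop)
    (hcond : ∀ i s, I i s → (e.eval s ≠ 0 ↔ i < N))
    (hbody : ∀ i s, i < N → I i s → Runs P s T (I (i + 1)))
    {s : State} (h0 : I 0 s) :
    Runs (.loop e P) s ((N + 1) * (T + e.cost + 1)) (I N) := by
  have key : ∀ j i s, i + j = N → I i s →
      Runs (.loop e P) s ((j + 1) * (T + e.cost + 1)) (I N) := by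
    intro j
    induction j with
    | zero =>
      intro i s hi hI
      have : e.eval s = 0 := by
        by_contra h
        have := (hcond i s hI).1 h
        omega
      obtain rfl : i = N := by omega
      exact ⟨_, s, by nlinarith, .loopDone this, hI⟩
    | succ j ih =>
      intro i s hi hI
      have hlt : i < N := by omega
      obtain ⟨t, s', ht, hE, hI'⟩ := hbody i s hlt hI
      obtain ⟨t', s'', ht', hE', hI''⟩ := ih (i + 1) s' (by omega) hI'
      refine ⟨_, s'', ?_, .loopStep ((hcond i s hI).2 hlt) hE hE', hI''⟩
      have : (j + 1 + 1) * (T + e.cost + 1) = (j + 1) * (T + e.cost + 1) + (T + e.cost + 1) := by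
        ring
      omega
  exact key N 0 s (by omega) h0

/-! ### Polynomial bounds -/

/-- The function `τ` is bounded by a polynomial. -/
def PolyBdd (τ : ℕ → ℕ) : Prop := ∃ C, ∀ n, τ n ≤ C * (n + 1) ^ C

theorem PolyBdd.const (c : ℕ) : PolyBdd fun _ => c :=
  ⟨c, fun n => Nat.le_mul_of_pos_right _ (by positivity)⟩

theorem PolyBdd.id : PolyBdd fun n => n := ⟨1, fun n => by simp⟩

theorem PolyBdd.add {τ σ : ℕ → ℕ} (h : PolyBdd τ) (h' : PolyBdd σ) :
    PolyBdd fun n => τ n + σ n := by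
  obtain ⟨C, hC⟩ := h
  obtain ⟨C', hC'⟩ := h'
  refine ⟨C + C', fun n => ?_⟩
  have h1 : (n + 1) ^ C ≤ (n + 1) ^ (C + C') := Nat.pow_le_pow_right (by omega) (by omega)
  have h2 : (n + 1) ^ C' ≤ (n + 1) ^ (C + C') := Nat.pow_le_pow_right (by omega) (by omega)
  calc τ n + σ n ≤ C * (n + 1) ^ C + C' * (n + 1) ^ C' := add_le_add (hC n) (hC' n)
    _ ≤ C * (n + 1) ^ (C + C') + C' * (n + 1) ^ (C + C') := by gcongr
    _ = _ := by ring

theorem PolyBdd.mul {τ σ : ℕ → ℕ} (h : PolyBdd τ) (h' : PolyBdd σ) :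
    PolyBdd fun n => τ n * σ n := by
  obtain ⟨C, hC⟩ := h
  obtain ⟨C', hC'⟩ := h'
  -- One constant serves as factor and as exponent: `C * C'` is needed for the former, `C + C'` for
  -- the latter.
  refine ⟨C * C' + C + C', fun n => ?_⟩
  calc τ n * σ n ≤ (C * (n + 1) ^ C) * (C' * (n + 1) ^ C') := Nat.mul_le_mul (hC n) (hC' n)
    _ = C * C' * (n + 1) ^ (C + C') := by ring
    _ ≤ (C * C' + C + C') * (n + 1) ^ (C * C' + C + C') := by
      apply Nat.mul_le_mul (by omega)
      exact Nat.pow_le_pow_right (by omega) (by omega)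

/-! ### Data and their representation in the machine -/

/-- The data that our programs work on: scalars, and `n × n` arrays. -/
structure Data (n : ℕ) where
  sc : ℕ → ℕ
  ar : ℕ → Fin n → Fin n → ℕ

/-- Overwrite scalar `i`. -/
def Data.setSc {n : ℕ} (D : Data n) (i v : ℕ) : Data n :=
  { D with sc := Function.update D.sc i v }

/-- Overwrite array `a`. -/
def Data.setAr {n : ℕ} (D : Data n) (a : ℕ) (F : Fin n → Fin n → ℕ) : Data n :=
  { D with ar := Function.update D.ar a F }

/-- Do `f i` for all `i` in increasing order. -/
def forV {n : ℕ} (f : Fin n → Data n → Data n) (D : Data n) : Data n :=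
  (List.finRange n).foldl (fun D i => f i D) D

/-- Do `f`, then `g`. -/
def andThen {n : ℕ} (f g : Data n → Data n) (D : Data n) : Data n := g (f D)

/-- The memory bank that holds array `a`. -/
def bank (a : ℕ) : ℕ := if a < 2 then a else a + 2

/-- Banks 0 and 1 hold the input and stay in place. Bank 2 is reserved for row offsets and bank 3
for a buffer, so all other arrays move up by two. -/
theorem bank_inj {a b : ℕ} (h : bank a = bank b) : a = b := by
  unfold bank at h; split_ifs at h <;> omega

theorem bank_ne_two (a : ℕ) : bank a ≠ 2 := by unfold bank; split_ifs <;> omega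

theorem bank_ne_three (a : ℕ) : bank a ≠ 3 := by unfold bank; split_ifs <;> omega

/-- The state `s` represents `D`; memory bank 2 holds the offsets of the rows. -/
structure Rep {n : ℕ} (D : Data n) (s : State) : Prop where
  size : s.reg 0 = n
  row : ∀ i : Fin n, s.mem 2 i = i * n
  sc : ∀ i, s.reg (3 * i + 3) = D.sc i
  ar : ∀ a (i j : Fin n), s.mem (bank a) (i * n + j) = D.ar a i j

/-- The values of `m` variables that range over `Fin n`. -/
def Ctx : ℕ → ℕ → Type
  | 0, _ => Unit
  | m + 1, n => Ctx m n × Fin n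

/-- The value of variable number `l`. -/
def Ctx.val {n : ℕ} : {m : ℕ} → Ctx m n → ℕ → ℕ
  | 0, _, _ => 0
  | m + 1, γ, l => if l = m then γ.2 else Ctx.val γ.1 l

/-- The state `s` represents the variables `γ`. -/
def CRep {m n : ℕ} (γ : Ctx m n) (s : State) : Prop :=
  ∀ l < m, s.reg (3 * l + 1) = γ.val l

/-- The evaluation of an expression leaves these parts of the state unchanged. -/
def Frame (m t : ℕ) (s s' : State) : Prop :=
  s'.mem = s.mem ∧
    ∀ r, (r % 3 = 0 ∨ r % 3 = 1 ∧ r / 3 < m ∨ r % 3 = 2 ∧ r / 3 < t) → s'.reg r = s.reg r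

/-- Registers are sorted by their residue modulo 3: `n` and the scalars (0), loop variables (1),
temporaries (2). Code placed at `m`, `t` may spoil only variables from `m` on and temporaries from
`t` on. -/
theorem Frame.refl (m t : ℕ) (s : State) : Frame m t s s := ⟨rfl, fun _ _ => rfl⟩

theorem Frame.trans {m t : ℕ} {s s' s'' : State} (h : Frame m t s s') (h' : Frame m t s' s'') :
    Frame m t s s'' :=
  ⟨h'.1.trans h.1, fun r hr => (h'.2 r hr).trans (h.2 r hr)⟩

theorem Frame.mono {m t m' t' : ℕ} {s s' : State} (h : Frame m' t' s s') (hm : m ≤ m')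
    (ht : t ≤ t') : Frame m t s s' :=
  ⟨h.1, fun r hr => h.2 r (by omega)⟩

theorem Frame.setReg {m t : ℕ} {s s' : State} (h : Frame m t s s') {x v : ℕ}
    (hx : x % 3 = 1 ∧ m ≤ x / 3 ∨ x % 3 = 2 ∧ t ≤ x / 3) : Frame m t s (s'.setReg x v) := by
  refine ⟨h.1, fun r hr => ?_⟩
  have : r ≠ x := by rintro rfl; omega
  simp [State.setReg, this, h.2 r hr]

theorem Rep.frame {n m t : ℕ} {D : Data n} {s s' : State} (h : Rep D s) (hf : Frame m t s s') :
    Rep D s' where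
  size := by rw [hf.2 0 (by omega), h.size]
  row i := by rw [hf.1, h.row]
  sc i := by rw [hf.2 _ (by omega), h.sc]
  ar a i j := by rw [hf.1, h.ar]

theorem CRep.frame {n m t : ℕ} {γ : Ctx m n} {s s' : State} (h : CRep γ s)
    (hf : Frame m t s s') : CRep γ s' := fun l hl => by
  rw [hf.2 _ (by omega), h l hl]

theorem CRep.cons {n m : ℕ} {γ : Ctx m n} {s : State} (h : CRep γ s) {i : Fin n}
    (hi : s.reg (3 * m + 1) = i) : CRep (m := m + 1) (γ, i) s := fun l hl => by
  simp only [Ctx.val]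
  split_ifs with hlm
  · rw [hlm, hi]
  · exact h l (by omega)

theorem CRep.tail {n m : ℕ} {γ : Ctx m n} {s : State} {i : Fin n}
    (h : CRep (m := m + 1) (γ, i) s) : CRep γ s := fun l hl => by
  have := h l (by omega)
  simp only [Ctx.val] at this
  rwa [if_neg (by omega)] at this

theorem CRep.head {n m : ℕ} {γ : Ctx m n} {s : State} {i : Fin n}
    (h : CRep (m := m + 1) (γ, i) s) : s.reg (3 * m + 1) = i := by
  have := h m (by omega)
  simpa [Ctx.val] using this

/-! ### Expressions that are evaluated in polynomial time -/

/-- `x` is one of the variables. -/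
class IsVar {m : ℕ} (x : ∀ n, Ctx m n → Fin n) : Prop where
  out : ∃ l < m, ∀ n γ, (x n γ : ℕ) = γ.val l

instance (priority := low) IsVar.tail {m : ℕ} {x : ∀ n, Ctx m n → Fin n} [h : IsVar x] :
    IsVar (m := m + 1) fun n γ => x n γ.1 := by
  obtain ⟨l, hl, h⟩ := h.out
  refine ⟨l, by omega, fun n γ => ?_⟩
  simp [Ctx.val, h, hl.ne]

instance isVar0 {m : ℕ} : IsVar (m := m + 1) fun _ γ => γ.2 :=
  ⟨m, by omega, fun n γ => by simp [Ctx.val]⟩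
instance isVar1 {m : ℕ} : IsVar (m := m + 2) fun _ γ => γ.1.2 := .tail (h := isVar0)
instance isVar2 {m : ℕ} : IsVar (m := m + 3) fun _ γ => γ.1.1.2 := .tail (h := isVar1)
instance isVar3 {m : ℕ} : IsVar (m := m + 4) fun _ γ => γ.1.1.1.2 := .tail (h := isVar2)

instance (priority := low) IsVar.tail2 {m : ℕ} {x : ∀ n, Ctx m n → Fin n} [IsVar x] :
    IsVar (m := m + 2) fun n γ => x n γ.1.1 := .tail (h := .tail)
instance (priority := low) IsVar.tail3 {m : ℕ} {x : ∀ n, Ctx m n → Fin n} [IsVar x] :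
    IsVar (m := m + 3) fun n γ => x n γ.1.1.1 := .tail (h := .tail2)

/-- The expression `F` is evaluated by a program in polynomial time. -/
class Def {m : ℕ} (F : ∀ n, Ctx m n → Data n → ℕ) : Prop where
  out : ∃ (code : ℕ → Program) (τ : ℕ → ℕ), PolyBdd τ ∧ ∀ t n (γ : Ctx m n) (D : Data n) s,
    Rep D s → CRep γ s →
      Runs (code t) s (τ n) fun s' => s'.reg (3 * t + 2) = F n γ D ∧ Frame m t s s'

open Classical in
/-- The predicate `P` is decided by a program in polynomial time. -/
class DefP {m : ℕ} (P : ∀ n, Ctx m n → Data n → Prop) : Prop where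
  out : Def fun n γ D => if P n γ D then 1 else 0

variable {m : ℕ} {F G : ∀ n, Ctx m n → Data n → ℕ} {P Q : ∀ n, Ctx m n → Data n → Prop}
  {x y : ∀ n, Ctx m n → Fin n}

theorem Def.of_expr (e : Expr) (h : ∀ n (γ : Ctx m n) (D : Data n) s, Rep D s → CRep γ s →
    e.eval s = F n γ D) : Def F := by
  refine ⟨fun t => .assign (3 * t + 2) e, fun _ => e.cost + 1, .const _, ?_⟩
  intro t n γ D s hD hγ
  refine Runs.assign ⟨?_, (Frame.refl _ _ _).setReg (by omega)⟩
  simp [State.setReg, h n γ D s hD hγ]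

instance Def.const (c : ℕ) : Def (m := m) fun _ _ _ => c :=
  .of_expr (.const c) fun _ _ _ _ _ _ => rfl

instance Def.size : Def (m := m) fun n _ _ => n :=
  .of_expr (.reg 0) fun _ _ _ _ h _ => h.size

instance Def.sc (i : ℕ) : Def (m := m) fun _ _ D => D.sc i :=
  .of_expr (.reg (3 * i + 3)) fun _ _ _ _ h _ => h.sc i

instance Def.var [hx : IsVar x] : Def fun n γ _ => (x n γ : ℕ) := by
  obtain ⟨l, hl, h⟩ := hx.out
  exact .of_expr (.reg (3 * l + 1)) fun n γ D s _ hγ => by rw [h]; exact hγ l hl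

instance Def.ar (a : ℕ) [hx : IsVar x] [hy : IsVar y] :
    Def fun n γ D => D.ar a (x n γ) (y n γ) := by
  obtain ⟨l, hl, h⟩ := hx.out
  obtain ⟨l', hl', h'⟩ := hy.out
  refine .of_expr (.read (bank a) (.add (.read 2 (.reg (3 * l + 1))) (.reg (3 * l' + 1))))
    fun n γ D s hD hγ => ?_
  simp only [Expr.eval, hγ l hl, hγ l' hl', ← h, ← h', hD.row, hD.ar]

theorem Def.binary (e : Expr → Expr → Expr) (op : ℕ → ℕ → ℕ)
    (he : ∀ r r' s, (e (.reg r) (.reg r')).eval s = op (s.reg r) (s.reg r')) (c : ℕ)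
    (hc : ∀ r r', (e (.reg r) (.reg r')).cost ≤ c)
    (hF : Def F) (hG : Def G) : Def fun n γ D => op (F n γ D) (G n γ D) := by
  obtain ⟨cF, τ, hτ, hF⟩ := hF.out
  obtain ⟨cG, σ, hσ, hG⟩ := hG.out
  -- The second operand is evaluated at temporary `t + 1`, which protects the first one in temporary
  -- `t`.
  refine ⟨fun t => .seq (cF t) (.seq (cG (t + 1))
    (.assign (3 * t + 2) (e (.reg (3 * t + 2)) (.reg (3 * (t + 1) + 2))))),
    fun n => τ n + (σ n + (c + 1)), hτ.add (hσ.add (.const _)), ?_⟩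
  intro t n γ D s hD hγ
  refine Runs.seq ((hF t n γ D s hD hγ).mono le_rfl ?_)
  rintro s₁ ⟨h₁, f₁⟩
  refine Runs.seq ((hG (t + 1) n γ D s₁ (hD.frame f₁) (hγ.frame f₁)).mono le_rfl ?_)
  rintro s₂ ⟨h₂, f₂⟩
  refine Runs.mono (Runs.assign (Q := fun s' => s'.reg (3 * t + 2) = op (F n γ D) (G n γ D) ∧
    Frame m t s s') ⟨?_, ?_⟩) (by simpa using hc _ _) fun _ h => h
  · simp only [State.setReg, Function.update_self, he, h₂]
    rw [f₂.2 _ (by omega), h₁]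
  · exact (f₁.trans (f₂.mono le_rfl (by omega))).setReg (by omega)

instance Def.add [hF : Def F] [hG : Def G] : Def fun n γ D => F n γ D + G n γ D :=
  .binary .add (· + ·) (fun _ _ _ => rfl) 3 (fun _ _ => le_rfl) hF hG

instance Def.sub [hF : Def F] [hG : Def G] : Def fun n γ D => F n γ D - G n γ D :=
  .binary .sub (· - ·) (fun _ _ _ => rfl) 3 (fun _ _ => le_rfl) hF hG

instance Def.half [hF : Def F] : Def fun n γ D => F n γ D / 2 :=
  .binary (fun e _ => .half e) (fun a _ => a / 2) (fun _ _ _ => rfl) 2 (fun _ _ => le_rfl) hF hF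

theorem Def.ite_ne_zero (hF : Def F) {G' H : ∀ n, Ctx m n → Data n → ℕ} (hG : Def G')
    (hH : Def H) : Def fun n γ D => if F n γ D ≠ 0 then G' n γ D else H n γ D := by
  obtain ⟨cF, τ, hτ, hF⟩ := hF.out
  obtain ⟨cG, σ, hσ, hG⟩ := hG.out
  obtain ⟨cH, ρ, hρ, hH⟩ := hH.out
  refine ⟨fun t => .seq (cF t) (.ite (.reg (3 * t + 2)) (cG t) (cH t)),
    fun n => τ n + (1 + 1 + (σ n + ρ n)), hτ.add ((PolyBdd.const _).add (hσ.add hρ)), ?_⟩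
  intro t n γ D s hD hγ
  refine Runs.seq ((hF t n γ D s hD hγ).mono le_rfl ?_)
  rintro s₁ ⟨h₁, f₁⟩
  refine Runs.ite (fun he => ?_) fun he => ?_
  · simp only [Expr.eval, h₁] at he
    refine (hG t n γ D s₁ (hD.frame f₁) (hγ.frame f₁)).mono le_rfl ?_
    rintro s₂ ⟨h₂, f₂⟩
    exact ⟨by rw [h₂, if_pos he], f₁.trans f₂⟩
  · simp only [Expr.eval, h₁] at he
    refine (hH t n γ D s₁ (hD.frame f₁) (hγ.frame f₁)).mono le_rfl ?_
    rintro s₂ ⟨h₂, f₂⟩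
    exact ⟨by rw [h₂, if_neg (by simpa using he)], f₁.trans f₂⟩

theorem Def.congr (hF : Def F) (h : ∀ n γ D, F n γ D = G n γ D) : Def G := by
  obtain rfl : F = G := by funext n γ D; exact h n γ D
  exact hF

/-- The decidability instance is left arbitrary, so that the rule matches every `if` whatever
instance it was elaborated with. -/
instance Def.ite [hP : DefP P] [hF : Def F] [hG : Def G] {inst : ∀ n γ D, Decidable (P n γ D)} :
    Def fun n γ D => @_root_.ite ℕ (P n γ D) (inst n γ D) (F n γ D) (G n γ D) :=
  (Def.ite_ne_zero hP.out hF hG).congr fun n γ D => by by_cases h : P n γ D <;> simp [h]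

instance Def.sum {F : ∀ n, Ctx m n → Fin n → Data n → ℕ}
    [hF : Def (m := m + 1) fun n γ D => F n γ.1 γ.2 D] :
    Def fun n γ D => ∑ i : Fin n, F n γ i D := by
  obtain ⟨cF, τ, hτ, hF⟩ := hF.out
  refine ⟨fun t => .seq (.assign (3 * t + 2) (.const 0)) (.seq (.assign (3 * m + 1) (.const 0))
    (.loop (.sub (.reg 0) (.reg (3 * m + 1))) (.seq (cF (t + 1)) (.seq
      (.assign (3 * t + 2) (.add (.reg (3 * t + 2)) (.reg (3 * (t + 1) + 2))))
      (.assign (3 * m + 1) (.add (.reg (3 * m + 1)) (.const 1))))))),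
    fun n => 2 + (2 + ((n + 1) * (τ n + (4 + 4) + 3 + 1))), ?_, ?_⟩
  · refine (PolyBdd.const _).add ((PolyBdd.const _).add ((PolyBdd.id.add (.const _)).mul ?_))
    exact ((hτ.add (.const _)).add (.const _)).add (.const _)
  intro t n γ D s hD hγ
  refine Runs.seq (Runs.assign (Runs.seq (Runs.assign ?_)))
  refine (Runs.loop (N := n) (T := τ n + (4 + 4)) (fun j s' => s'.reg (3 * m + 1) = j ∧
      s'.reg (3 * t + 2) = (∑ i : Fin n with i.val < j, F n γ i D) ∧ Frame m t s s')
    ?_ ?_ ?_).mono le_rfl ?_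
  · rintro j s' ⟨h₁, h₂, h₃⟩
    simp only [Expr.eval, h₁, (hD.frame h₃).size]
    omega
  · rintro j s' hj ⟨h₁, h₂, h₃⟩
    have := hF (t + 1) n (γ, ⟨j, hj⟩) D s' (hD.frame h₃) ((hγ.frame h₃).cons h₁)
    refine Runs.seq (this.mono le_rfl ?_)
    rintro s₁ ⟨g₁, f₁⟩
    refine Runs.seq (Runs.assign (Runs.assign ⟨?_, ?_, ?_⟩))
    · have : 3 * m + 1 ≠ 3 * t + 2 := by omega
      simp only [State.setReg, Expr.eval, Function.update_self, Function.update_of_ne this]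
      rw [f₁.2 (3 * m + 1) (by omega), h₁]
    · have : 3 * t + 2 ≠ 3 * m + 1 := by omega
      simp only [State.setReg, Expr.eval, ne_eq, this, not_false_eq_true,
        Function.update_of_ne, Function.update_self, g₁]
      rw [f₁.2 (3 * t + 2) (by omega), h₂]
      have : (Finset.univ.filter fun i : Fin n => i.val < j + 1) =
          insert ⟨j, hj⟩ (Finset.univ.filter fun i : Fin n => i.val < j) := by
        ext i; simp [Fin.ext_iff]; omega
      rw [this, Finset.sum_insert (by simp), add_comm]
    · exact ((h₃.trans (f₁.mono (by omega) (by omega))).setReg (by omega)).setReg (by omega)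
  · refine ⟨by simp [State.setReg, Expr.eval], ?_, ?_⟩
    · have : 3 * t + 2 ≠ 3 * m + 1 := by omega
      simp [State.setReg, Expr.eval, this]
    · exact ((Frame.refl m t s).setReg (by omega)).setReg (by omega)
  · rintro s' ⟨-, h₂, h₃⟩
    refine ⟨?_, h₃⟩
    rw [h₂]
    congr 1
    ext i; simp

theorem DefP.congr (hP : DefP P) (h : ∀ n γ D, P n γ D ↔ Q n γ D) : DefP Q := by
  obtain rfl : P = Q := by funext n γ D; exact propext (h n γ D)
  exact hP

theorem DefP.ne_zero (hF : Def F) : DefP fun n γ D => F n γ D ≠ 0 :=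
  ⟨(Def.ite_ne_zero hF (.const 1) (.const 0)).congr fun n γ D => by
    by_cases h : F n γ D = 0 <;> simp [h]⟩

/-- Truncated subtraction is nonzero exactly when the comparison is strict; all other comparisons
reduce to this one. -/
instance DefP.lt [Def F] [Def G] : DefP fun n γ D => F n γ D < G n γ D :=
  (DefP.ne_zero (F := fun n γ D => G n γ D - F n γ D) inferInstance).congr fun n γ D => by omega

instance DefP.not [hP : DefP P] : DefP fun n γ D => ¬ P n γ D := by
  classical
  exact (DefP.ne_zero (F := fun n γ D => if P n γ D then 0 else 1) inferInstance).congr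
    fun n γ D => by by_cases h : P n γ D <;> simp [h]

instance DefP.and [hP : DefP P] [hQ : DefP Q] : DefP fun n γ D => P n γ D ∧ Q n γ D := by
  classical
  exact (DefP.ne_zero (F := fun n γ D => if P n γ D then (if Q n γ D then 1 else 0) else 0)
    inferInstance).congr fun n γ D => by
      by_cases h : P n γ D <;> by_cases h' : Q n γ D <;> simp [h, h']

instance DefP.or [hP : DefP P] [hQ : DefP Q] : DefP fun n γ D => P n γ D ∨ Q n γ D := by
  classical
  exact (DefP.ne_zero (F := fun n γ D => if P n γ D then 1 else (if Q n γ D then 1 else 0))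
    inferInstance).congr fun n γ D => by
      by_cases h : P n γ D <;> by_cases h' : Q n γ D <;> simp [h, h']

instance DefP.imp [hP : DefP P] [hQ : DefP Q] : DefP fun n γ D => (P n γ D → Q n γ D) :=
  (inferInstance : DefP fun n γ D => ¬ P n γ D ∨ Q n γ D).congr fun _ _ _ => by tauto

instance DefP.iff [hP : DefP P] [hQ : DefP Q] : DefP fun n γ D => (P n γ D ↔ Q n γ D) :=
  (inferInstance : DefP fun n γ D => (P n γ D → Q n γ D) ∧ (Q n γ D → P n γ D)).congr
    fun _ _ _ => by tauto

instance DefP.le [Def F] [Def G] : DefP fun n γ D => F n γ D ≤ G n γ D :=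
  (inferInstance : DefP fun n γ D => ¬ G n γ D < F n γ D).congr fun _ _ _ => by omega

instance DefP.eq [Def F] [Def G] : DefP fun n γ D => F n γ D = G n γ D :=
  (inferInstance : DefP fun n γ D => F n γ D ≤ G n γ D ∧ G n γ D ≤ F n γ D).congr
    fun _ _ _ => by omega

instance DefP.ne [Def F] [Def G] : DefP fun n γ D => F n γ D ≠ G n γ D :=
  (inferInstance : DefP fun n γ D => ¬ F n γ D = G n γ D)

instance DefP.varEq [IsVar x] [IsVar y] : DefP fun n γ _ => x n γ = y n γ :=
  (inferInstance : DefP fun n γ _ => (x n γ : ℕ) = y n γ).congr fun _ _ _ => by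
    rw [Fin.ext_iff]

instance DefP.varNe [IsVar x] [IsVar y] : DefP fun n γ _ => x n γ ≠ y n γ :=
  (inferInstance : DefP fun n γ _ => ¬ x n γ = y n γ)

instance DefP.varLe [IsVar x] [IsVar y] : DefP fun n γ _ => x n γ ≤ y n γ :=
  (inferInstance : DefP fun n γ _ => (x n γ : ℕ) ≤ y n γ)

instance DefP.varLt [IsVar x] [IsVar y] : DefP fun n γ _ => x n γ < y n γ :=
  (inferInstance : DefP fun n γ _ => (x n γ : ℕ) < y n γ)

/-- A quantifier over the vertices is a sum of indicators tested for being nonzero, so `Def.sum` is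
the only loop that predicates need. -/
instance DefP.exists {P : ∀ n, Ctx m n → Fin n → Data n → Prop}
    [DefP (m := m + 1) fun n γ D => P n γ.1 γ.2 D] :
    DefP fun n γ D => ∃ i : Fin n, P n γ i D := by
  classical
  have : Def (m := m + 1) fun n γ D => if P n γ.1 γ.2 D then 1 else 0 := inferInstance
  exact (DefP.ne_zero (Def.sum (F := fun n γ i D => if P n γ i D then 1 else 0))).congr
    fun n γ D => by simp

instance DefP.forall {P : ∀ n, Ctx m n → Fin n → Data n → Prop}
    [DefP (m := m + 1) fun n γ D => P n γ.1 γ.2 D] :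
    DefP fun n γ D => ∀ i : Fin n, P n γ i D :=
  (inferInstance : DefP fun n γ D => ¬ ∃ i : Fin n, ¬ P n γ i D).congr fun n γ D => by
    simp

end HGI

namespace HGI

/-! ### Operations on the data -/

theorem addr_inj {n : ℕ} {i j i' j' : Fin n} (h : (i * n + j : ℕ) = i' * n + j') :
    i = i' ∧ j = j' := by
  have hn : 0 < n := i.pos
  have h1 := congrArg (· / n) h
  have h2 := congrArg (· % n) h
  simp only [Nat.mul_add_mod', Nat.mod_eq_of_lt j.2, Nat.mod_eq_of_lt j'.2] at h2
  simp only [mul_comm _ n, Nat.mul_add_div hn, Nat.div_eq_of_lt j.2, Nat.div_eq_of_lt j'.2,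
    add_zero] at h1
  exact ⟨Fin.ext h1, Fin.ext h2⟩

theorem Rep.setReg {n : ℕ} {D : Data n} {s : State} (h : Rep D s) {x v : ℕ} (hx : x % 3 ≠ 0) :
    Rep D (s.setReg x v) :=
  h.frame (m := 0) (t := 0) ((Frame.refl 0 0 s).setReg (by omega))

theorem CRep.setReg {n m : ℕ} {γ : Ctx m n} {s : State} (h : CRep γ s) {x v : ℕ}
    (hx : x % 3 ≠ 1 ∨ m ≤ x / 3) : CRep γ (s.setReg x v) := fun l hl => by
  have : 3 * l + 1 ≠ x := by omega
  simp [State.setReg, Function.update_of_ne this, h l hl]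

theorem Rep.setMem_three {n : ℕ} {D : Data n} {s : State} (h : Rep D s) (i v : ℕ) :
    Rep D (s.setMem 3 i v) where
  size := h.size
  row i := by simpa [State.setMem] using h.row i
  sc := h.sc
  ar a i j := by simpa [State.setMem, bank_ne_three] using h.ar a i j

theorem setMem_addr {n : ℕ} (s : State) (a v : ℕ) (i j i' j' : Fin n) :
    (s.setMem a (i * n + j) v).mem a (i' * n + j') =
      if i' = i ∧ j' = j then v else s.mem a (i' * n + j') := by
  by_cases h : (i' * n + j' : ℕ) = i * n + j
  · simp [State.setMem, addr_inj h]
  · have : ¬ (i' = i ∧ j' = j) := by rintro ⟨rfl, rfl⟩; exact h rfl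
    simp [State.setMem, h, this]

theorem Rep.setScalar {n : ℕ} {D : Data n} {s : State} (h : Rep D s) (i v : ℕ) :
    Rep (D.setSc i v) (s.setReg (3 * i + 3) v) where
  size := by simpa [State.setReg] using h.size
  row := h.row
  sc j := by
    by_cases hj : j = i
    · simp [State.setReg, Data.setSc, hj]
    · have : 3 * j + 3 ≠ 3 * i + 3 := by omega
      simp only [State.setReg, Data.setSc, Function.update_of_ne this, Function.update_of_ne hj,
        h.sc]
  ar := h.ar

/-- A loop over the values of variable number `m`. -/
def forP (m : ℕ) (P : Program) : Program :=
  .seq (.assign (3 * m + 1) (.const 0)) (.loop (.sub (.reg 0) (.reg (3 * m + 1)))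
    (.seq P (.assign (3 * m + 1) (.add (.reg (3 * m + 1)) (.const 1)))))

/-- The 2 pays for the initial assignment, 4 for the increment and `3 + 1` for the test. The
invariant must not depend on the register of the loop variable, which changes between rounds. -/
theorem Runs.forP {m n T : ℕ} {P : Program} (I : ℕ → State → Prop)
    (hsize : ∀ j s, I j s → s.reg 0 = n)
    (hset : ∀ j s v, I j s → I j (s.setReg (3 * m + 1) v))
    (hbody : ∀ (j : Fin n) s, I j s → s.reg (3 * m + 1) = j →
      Runs P s T fun s' => I (j + 1) s' ∧ s'.reg (3 * m + 1) = j)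
    {s : State} (h0 : I 0 s) : Runs (forP m P) s (2 + (n + 1) * (T + 4 + 3 + 1)) (I n) := by
  refine Runs.seq (Runs.assign ?_)
  refine (Runs.loop (N := n) (T := T + 4) (fun j s' => I j s' ∧ s'.reg (3 * m + 1) = j)
    ?_ ?_ ?_).mono le_rfl fun _ h => h.1
  · rintro j s' ⟨h₁, h₂⟩
    simp only [Expr.eval, h₂, hsize _ _ h₁]
    omega
  · rintro j s' hj ⟨h₁, h₂⟩
    refine Runs.seq ((hbody ⟨j, hj⟩ s' h₁ h₂).mono le_rfl ?_)
    rintro s'' ⟨h₃, h₄⟩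
    exact Runs.assign ⟨hset _ _ _ h₃, by simp [State.setReg, Expr.eval, h₄]⟩
  · exact ⟨hset _ _ _ h0, by simp [State.setReg, Expr.eval]⟩

/-- The operation `f` is performed by a program within time `T`. -/
def Timed {m : ℕ} (f : ∀ n, Ctx m n → Data n → Data n) (T : ∀ n, Ctx m n → Data n → ℕ) : Prop :=
  ∃ P, ∀ n (γ : Ctx m n) (D : Data n) s, Rep D s → CRep γ s →
    Runs P s (T n γ D) fun s' => Rep (f n γ D) s' ∧ CRep γ s'

/-- The operation `f` is performed by a program in polynomial time. -/
class Poly {m : ℕ} (f : ∀ n, Ctx m n → Data n → Data n) : Prop where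
  out : ∃ τ : ℕ → ℕ, PolyBdd τ ∧ Timed f fun n _ _ => τ n

theorem Timed.andThen {m : ℕ} {f g : ∀ n, Ctx m n → Data n → Data n}
    {T U : ∀ n, Ctx m n → Data n → ℕ} (hf : Timed f T) (hg : Timed g U) :
    Timed (fun n γ D => andThen (f n γ) (g n γ) D)
      fun n γ D => T n γ D + U n γ (f n γ D) := by
  obtain ⟨P, hP⟩ := hf
  obtain ⟨P', hP'⟩ := hg
  refine ⟨.seq P P', fun n γ D s hD hγ => Runs.seq ((hP n γ D s hD hγ).mono le_rfl ?_)⟩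
  rintro s' ⟨h₁, h₂⟩
  exact hP' n γ _ s' h₁ h₂

/-- The data before round `j` of `forV f`. -/
def forPrefix {n : ℕ} (f : Fin n → Data n → Data n) (D : Data n) (j : ℕ) : Data n :=
  ((List.finRange n).take j).foldl (fun D i => f i D) D

theorem forPrefix_succ {n : ℕ} (f : Fin n → Data n → Data n) (D : Data n) (j : Fin n) :
    forPrefix f D (j + 1) = f j (forPrefix f D j) := by
  unfold forPrefix
  rw [List.take_add_one, List.foldl_append]
  simp

theorem forPrefix_last {n : ℕ} (f : Fin n → Data n → Data n) (D : Data n) :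
    forPrefix f D n = forV f D := by
  unfold forPrefix forV
  rw [List.take_of_length_le (by simp)]

/-- The bound `B` is required only for the data that really occur during the run. This matters for
the loop over components, whose time depends on the budget left. -/
theorem Timed.forV {m : ℕ} {f : ∀ n, Ctx m n → Fin n → Data n → Data n}
    {T : ∀ n, Ctx (m + 1) n → Data n → ℕ}
    (hf : Timed (m := m + 1) (fun n γ D => f n γ.1 γ.2 D) T)
    {B : ∀ n, Ctx m n → Data n → ℕ}
    (hB : ∀ n γ D (j : Fin n), T n (γ, j) (forPrefix (f n γ) D j) ≤ B n γ D) :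
    Timed (fun n γ D => forV (f n γ) D)
      fun n γ D => 2 + (n + 1) * (B n γ D + 4 + 3 + 1) := by
  obtain ⟨P, hP⟩ := hf
  refine ⟨forP m P, fun n γ D s hD hγ => ?_⟩
  refine (Runs.forP (fun j s' => Rep (forPrefix (f n γ) D j) s' ∧ CRep γ s') ?_ ?_ ?_ ?_).mono
    le_rfl ?_
  · exact fun j s' h => h.1.size
  · exact fun j s' v h => ⟨h.1.setReg (by omega), h.2.setReg (by omega)⟩
  · rintro j s' ⟨h₁, h₂⟩ h₃
    refine (hP n (γ, j) _ s' h₁ (h₂.cons h₃)).mono (hB n γ D j) ?_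
    rintro s'' ⟨h₄, h₅⟩
    exact ⟨⟨by rwa [forPrefix_succ], h₅.tail⟩, h₅.head⟩
  · exact ⟨hD, hγ⟩
  · rintro s' ⟨h₁, h₂⟩
    refine ⟨?_, h₂⟩
    change Rep (HGI.forV (f n γ) D) s'
    rwa [← forPrefix_last]

/-- Do `f` as many times as scalar `l` says, with scalar `z` as the counter. -/
def whileLt {n : ℕ} (z l : ℕ) (f : Data n → Data n) (D : Data n) : Data n :=
  (List.range (D.sc l)).foldl (fun D' j => (f D').setSc z (j + 1)) (D.setSc z 0)

theorem whileLt_induction {n : ℕ} {z l : ℕ} {f : Data n → Data n} {D : Data n}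
    (I : ℕ → Data n → Prop) (h0 : I 0 (D.setSc z 0))
    (hs : ∀ j D', I j D' → j < D.sc l → I (j + 1) ((f D').setSc z (j + 1))) :
    I (D.sc l) (whileLt z l f D) := by
  unfold whileLt
  have : ∀ N ≤ D.sc l, I N
      ((List.range N).foldl (fun D' j => (f D').setSc z (j + 1)) (D.setSc z 0)) := by
    intro N
    induction N with
    | zero => exact fun _ => h0
    | succ N ih =>
      intro hN
      rw [List.range_succ, List.foldl_append]
      exact hs _ _ (ih (by omega)) hN
  exact this _ le_rfl

/-- Since the body leaves the counter and the limit alone, the number of rounds is the initial value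
of scalar `l`. Here a value of the data enters the time, which yields the exponential factor. -/
theorem Timed.whileLt {m z l : ℕ} (hzl : l ≠ z) {f : ∀ n, Ctx m n → Data n → Data n} {τ : ℕ → ℕ}
    (hf : Timed f fun n _ _ => τ n) (hz : ∀ n γ D, (f n γ D).sc z = D.sc z)
    (hl : ∀ n γ D, (f n γ D).sc l = D.sc l) :
    Timed (fun n γ D => whileLt z l (f n γ) D)
      fun n _ D => 2 + (D.sc l + 1) * (τ n + 4 + 3 + 1) := by
  obtain ⟨P, hP⟩ := hf
  refine ⟨.seq (.assign (3 * z + 3) (.const 0)) (.loop (.sub (.reg (3 * l + 3))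
    (.reg (3 * z + 3))) (.seq P (.assign (3 * z + 3) (.add (.reg (3 * z + 3)) (.const 1))))),
    fun n γ D s hD hγ => ?_⟩
  refine Runs.seq (Runs.assign ?_)
  have step : ∀ N ≤ D.sc l, ∃ D' : Data n, D' =
      ((List.range N).foldl (fun D' j => (f n γ D').setSc z (j + 1)) (D.setSc z 0)) ∧
      D'.sc z = N ∧ D'.sc l = D.sc l := by
    intro N hN
    refine ⟨_, rfl, ?_⟩
    induction N with
    | zero => simp [Data.setSc, hzl]
    | succ N ih =>
      rw [List.range_succ, List.foldl_append]
      simp only [List.foldl_cons, List.foldl_nil]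
      refine ⟨by simp [Data.setSc], ?_⟩
      rw [Data.setSc]
      simp only [Function.update_of_ne hzl]
      rw [hl, (ih (by omega)).2]
  refine (Runs.loop (N := D.sc l) (T := τ n + 4) (fun j s' => j ≤ D.sc l ∧ Rep
    ((List.range j).foldl (fun D' j => (f n γ D').setSc z (j + 1)) (D.setSc z 0)) s' ∧
      CRep γ s') ?_ ?_ ?_).mono le_rfl fun _ h => h.2
  · rintro j s' ⟨h₀, h₁, -⟩
    obtain ⟨D', hD', h₂, h₃⟩ := step j h₀
    rw [← hD'] at h₁
    simp only [Expr.eval, h₁.sc, h₂, h₃]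
    omega
  · rintro j s' hj ⟨h₀, h₁, h₂⟩
    obtain ⟨D', hD', h₃, h₄⟩ := step j h₀
    rw [← hD'] at h₁
    refine Runs.seq ((hP n γ _ s' h₁ h₂).mono le_rfl ?_)
    rintro s'' ⟨h₅, h₆⟩
    refine Runs.assign ⟨hj, ?_, h₆.setReg (by omega)⟩
    rw [List.range_succ, List.foldl_append]
    simp only [List.foldl_cons, List.foldl_nil, ← hD', Expr.eval, h₅.sc, hz, h₃]
    exact h₅.setScalar _ _
  · exact ⟨Nat.zero_le _, hD.setScalar z 0, hγ.setReg (by omega)⟩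

variable {m : ℕ}

instance Poly.andThen {f g : ∀ n, Ctx m n → Data n → Data n} [hf : Poly f] [hg : Poly g] :
    Poly fun n γ D => andThen (f n γ) (g n γ) D := by
  obtain ⟨τ, hτ, hf⟩ := hf.out
  obtain ⟨σ, hσ, hg⟩ := hg.out
  exact ⟨_, hτ.add hσ, hf.andThen hg⟩

instance Poly.forV {f : ∀ n, Ctx m n → Fin n → Data n → Data n}
    [hf : Poly (m := m + 1) fun n γ D => f n γ.1 γ.2 D] :
    Poly fun n γ D => forV (f n γ) D := by
  obtain ⟨τ, hτ, hf⟩ := hf.out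
  refine ⟨_, ?_, Timed.forV (B := fun n _ _ => τ n) hf fun _ _ _ _ => le_rfl⟩
  exact (PolyBdd.const _).add ((PolyBdd.id.add (.const _)).mul
    (((hτ.add (.const _)).add (.const _)).add (.const _)))

instance Poly.setSc {F : ∀ n, Ctx m n → Data n → ℕ} (i : ℕ) [hF : Def F] :
    Poly fun n γ D => D.setSc i (F n γ D) := by
  obtain ⟨c, τ, hτ, hF⟩ := hF.out
  refine ⟨fun n => τ n + 2, hτ.add (.const _), .seq (c 0) (.assign (3 * i + 3) (.reg 2)),
    fun n γ D s hD hγ => Runs.seq ((hF 0 n γ D s hD hγ).mono le_rfl ?_)⟩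
  rintro s' ⟨h₁, h₂⟩
  refine Runs.assign ⟨?_, (hγ.frame h₂).setReg (by omega)⟩
  rw [Expr.eval, show s'.reg 2 = F n γ D from h₁]
  exact (hD.frame h₂).setScalar _ _

instance Poly.ite {P : ∀ n, Ctx m n → Data n → Prop} {f g : ∀ n, Ctx m n → Data n → Data n}
    [hP : DefP P] [hf : Poly f] [hg : Poly g] {inst : ∀ n γ D, Decidable (P n γ D)} :
    Poly fun n γ D => @_root_.ite (Data n) (P n γ D) (inst n γ D) (f n γ D) (g n γ D) := by
  obtain ⟨c, τ, hτ, hP⟩ := hP.out.out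
  obtain ⟨σ, hσ, Pf, hf⟩ := hf.out
  obtain ⟨ρ, hρ, Pg, hg⟩ := hg.out
  refine ⟨fun n => τ n + (1 + 1 + (σ n + ρ n)), hτ.add ((PolyBdd.const _).add (hσ.add hρ)),
    .seq (c 0) (.ite (.reg 2) Pf Pg),
    fun n γ D s hD hγ => Runs.seq ((hP 0 n γ D s hD hγ).mono le_rfl ?_)⟩
  rintro s' ⟨h₁, h₂⟩
  simp only [show 3 * 0 + 2 = 2 from rfl] at h₁
  refine Runs.ite (fun he => ?_) fun he => ?_
  · have : P n γ D := by simpa [Expr.eval, h₁] using he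
    simpa [this] using hf n γ D s' (hD.frame h₂) (hγ.frame h₂)
  · have : ¬ P n γ D := by simpa [Expr.eval, h₁] using he
    simpa [this] using hg n γ D s' (hD.frame h₂) (hγ.frame h₂)

/-- There is no empty program, so a temporary register is overwritten instead. -/
instance Poly.id : Poly fun n (_ : Ctx m n) D => D :=
  ⟨fun _ => 1 + 1, .const _, .assign 2 (.const 0), fun _ _ _ _ hD hγ =>
    Runs.assign ⟨hD.setReg (by omega), hγ.setReg (by omega)⟩⟩

/-- The address of the entry given by variables number `m` and `m + 1`. -/
def cell (m : ℕ) : Expr := .add (.read 2 (.reg (3 * m + 1))) (.reg (3 * (m + 1) + 1))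

theorem eval_cell {n : ℕ} {D : Data n} {s : State} (hD : Rep D s) {γ : Ctx m n} {u v : Fin n}
    (h : CRep (m := m + 1) (γ, u) s) (hv : s.reg (3 * (m + 1) + 1) = v) :
    (cell m).eval s = u * n + v := by
  simp [cell, Expr.eval, h.head, hD.row, hv]

theorem eval_cell' {n : ℕ} {D : Data n} {s : State} (hD : Rep D s) {γ : Ctx m n} {u v : Fin n}
    (h : CRep (m := m + 1 + 1) ((γ, u), v) s) : (cell m).eval s = u * n + v :=
  eval_cell hD h.tail h.head

theorem Rep.setCell {n : ℕ} {D : Data n} {s : State} (h : Rep D s) (a v : ℕ) (i j : Fin n) :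
    Rep (D.setAr a fun i' j' => if i' = i ∧ j' = j then v else D.ar a i' j')
      (s.setMem (bank a) (i * n + j) v) where
  size := h.size
  row i := by
    simpa [State.setMem, Function.update_of_ne (bank_ne_two a).symm] using h.row i
  sc := h.sc
  ar b i' j' := by
    by_cases hb : b = a
    · subst hb
      rw [setMem_addr, h.ar]
      simp [Data.setAr]
    · have : bank b ≠ bank a := fun h => hb (bank_inj h)
      simp only [State.setMem, Data.setAr, Function.update_of_ne this, Function.update_of_ne hb,
        h.ar]

theorem Data.setAr_setAr {n : ℕ} (D : Data n) (a : ℕ) (F G : Fin n → Fin n → ℕ) :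
    (D.setAr a F).setAr a G = D.setAr a G := by
  simp [Data.setAr]

theorem Data.setAr_self {n : ℕ} (D : Data n) (a : ℕ) : D.setAr a (D.ar a) = D := by
  simp [Data.setAr]

/-- Fill memory bank 3 with the values of an expression. -/
theorem runs_fill {F : ∀ n, Ctx m n → Fin n → Fin n → Data n → ℕ}
    (hF : Def (m := m + 1 + 1) fun n γ D => F n γ.1.1 γ.1.2 γ.2 D) :
    ∃ P τ, PolyBdd τ ∧ ∀ n (γ : Ctx m n) (D : Data n) s, Rep D s → CRep γ s →
      Runs P s (τ n) fun s' => Rep D s' ∧ CRep γ s' ∧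
        ∀ i j : Fin n, s'.mem 3 (i * n + j) = F n γ i j D := by
  obtain ⟨c, τ, hτ, hF⟩ := hF.out
  refine ⟨HGI.forP m (HGI.forP (m + 1) (.seq (c 0) (.write 3 (cell m) (.reg 2)))),
    fun n => 2 + (n + 1) * (2 + (n + 1) * (τ n + 6 + 4 + 3 + 1) + 4 + 3 + 1), ?_, ?_⟩
  · have hn : PolyBdd fun n => n + 1 := PolyBdd.id.add (.const _)
    exact (PolyBdd.const _).add (hn.mul (((((PolyBdd.const _).add (hn.mul ((((hτ.add
      (.const _)).add (.const _)).add (.const _)).add (.const _)))).add (.const _)).add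
      (.const _)).add (.const _)))
  intro n γ D s hD hγ
  refine (Runs.forP (fun k s' => Rep D s' ∧ CRep γ s' ∧
    ∀ i j : Fin n, i < k → s'.mem 3 (i * n + j) = F n γ i j D) ?_ ?_ ?_ ?_).mono le_rfl ?_
  · exact fun _ _ h => h.1.size
  · exact fun _ _ _ h => ⟨h.1.setReg (by omega), h.2.1.setReg (by omega), h.2.2⟩
  · rintro u s₁ ⟨h₁, h₂, h₃⟩ hu
    refine (Runs.forP (fun k s' => Rep D s' ∧ CRep (m := m + 1) (γ, u) s' ∧
      ∀ i j : Fin n, i < u ∨ i = u ∧ j < k → s'.mem 3 (i * n + j) = F n γ i j D)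
      ?_ ?_ ?_ ?_).mono le_rfl ?_
    · exact fun _ _ h => h.1.size
    · exact fun _ _ _ h => ⟨h.1.setReg (by omega), h.2.1.setReg (by omega), h.2.2⟩
    · rintro v s₂ ⟨g₁, g₂, g₃⟩ hv
      refine Runs.seq ((hF 0 n ((γ, u), v) D s₂ g₁ (g₂.cons hv)).mono le_rfl ?_)
      rintro s₃ ⟨f₁, f₂⟩
      have hv' : s₃.reg (3 * (m + 1) + 1) = v := by rw [f₂.2 _ (by omega), hv]
      have hR := g₁.frame f₂
      have hC := (g₂.cons hv).frame f₂
      refine Runs.write ⟨⟨hR.setMem_three _ _, hC.tail, ?_⟩, hv'⟩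
      intro i j hij
      rw [eval_cell' hR hC, setMem_addr]
      simp only [Expr.eval, show 3 * 0 + 2 = 2 from rfl] at f₁ ⊢
      split_ifs with h
      · rw [f₁, h.1, h.2]
      · rw [f₂.1]
        refine g₃ i j ?_
        simp only [Fin.lt_def, Fin.ext_iff] at hij h ⊢
        omega
    · refine ⟨h₁, h₂.cons hu, fun i j hij => h₃ i j ?_⟩
      simpa using hij
    · rintro s₂ ⟨g₁, g₂, g₃⟩
      refine ⟨⟨g₁, g₂.tail, fun i j hij => g₃ i j ?_⟩, g₂.head⟩
      have := j.2
      simp only [Fin.lt_def, Fin.ext_iff] at hij ⊢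
      omega
  · exact ⟨hD, hγ, fun i j hij => absurd hij (by omega)⟩
  · exact fun s' h => ⟨h.1, h.2.1, fun i j => h.2.2 i j i.2⟩

/-- Copy memory bank 3 to array `a`. -/
theorem runs_copy (m a : ℕ) :
    ∃ P τ, PolyBdd τ ∧ ∀ n (γ : Ctx m n) (D : Data n) s (F : Fin n → Fin n → ℕ), Rep D s →
      CRep γ s → (∀ i j : Fin n, s.mem 3 (i * n + j) = F i j) →
      Runs P s (τ n) fun s' => Rep (D.setAr a F) s' ∧ CRep γ s' := by
  refine ⟨HGI.forP m (HGI.forP (m + 1) (.write (bank a) (cell m) (.read 3 (cell m)))),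
    fun n => 2 + (n + 1) * (2 + (n + 1) * (10 + 4 + 3 + 1) + 4 + 3 + 1), ?_, ?_⟩
  · have hn : PolyBdd fun n => n + 1 := PolyBdd.id.add (.const _)
    exact (PolyBdd.const _).add (hn.mul (((((PolyBdd.const _).add (hn.mul (.const _))).add
      (.const _)).add (.const _)).add (.const _)))
  intro n γ D s F hD hγ hs
  refine (Runs.forP (fun k s' => Rep (D.setAr a fun i j => if i < k then F i j else D.ar a i j) s' ∧
    CRep γ s' ∧ ∀ i j : Fin n, s'.mem 3 (i * n + j) = F i j) ?_ ?_ ?_ ?_).mono le_rfl ?_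
  · exact fun _ _ h => h.1.size
  · exact fun _ _ _ h => ⟨h.1.setReg (by omega), h.2.1.setReg (by omega), h.2.2⟩
  · rintro u s₁ ⟨h₁, h₂, h₃⟩ hu
    refine (Runs.forP (fun k s' => Rep (D.setAr a fun i j =>
      if i < u ∨ i = u ∧ j < k then F i j else D.ar a i j) s' ∧ CRep (m := m + 1) (γ, u) s' ∧
      ∀ i j : Fin n, s'.mem 3 (i * n + j) = F i j) ?_ ?_ ?_ ?_).mono le_rfl ?_
    · exact fun _ _ h => h.1.size
    · exact fun _ _ _ h => ⟨h.1.setReg (by omega), h.2.1.setReg (by omega), h.2.2⟩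
    · rintro v s₂ ⟨g₁, g₂, g₃⟩ hv
      refine Runs.write ⟨⟨?_, g₂, ?_⟩, hv⟩
      · rw [Expr.eval, eval_cell g₁ g₂ hv, g₃]
        convert g₁.setCell a (F u v) u v using 1
        rw [Data.setAr_setAr]
        congr 1
        funext i j
        simp only [Data.setAr, Function.update_self, Fin.lt_def, Fin.ext_iff]
        split_ifs with c₁ c₂ c₃ c₄ c₅ <;> first | rfl | omega | skip
        all_goals simp only [← Fin.ext_iff] at *
        obtain ⟨rfl, rfl⟩ := c₂
        rfl
      · intro i j
        rw [← g₃ i j]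
        simp [State.setMem, (bank_ne_three a).symm]
    · refine ⟨?_, h₂.cons hu, h₃⟩
      simpa using h₁
    · rintro s₂ ⟨g₁, g₂, g₃⟩
      refine ⟨⟨?_, g₂.tail, g₃⟩, g₂.head⟩
      convert g₁ using 5 with i j
      have := j.2
      simp only [Fin.lt_def, Fin.ext_iff]
      omega
  · simpa [Data.setAr_self] using ⟨hD, hγ, hs⟩
  · rintro s' ⟨h₁, h₂, -⟩
    exact ⟨by simpa using h₁, h₂⟩

/-- New entries may depend on the old contents of the same array. They are therefore collected in
the buffer first and copied only when all are known. -/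
instance Poly.setAr {F : ∀ n, Ctx m n → Fin n → Fin n → Data n → ℕ} (a : ℕ)
    [hF : Def (m := m + 1 + 1) fun n γ D => F n γ.1.1 γ.1.2 γ.2 D] :
    Poly fun n γ D => D.setAr a fun i j => F n γ i j D := by
  obtain ⟨P, τ, hτ, hP⟩ := runs_fill hF
  obtain ⟨P', σ, hσ, hP'⟩ := runs_copy m a
  refine ⟨_, hτ.add hσ, .seq P P',
    fun n γ D s hD hγ => Runs.seq ((hP n γ D s hD hγ).mono le_rfl ?_)⟩
  rintro s' ⟨h₁, h₂, h₃⟩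
  exact hP' n γ D s' _ h₁ h₂ h₃

/-! ### Start of the computation -/

/-- The data that represent an input. -/
noncomputable def inputData (I : HGIInstance) : Data I.n where
  sc i := if i = 0 then I.k else 0
  ar a i j := if a = 0 then matrixOf I.G.Adj (i * I.n + j)
    else if a = 1 then matrixOf (fun u v => s(u, v) ∈ I.T) (i * I.n + j) else 0

open Classical in
theorem matrixOf_apply {n : ℕ} (r : Fin n → Fin n → Prop) (i j : Fin n) :
    matrixOf r (i * n + j) = if r i j then 1 else 0 := by
  unfold matrixOf
  congr 1
  refine propext ⟨?_, fun h => ⟨i, j, rfl, h⟩⟩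
  rintro ⟨i', j', h, hr⟩
  obtain ⟨rfl, rfl⟩ := addr_inj h
  exact hr

/-- Without multiplication, the row offsets are produced by adding `n` repeatedly. The budget leaves
register 1, which is needed as a loop variable. -/
theorem runs_init : ∃ P τ, PolyBdd τ ∧ ∀ I : HGIInstance,
    Runs P I.input (τ I.n) fun s' => Rep (inputData I) s' := by
  refine ⟨.seq (.assign 3 (.reg 1)) (.seq (.assign 2 (.const 0)) (HGI.forP 0
    (.seq (.write 2 (.reg 1) (.reg 2)) (.assign 2 (.add (.reg 2) (.reg 0)))))),
    fun n => 2 + (2 + (2 + (n + 1) * (3 + 4 + 4 + 3 + 1))), ?_, ?_⟩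
  · exact (PolyBdd.const _).add ((PolyBdd.const _).add ((PolyBdd.const _).add
      ((PolyBdd.id.add (.const _)).mul (.const _))))
  intro I
  refine Runs.seq (Runs.assign (Runs.seq (Runs.assign ?_)))
  refine (Runs.forP (T := 3 + 4) (n := I.n) (fun k s' => s'.reg 2 = k * I.n ∧
    (∀ i < k, s'.mem 2 i = i * I.n) ∧ s'.reg 0 = I.n ∧
    (∀ i, s'.reg (3 * i + 3) = (inputData I).sc i) ∧
    ∀ a ≠ 2, s'.mem a = I.input.mem a) ?_ ?_ ?_ ?_).mono le_rfl ?_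
  · exact fun _ _ h => h.2.2.1
  · rintro j s v ⟨h₁, h₂, h₃, h₄, h₅⟩
    refine ⟨by simpa [State.setReg] using h₁, h₂, by simpa [State.setReg] using h₃, ?_, h₅⟩
    intro i
    have : 3 * i + 3 ≠ 3 * 0 + 1 := by omega
    simpa [State.setReg] using h₄ i
  · rintro j s ⟨h₁, h₂, h₃, h₄, h₅⟩ hj
    simp only [mul_zero, zero_add] at hj
    refine Runs.seq (Runs.write (Runs.assign ⟨⟨?_, ?_, ?_, ?_, ?_⟩, ?_⟩))
    · simp [State.setReg, State.setMem, Expr.eval, h₁, h₃, add_mul]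
    · intro i hi
      by_cases hij : i = j
      · simp [State.setReg, State.setMem, Expr.eval, h₁, hj, hij]
      · simp [State.setReg, State.setMem, Expr.eval, hj, hij, h₂ i (by omega)]
    · simpa [State.setReg, State.setMem] using h₃
    · intro i
      simpa [State.setReg, State.setMem] using h₄ i
    · intro a ha
      simpa [State.setReg, State.setMem, ha] using h₅ a ha
    · simpa [State.setReg, State.setMem] using hj
  · refine ⟨by simp [State.setReg, Expr.eval], by simp, by simp [State.setReg, HGIInstance.input],
      ?_, fun a _ => rfl⟩
    intro i
    rcases i with _ | i <;> simp [State.setReg, HGIInstance.input, inputData, Expr.eval]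
  · rintro s ⟨-, h₂, h₃, h₄, h₅⟩
    refine ⟨h₃, fun i => h₂ i i.2, h₄, fun a i j => ?_⟩
    rw [h₅ _ (bank_ne_two a)]
    simp only [HGIInstance.input, inputData, bank]
    rcases a with _ | _ | a <;> simp

end HGI

namespace HGI

/-! ### The algorithm

Scalars: 0 is the remaining budget, 1 the number of guesses, 2 the guess, 3 its unread bits, 4 the
best solution size so far, 5 tells of a failure, 6 is the answer. Arrays: 0 is the adjacency
matrix, 1 the matrix of terminal pairs, 2 the distances, 3 the adjacency in the complement of the
components, 4 the distances there, 5 the relation of being in the same module, 6 a set that is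
closed to a module, 7 the guessed set of vertices in hit modules, 8 the guessed vertex cover, 9 and
10 the pairs still to be hit. Sets are stored on the diagonal. -/

section Predicates

variable {n : ℕ} (A T d sm X S H W : Fin n → Fin n → ℕ) (r u v : Fin n)

/-- The geodesic interval of `u` and `v` contains a vertex of a hit module other than theirs. -/
def Sat : Prop := ∃ x, X x x ≠ 0 ∧ d u x + d x v = d u v ∧ sm x u = 0 ∧ sm x v = 0

/-- The pair has to be hit in `u` or `v`. -/
def Hard : Prop :=
  T u v ≠ 0 ∧ d r u < n ∧ d r v < n ∧ (sm u v = 0 ∨ A u v ≠ 0 ∨ u = v) ∧ ¬ Sat d sm X u v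

/-- The pair has to be hit in the module that contains it. -/
def Soft : Prop :=
  T u v ≠ 0 ∧ d r u < n ∧ d r v < n ∧ sm u v ≠ 0 ∧ A u v = 0 ∧ u ≠ v ∧ ¬ Sat d sm X u v

/-- The vertex `u` is the least one of its module, in the component of `r`. -/
def IsRep : Prop := d r u < n ∧ ∀ w, sm w u ≠ 0 → u ≤ w

/-- The vertex `r` is the least one of its component. -/
def IsRoot : Prop := ∀ w, d r w < n → r ≤ w

/-- The set `S` does not meet the module of `u`. -/
def Misses : Prop := ∀ w, S w w ≠ 0 → sm w u = 0

/-- The set `S` contains neither `u` nor `v`, where `H u v`. -/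
def Unc : Prop := H u v ≠ 0 ∧ S u u = 0 ∧ S v v = 0

/-- The lexicographically first pair that is not covered. -/
def FirstUnc : Prop :=
  Unc S H u v ∧ ∀ u' v', Unc S H u' v' → u < u' ∨ u = u' ∧ v ≤ v'

/-- The cover `S` can be completed to a solution by one vertex in each module of `X` that it
misses. -/
def Valid : Prop :=
  (∀ u v, H u v ≠ 0 → S u u ≠ 0 ∨ S v v ≠ 0) ∧
  (∀ u v, W u v ≠ 0 → (∃ w, S w w ≠ 0 ∧ d u w + d w v = d u v) ∨ X u u ≠ 0 ∧ Misses sm S u) ∧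
  ∀ x, IsRep d sm r x → X x x ≠ 0 → Misses sm S x →
    ∃ s, sm s x ≠ 0 ∧ ∀ u v, W u v ≠ 0 → sm u x ≠ 0 → d u s + d s v = d u v

open Classical in
/-- The size of the solution that extends `S`. -/
noncomputable def solSize : ℕ :=
  (∑ a, if S a a ≠ 0 then 1 else 0) +
    ∑ x, if IsRep d sm r x ∧ X x x ≠ 0 ∧ Misses sm S x then 1 else 0

/-- The component of `u` is disconnected in the complement; `c` has the distances there. -/
def CoDisc (c : Fin n → Fin n → ℕ) : Prop := ∃ a, d u a < n ∧ ¬ c u a < n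

/-- The vertices `u` and `v` are in the same module: in a component with disconnected complement,
the vertices that are joined to the least one in the complement make up one of two modules. -/
def SameMod (c C : Fin n → Fin n → ℕ) : Prop :=
  d u v < n ∧ ((CoDisc d u c ∧ ∃ r, d r u < n ∧ IsRoot d r ∧ (c r u < n ↔ c r v < n)) ∨
    (¬ CoDisc d u c ∧ (u = v ∨ C u v ≠ 0)))

end Predicates

/-- The last binary digit. -/
def lastBit (w : ℕ) : ℕ := w - (w / 2 + w / 2)

/-! ### The stages of the algorithm as transformations of the data -/

section Steps

variable {n : ℕ}

open Classical in
/-- Compute the distances in the graph with adjacency matrix `src`. -/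
noncomputable def distStep (src dst : ℕ) (D : Data n) : Data n :=
  andThen (fun D => D.setAr dst fun u v => if u = v then 0 else n)
    (forV fun t D => D.setAr dst fun u v =>
      if D.ar dst u v = n ∧ ∃ w, D.ar dst u w = t ∧ D.ar src w v ≠ 0 then t + 1
      else D.ar dst u v) D

open Classical in
/-- Compute the smallest module that contains `u` and `v`, and record whether it is not the whole
component. -/
noncomputable def closureStep (u v : Fin n) (D : Data n) : Data n :=
  andThen (fun D => D.setAr 6 fun w _ => if w = u ∨ w = v then 1 else 0)
    (andThen (forV fun _ D => D.setAr 6 fun w _ => if D.ar 6 w w ≠ 0 ∨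
        (D.ar 2 u w < n ∧ ∃ a b, D.ar 6 a a ≠ 0 ∧ D.ar 6 b b ≠ 0 ∧ D.ar 0 a w ≠ 0 ∧
          D.ar 0 b w = 0) then 1 else 0)
      (fun D => D.setAr 5 fun a b => if a = u ∧ b = v then
        (if ∃ w, D.ar 2 u w < n ∧ D.ar 6 w w = 0 then 1 else 0) else D.ar 5 a b)) D

open Classical in
/-- Compute the distances and the modules. -/
noncomputable def prepStep (D : Data n) : Data n :=
  andThen (distStep 0 2) (andThen
    (fun D => D.setAr 3 fun u v => if D.ar 2 u v < n ∧ D.ar 0 u v = 0 ∧ u ≠ v then 1 else 0)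
    (andThen (distStep 3 4) (andThen (forV fun u => forV fun v => closureStep u v)
      (fun D => D.setAr 5 fun u v =>
        if SameMod (D.ar 2) u v (D.ar 4) (D.ar 5) then 1 else 0)))) D

open Classical in
/-- Read the guess of the modules that are hit. -/
noncomputable def guessX (r : Fin n) (D : Data n) : Data n :=
  andThen (forV fun v D => if IsRep (D.ar 2) (D.ar 5) r v then
      andThen (fun D => D.setAr 7 fun a _ => if a = v then lastBit (D.sc 3) else D.ar 7 a a)
        (fun D => D.setSc 3 (D.sc 3 / 2)) D
      else D.setAr 7 fun a _ => if a = v then 0 else D.ar 7 a a)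
    (fun D => D.setAr 7 fun a _ =>
      if ∃ x, IsRep (D.ar 2) (D.ar 5) r x ∧ D.ar 5 x a ≠ 0 ∧ D.ar 7 x x ≠ 0 then 1 else 0) D

open Classical in
/-- Read the guess of a vertex cover. -/
noncomputable def guessS (D : Data n) : Data n :=
  andThen (fun D => D.setAr 8 fun _ _ => 0)
    (forV fun v D => if (v : ℕ) < D.sc 0 then
      andThen (fun D => D.setAr 8 fun a _ => if D.ar 8 a a ≠ 0 ∨
          ∃ u v, FirstUnc (D.ar 8) (D.ar 9) u v ∧
            (lastBit (D.sc 3) ≠ 0 ∧ a = u ∨ lastBit (D.sc 3) = 0 ∧ a = v) then 1 else 0)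
        (fun D => D.setSc 3 (D.sc 3 / 2)) D
      else D) D

open Classical in
/-- Compute the pairs that still have to be hit. -/
noncomputable def pairStep (r : Fin n) (D : Data n) : Data n :=
  andThen (fun D => D.setAr 9 fun u v =>
      if Hard (D.ar 0) (D.ar 1) (D.ar 2) (D.ar 5) (D.ar 7) r u v then 1 else 0)
    (fun D => D.setAr 10 fun u v =>
      if Soft (D.ar 0) (D.ar 1) (D.ar 2) (D.ar 5) (D.ar 7) r u v then 1 else 0) D

open Classical in
/-- Try a guess in the component of `r`. -/
noncomputable def tryStep (r : Fin n) (D : Data n) : Data n :=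
  andThen (fun D => D.setSc 3 (D.sc 2)) (andThen (guessX r) (andThen (pairStep r) (andThen guessS
    (fun D => if Valid (D.ar 2) (D.ar 5) (D.ar 7) (D.ar 8) (D.ar 9) (D.ar 10) r ∧
        solSize (D.ar 2) (D.ar 5) (D.ar 7) (D.ar 8) r < D.sc 4 then
      D.setSc 4 (solSize (D.ar 2) (D.ar 5) (D.ar 7) (D.ar 8) r) else D)))) D

open Classical in
/-- Compute the number of guesses to be tried in the component of `r`. -/
noncomputable def countStep (r : Fin n) (D : Data n) : Data n :=
  andThen (fun D => D.setSc 4 (n + 1)) (andThen (fun D => D.setSc 1 1) (andThen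
    (forV fun v D => if IsRep (D.ar 2) (D.ar 5) r v then D.setSc 1 (D.sc 1 + D.sc 1) else D)
    (forV fun v D => if (v : ℕ) < D.sc 0 then D.setSc 1 (D.sc 1 + D.sc 1) else D))) D

open Classical in
/-- Pay for the component. -/
noncomputable def payStep (D : Data n) : Data n :=
  if D.sc 4 ≤ D.sc 0 then D.setSc 0 (D.sc 0 - D.sc 4) else D.setSc 5 1

open Classical in
/-- Skip the component of a vertex that is not its root: let there be no guesses, and nothing to
pay. -/
noncomputable def skipStep (r : Fin n) (D : Data n) : Data n :=
  if IsRoot (D.ar 2) r then countStep r D else andThen (fun D => D.setSc 1 0)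
    (fun D => D.setSc 4 0) D

/-- Solve the problem in the component of `r`, if `r` is its root. -/
noncomputable def compStep (r : Fin n) (D : Data n) : Data n :=
  andThen (skipStep r) (andThen (whileLt 2 1 (tryStep r)) payStep) D

open Classical in
/-- Compute the answer. -/
noncomputable def answerStep (D : Data n) : Data n :=
  D.setSc 6 (if D.sc 5 = 0 ∧ ∀ u v, D.ar 1 u v ≠ 0 → D.ar 2 u v < n then 1 else 0)

/-- The whole algorithm. -/
noncomputable def algorithm (D : Data n) : Data n :=
  andThen prepStep (andThen (forV compStep) answerStep) D

end Steps

/-! ### Polynomial running time of the predicates and stages -/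

section Instances

variable {m : ℕ} {x y z : ∀ n, Ctx m n → Fin n} [IsVar x] [IsVar y] [IsVar z] (a b c d e f : ℕ)

instance : DefP fun n γ D => Sat (D.ar a) (D.ar b) (D.ar c) (x n γ) (y n γ) := by
  unfold Sat; infer_instance

instance : DefP fun n γ D => Hard (D.ar a) (D.ar b) (D.ar c) (D.ar d) (D.ar e)
    (z n γ) (x n γ) (y n γ) := by
  unfold Hard; infer_instance

instance : DefP fun n γ D => Soft (D.ar a) (D.ar b) (D.ar c) (D.ar d) (D.ar e)
    (z n γ) (x n γ) (y n γ) := by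
  unfold Soft; infer_instance

instance : DefP fun n γ D => IsRep (D.ar a) (D.ar b) (x n γ) (y n γ) := by
  unfold IsRep; infer_instance

instance : DefP fun n γ D => IsRoot (D.ar a) (x n γ) := by
  unfold IsRoot; infer_instance

instance : DefP fun n γ D => Misses (D.ar a) (D.ar b) (x n γ) := by
  unfold Misses; infer_instance

instance : DefP fun n γ D => Unc (D.ar a) (D.ar b) (x n γ) (y n γ) := by
  unfold Unc; infer_instance

instance : DefP fun n γ D => FirstUnc (D.ar a) (D.ar b) (x n γ) (y n γ) := by
  unfold FirstUnc; infer_instance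

instance : DefP fun n γ D => Valid (D.ar a) (D.ar b) (D.ar c) (D.ar d) (D.ar e) (D.ar f)
    (x n γ) := by
  unfold Valid; infer_instance

instance : Def fun n γ D => solSize (D.ar a) (D.ar b) (D.ar c) (D.ar d) (x n γ) := by
  unfold solSize; infer_instance

instance : DefP fun n γ D => CoDisc (D.ar a) (x n γ) (D.ar b) := by
  unfold CoDisc; infer_instance

instance : DefP fun n γ D => SameMod (D.ar a) (x n γ) (y n γ) (D.ar b) (D.ar c) := by
  unfold SameMod; infer_instance

instance {F : ∀ n, Ctx m n → Data n → ℕ} [Def F] : Def fun n γ D => lastBit (F n γ D) := by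
  unfold lastBit; infer_instance

instance : Poly fun n (_ : Ctx m n) D => distStep a b D := by
  unfold distStep; infer_instance

instance : Poly fun n γ D => closureStep (x n γ) (y n γ) D := by
  unfold closureStep; infer_instance

instance : Poly fun n (_ : Ctx m n) D => prepStep D := by
  unfold prepStep; infer_instance

instance : Poly fun n γ D => guessX (x n γ) D := by
  unfold guessX; infer_instance

instance : Poly fun n (_ : Ctx m n) D => guessS D := by
  unfold guessS; infer_instance

instance : Poly fun n γ D => pairStep (x n γ) D := by
  unfold pairStep; infer_instance

instance : Poly fun n γ D => tryStep (x n γ) D := by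
  unfold tryStep; infer_instance

instance : Poly fun n γ D => countStep (x n γ) D := by
  unfold countStep; infer_instance

instance : Poly fun n (_ : Ctx m n) D => payStep D := by
  unfold payStep; infer_instance

instance : Poly fun n γ D => skipStep (x n γ) D := by
  unfold skipStep; infer_instance

instance : Poly fun n (_ : Ctx m n) D => answerStep D := by
  unfold answerStep; infer_instance

end Instances

end HGI

namespace HGI

/-! ### Invariants of loops over the vertices -/

theorem forPrefix_induction {n : ℕ} {f : Fin n → Data n → Data n} {D : Data n}
    (I : ℕ → Data n → Prop) (h0 : I 0 D) (hs : ∀ (j : Fin n) D', I j D' → I (j + 1) (f j D')) :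
    ∀ k ≤ n, I k (forPrefix f D k) := by
  intro k
  induction k with
  | zero => exact fun _ => h0
  | succ k ih =>
    intro hk
    have := hs ⟨k, hk⟩ _ (ih (by omega))
    rwa [← forPrefix_succ f D ⟨k, hk⟩] at this

theorem forV_induction {n : ℕ} {f : Fin n → Data n → Data n} {D : Data n}
    (I : ℕ → Data n → Prop) (h0 : I 0 D) (hs : ∀ (j : Fin n) D', I j D' → I (j + 1) (f j D')) :
    I n (forV f D) := by
  rw [← forPrefix_last]
  exact forPrefix_induction I h0 hs n le_rfl

@[simp] theorem setAr_ar {n : ℕ} (D : Data n) (a b : ℕ) (F : Fin n → Fin n → ℕ) :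
    (D.setAr a F).ar b = if b = a then F else D.ar b := by
  simp [Data.setAr, Function.update_apply]

@[simp] theorem setAr_sc {n : ℕ} (D : Data n) (a : ℕ) (F : Fin n → Fin n → ℕ) :
    (D.setAr a F).sc = D.sc := rfl

@[simp] theorem setSc_sc {n : ℕ} (D : Data n) (a b v : ℕ) :
    (D.setSc a v).sc b = if b = a then v else D.sc b := by
  simp [Data.setSc, Function.update_apply]

@[simp] theorem setSc_ar {n : ℕ} (D : Data n) (a v : ℕ) : (D.setSc a v).ar = D.ar := rfl

/-! ### Distances -/

section Distances

variable {n : ℕ} (G : SimpleGraph (Fin n))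

open Classical in
/-- The distance of two vertices, or `n` if they are in different components. -/
noncomputable def dt (u v : Fin n) : ℕ := if G.Reachable u v then G.dist u v else n

variable {G} {u v w : Fin n}

/-- A shortest walk is a path and so has fewer than `n` edges. This frees the value `n` as a mark
for unreachable pairs. -/
theorem dist_lt_card (h : G.Reachable u v) : G.dist u v < n := by
  obtain ⟨p, hp, hl⟩ := h.exists_path_of_dist
  have := hp.length_lt
  rw [Fintype.card_fin] at this
  omega

theorem dt_of_reachable (h : G.Reachable u v) : dt G u v = G.dist u v := if_pos h

theorem dt_lt_iff : dt G u v < n ↔ G.Reachable u v := by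
  unfold dt
  split_ifs with h
  · simp [h, dist_lt_card h]
  · simp [h]

theorem dt_comm (u v : Fin n) : dt G u v = dt G v u := by
  by_cases h : G.Reachable u v
  · simp [dt, h, h.symm, G.dist_comm]
  · simp [dt, h, mt SimpleGraph.Reachable.symm h]

theorem dt_self (u : Fin n) : dt G u u = 0 := by simp [dt]

theorem dt_eq_zero (hn : G.Reachable u v) : dt G u v = 0 ↔ u = v := by
  rw [dt_of_reachable hn, hn.dist_eq_zero_iff]

theorem reachable_of_dt_add (h : G.Reachable u v) (hw : dt G u w + dt G w v = dt G u v) :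
    G.Reachable u w := by
  have := dist_lt_card h
  rw [dt_of_reachable h] at hw
  exact dt_lt_iff.1 (by omega)

/-- Concatenating shortest walks through `w` gives a walk of length `G.dist u v`, necessarily a
path. Interval membership becomes an equation between table entries; the mark `n` cannot satisfy it,
as the right side is below `n`. -/
theorem mem_geodesicInterval_iff (h : G.Reachable u v) :
    w ∈ geodesicInterval G u v ↔ dt G u w + dt G w v = dt G u v := by
  constructor
  · rintro ⟨q, -, hl, hw⟩
    obtain ⟨q₁, q₂, rfl⟩ := q.mem_support_iff_exists_append.1 hw
    rw [dt_of_reachable q₁.reachable, dt_of_reachable q₂.reachable, dt_of_reachable h]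
    rw [SimpleGraph.Walk.length_append] at hl
    have h₁ := G.dist_le q₁
    have h₂ := G.dist_le q₂
    have h₃ : G.dist u v ≤ G.dist u w + G.dist w v := by
      obtain ⟨p₁, hp₁⟩ := q₁.reachable.exists_walk_length_eq_dist
      obtain ⟨p₂, hp₂⟩ := q₂.reachable.exists_walk_length_eq_dist
      rw [← hp₁, ← hp₂, ← SimpleGraph.Walk.length_append]
      exact G.dist_le _
    omega
  · intro hw
    have h₁ := reachable_of_dt_add h hw
    have h₂ := h₁.symm.trans h
    rw [dt_of_reachable h₁, dt_of_reachable h₂, dt_of_reachable h] at hw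
    obtain ⟨p₁, hp₁⟩ := h₁.exists_walk_length_eq_dist
    obtain ⟨p₂, hp₂⟩ := h₂.exists_walk_length_eq_dist
    have hl : (p₁.append p₂).length = G.dist u v := by
      rw [SimpleGraph.Walk.length_append, hp₁, hp₂, hw]
    refine ⟨p₁.append p₂, (p₁.append p₂).isPath_of_length_eq_dist hl, hl, ?_⟩
    exact p₁.mem_support_append_iff p₂ |>.2 (Or.inl p₁.end_mem_support)

theorem exists_adj_dist (h : G.Reachable u v) {t : ℕ} (ht : G.dist u v = t + 1) :
    ∃ w, G.Reachable u w ∧ G.dist u w = t ∧ G.Adj w v := by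
  obtain ⟨p, hp⟩ := h.symm.exists_walk_length_eq_dist
  rw [G.dist_comm, ht] at hp
  cases p with
  | nil => simp at hp
  | @cons _ w _ hvw p =>
    rw [SimpleGraph.Walk.length_cons] at hp
    have h₁ := G.dist_le p
    have h₂ : G.dist u v ≤ G.dist u w + 1 := by
      obtain ⟨q, hq⟩ := p.reachable.symm.exists_walk_length_eq_dist
      have := G.dist_le (q.concat hvw.symm)
      rwa [SimpleGraph.Walk.length_concat, hq] at this
    refine ⟨w, p.reachable.symm, ?_, hvw.symm⟩
    rw [G.dist_comm] at h₁
    omega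

theorem dist_le_succ (h : G.Reachable u w) (hwv : G.Adj w v) : G.dist u v ≤ G.dist u w + 1 := by
  obtain ⟨q, hq⟩ := h.exists_walk_length_eq_dist
  have := G.dist_le (q.concat hwv)
  rwa [SimpleGraph.Walk.length_concat, hq] at this

-- Breadth-first search from all vertices at once: after `j` rounds exactly the distances up to `j`
-- are entered, and all other entries are `n`. No distance reaches `n`, so `n` rounds suffice.
open Classical in
theorem distStep_eq {D : Data n} {src dst : ℕ} (hsd : src ≠ dst)
    (hA : ∀ u v, D.ar src u v ≠ 0 ↔ G.Adj u v) :
    distStep src dst D = D.setAr dst (dt G) := by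
  have key : forV (fun t D => D.setAr dst fun u v =>
      if D.ar dst u v = n ∧ ∃ w, D.ar dst u w = t ∧ D.ar src w v ≠ 0 then (t : ℕ) + 1
      else D.ar dst u v) (D.setAr dst fun u v => if u = v then 0 else n) =
      D.setAr dst fun u v => if G.Reachable u v ∧ G.dist u v ≤ n then G.dist u v else n := by
    refine forV_induction (fun j D' => D' = D.setAr dst fun u v =>
      if G.Reachable u v ∧ G.dist u v ≤ j then G.dist u v else n) ?_ ?_
    · congr 1
      funext u v
      by_cases huv : u = v
      · simp [huv]
      · rw [if_neg huv, if_neg]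
        rintro ⟨h, h'⟩
        exact huv (h.dist_eq_zero_iff.1 (by omega))
    · rintro j D' rfl
      rw [Data.setAr_setAr]
      congr 1
      funext u v
      simp only [setAr_ar, if_true, if_neg hsd, hA]
      have hj := j.2
      -- Because `j < n`, the mark for unknown entries cannot be mistaken for the distance `j`.
      have e : ∀ w, ((if G.Reachable u w ∧ G.dist u w ≤ j then G.dist u w else n) = (j : ℕ)) ↔
          G.Reachable u w ∧ G.dist u w = j := by
        intro w
        split_ifs with h
        · simp [h.1]
        · constructor
          · intro h'; omega
          · rintro ⟨h₁, h₂⟩; exact absurd ⟨h₁, h₂.le⟩ h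
      simp only [e]
      by_cases hr : G.Reachable u v
      · have hlt := dist_lt_card hr
        by_cases hle : G.dist u v ≤ j
        · simp only [hr, hle, true_and, and_self, if_true]
          rw [if_neg (by rintro ⟨h, -⟩; omega), if_pos (by omega)]
        · simp only [hr, hle, true_and, if_false]
          by_cases heq : G.dist u v = j + 1
          · obtain ⟨w, h₁, h₂, h₃⟩ := exists_adj_dist hr heq
            rw [if_pos ⟨w, ⟨h₁, h₂⟩, h₃⟩, if_pos heq.le, heq]
          · rw [if_neg, if_neg (by omega)]
            rintro ⟨w, ⟨h₁, h₂⟩, h₃⟩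
            have := dist_le_succ h₁ h₃
            omega
      · simp only [hr, false_and, if_false, true_and]
        rw [if_neg]
        rintro ⟨w, ⟨h₁, -⟩, h₃⟩
        exact hr (h₁.trans h₃.reachable)
  unfold distStep andThen
  rw [key]
  congr 1
  funext u v
  by_cases h : G.Reachable u v
  · simp [dt, h, (dist_lt_card h).le]
  · simp [dt, h]

end Distances

end HGI

namespace HGI

/-! ### The modules of a component -/

section Modules

variable {n : ℕ} (G : SimpleGraph (Fin n))

/-- A relation whose classes are modules, at least two in every component with at least two
vertices. -/
structure IsModRel (R : Fin n → Fin n → Prop) : Prop where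
  equiv : Equivalence R
  reach : ∀ {u v}, R u v → G.Reachable u v
  mod : ∀ {u v w}, R u v → ¬ R u w → (G.Adj u w ↔ G.Adj v w)
  out : ∀ {u v}, R u v → u ≠ v → ∃ w, G.Adj u w ∧ ¬ R u w

/-- The disjoint union of the complements of the components. -/
def coGraph : SimpleGraph (Fin n) where
  Adj u v := G.Reachable u v ∧ ¬ G.Adj u v ∧ u ≠ v
  symm := ⟨fun _ _ h => ⟨h.1.symm, fun h' => h.2.1 h'.symm, h.2.2.symm⟩⟩
  loopless := ⟨fun _ h => h.2.2 rfl⟩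

/-- A module that is a proper subset of the component of `r`. -/
structure ProperMod (r : Fin n) (M : Set (Fin n)) : Prop where
  sub : ∀ u ∈ M, G.Reachable r u
  mod : ∀ u ∈ M, ∀ v ∈ M, ∀ w ∉ M, G.Adj u w ↔ G.Adj v w
  proper : ∃ w, G.Reachable r w ∧ w ∉ M

/-- The component of `u` is disconnected in the complement. -/
def CoD (u : Fin n) : Prop := ∃ a, G.Reachable u a ∧ ¬ (coGraph G).Reachable u a

/-- The vertex `r` is the least one of its component. -/
def Root (r : Fin n) : Prop := ∀ w, G.Reachable r w → r ≤ w

/-- The vertices `u` and `v` are in the same module. -/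
def Same (u v : Fin n) : Prop :=
  G.Reachable u v ∧ ((CoD G u ∧ ∃ r, G.Reachable r u ∧ Root G r ∧
    ((coGraph G).Reachable r u ↔ (coGraph G).Reachable r v)) ∨
    (¬ CoD G u ∧ (u = v ∨ ∃ M, ProperMod G u M ∧ u ∈ M ∧ v ∈ M)))

variable {G} {u v w r : Fin n} {M N : Set (Fin n)}

theorem ProperMod.congr (h : ProperMod G u M) (huv : G.Reachable u v) : ProperMod G v M where
  sub w hw := huv.symm.trans (h.sub w hw)
  mod := h.mod
  proper := by
    obtain ⟨w, h₁, h₂⟩ := h.proper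
    exact ⟨w, huv.symm.trans h₁, h₂⟩

theorem coGraph_reachable (h : (coGraph G).Reachable u v) : G.Reachable u v := by
  obtain ⟨p⟩ := h
  induction p with
  | nil => exact .refl _
  | cons h _ ih => exact h.1.trans ih

theorem CoD.congr (h : CoD G u) (huv : G.Reachable u v) : CoD G v := by
  obtain ⟨a, h₁, h₂⟩ := h
  by_contra hv
  simp only [CoD, not_exists, not_and, not_not] at hv
  exact h₂ ((hv u huv.symm).symm.trans (hv a (huv.symm.trans h₁)))

theorem exists_root (u : Fin n) : ∃ r, G.Reachable r u ∧ Root G r := by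
  classical
  have hne : (Finset.univ.filter fun w => G.Reachable u w).Nonempty := ⟨u, by simp⟩
  refine ⟨_, ((Finset.mem_filter.1 (Finset.min'_mem _ hne)).2).symm, fun w hw => ?_⟩
  refine Finset.min'_le _ _ (Finset.mem_filter.2 ⟨Finset.mem_univ _, ?_⟩)
  exact ((Finset.mem_filter.1 (Finset.min'_mem _ hne)).2).trans hw

theorem Root.unique (hu : Root G u) (hv : Root G v) (h : G.Reachable u v) : u = v :=
  le_antisymm (hu v h) (hv u h.symm)

/-- A walk that leaves a set has an edge that leaves it. -/
theorem exists_leaving_edge (h : G.Reachable u v) (hu : u ∈ M) (hv : v ∉ M) :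
    ∃ a b, G.Reachable u a ∧ G.Adj a b ∧ a ∈ M ∧ b ∉ M := by
  obtain ⟨p⟩ := h
  obtain ⟨d, hd, h₁, h₂⟩ := p.exists_boundary_dart M hu hv
  have ha := p.dart_fst_mem_support_of_mem_darts hd
  obtain ⟨q, -, -⟩ := p.mem_support_iff_exists_append.1 ha
  exact ⟨d.fst, d.snd, q.reachable, d.adj, h₁, h₂⟩

/-- The issue is properness. If the union were the whole component, then `N` and its complement
there would be joined by all edges or by none, contradicting connectedness of the complement or of
the component. -/
theorem ProperMod.union (hc : ¬ CoD G r) (hM : ProperMod G r M) (hN : ProperMod G r N)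
    (hv : v ∈ M) (hv' : v ∈ N) : ProperMod G r (M ∪ N) where
  sub u hu := hu.elim (hM.sub u) (hN.sub u)
  mod := by
    have key : ∀ u ∈ M ∪ N, ∀ w ∉ M ∪ N, G.Adj u w ↔ G.Adj v w := by
      rintro u (hu | hu) w hw
      · exact hM.mod u hu v hv w fun h => hw (Or.inl h)
      · exact hN.mod u hu v hv' w fun h => hw (Or.inr h)
    intro a ha b hb w hw
    rw [key a ha w hw, key b hb w hw]
  proper := by
    by_contra hall
    simp only [not_exists, not_and, not_not] at hall
    obtain ⟨y, hy, hyM⟩ := hM.proper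
    obtain ⟨x, hx, hxN⟩ := hN.proper
    have hyN : y ∈ N := (hall y hy).resolve_left hyM
    have hxM : x ∈ M := (hall x hx).resolve_right hxN
    -- Move `b` to `y` inside the module `N`, then `a` to `x` inside the module `M`, which does not
    -- contain `y`.
    have claim : ∀ a, G.Reachable r a → a ∉ N → ∀ b ∈ N, G.Adj a b ↔ G.Adj x y := by
      intro a ha haN b hb
      have haM : a ∈ M := (hall a ha).resolve_right haN
      rw [G.adj_comm, hN.mod b hb y hyN a haN, G.adj_comm, hM.mod a haM x hxM y hyM]
    by_cases hxy : G.Adj x y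
    · have hco : (coGraph G).Reachable x y := by
        simp only [CoD, not_exists, not_and, not_not] at hc
        exact (hc x hx).symm.trans (hc y hy)
      obtain ⟨a, b, h₁, h₂, h₃, h₄⟩ :=
        exists_leaving_edge (M := Nᶜ) hco hxN fun h => h hyN
      have ha := hx.trans (coGraph_reachable h₁)
      exact h₂.2.1 ((claim a ha h₃ b (by simpa using h₄)).2 hxy)
    · obtain ⟨a, b, h₁, h₂, h₃, h₄⟩ :=
        exists_leaving_edge (M := Nᶜ) (hx.symm.trans hy) hxN fun h => h hyN
      exact hxy ((claim a (hx.trans h₁) h₃ b (by simpa using h₄)).1 h₂)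

theorem ProperMod.singleton (huv : G.Reachable u v) (hne : u ≠ v) : ProperMod G u {u} where
  sub w hw := by rw [hw]
  mod a ha b hb w _ := by rw [ha, hb]
  proper := ⟨v, huv, fun h => hne h.symm⟩

theorem same_refl (u : Fin n) : Same G u u := by
  refine ⟨.refl _, ?_⟩
  by_cases h : CoD G u
  · obtain ⟨r, hr⟩ := exists_root (G := G) u
    exact Or.inl ⟨h, r, hr.1, hr.2, Iff.rfl⟩
  · exact Or.inr ⟨h, Or.inl rfl⟩

theorem Same.symm (h : Same G u v) : Same G v u := by
  obtain ⟨huv, h⟩ := h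
  refine ⟨huv.symm, ?_⟩
  obtain ⟨hc, r, h₁, h₂, h₃⟩ | ⟨hc, h⟩ := h
  · exact Or.inl ⟨hc.congr huv, r, h₁.trans huv, h₂, h₃.symm⟩
  · refine Or.inr ⟨fun h => hc (h.congr huv.symm), ?_⟩
    obtain rfl | ⟨M, hM, h₁, h₂⟩ := h
    · exact Or.inl rfl
    · exact Or.inr ⟨M, hM.congr huv, h₂, h₁⟩

theorem Same.trans (h : Same G u v) (h' : Same G v w) : Same G u w := by
  obtain ⟨huv, h⟩ := h
  obtain ⟨hvw, h'⟩ := h'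
  refine ⟨huv.trans hvw, ?_⟩
  obtain ⟨hc, r, h₁, h₂, h₃⟩ | ⟨hc, h⟩ := h
  · obtain ⟨hc', r', h₁', h₂', h₃'⟩ | ⟨hc', h'⟩ := h'
    · obtain rfl := h₂.unique h₂' ((h₁.trans huv).trans h₁'.symm)
      exact Or.inl ⟨hc, r, h₁, h₂, h₃.trans h₃'⟩
    · exact absurd (hc.congr huv) hc'
  · obtain ⟨hc', -⟩ | ⟨hc', h'⟩ := h'
    · exact absurd (hc'.congr huv.symm) hc
    · refine Or.inr ⟨hc, ?_⟩
      obtain rfl | ⟨M, hM, h₁, h₂⟩ := h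
      · exact h'
      · obtain rfl | ⟨N, hN, h₃, h₄⟩ := h'
        · exact Or.inr ⟨M, hM, h₁, h₂⟩
        · exact Or.inr ⟨M ∪ N, hM.union hc (hN.congr huv.symm) h₂ h₃, Or.inl h₁, Or.inr h₄⟩

/-- If the complement is disconnected, different classes lie in different co-components, so all
edges between them are present. Otherwise a proper module containing `u` and `v` cannot contain `w`.
-/
theorem Same.adj_iff (h : Same G u v) (hw : ¬ Same G u w) : G.Adj u w ↔ G.Adj v w := by
  by_cases hr : G.Reachable u w
  swap
  · exact ⟨fun h' => absurd h'.reachable hr, fun h' => absurd (h.1.trans h'.reachable) hr⟩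
  obtain ⟨huv, h⟩ := h
  obtain ⟨hc, r, h₁, h₂, h₃⟩ | ⟨hc, h⟩ := h
  · have key : ∀ x, G.Reachable u x → ((coGraph G).Reachable r u ↔ (coGraph G).Reachable r x) →
        G.Adj x w := by
      intro x hx hrx
      by_contra hadj
      refine hw ⟨hr, Or.inl ⟨hc, r, h₁, h₂, ?_⟩⟩
      rw [hrx]
      by_cases hxw : x = w
      · rw [hxw]
      · have : (coGraph G).Adj x w := ⟨hx.symm.trans hr, hadj, hxw⟩
        exact ⟨fun h => h.trans this.reachable, fun h => h.trans this.reachable.symm⟩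
    exact iff_of_true (key u (.refl _) Iff.rfl) (key v huv h₃)
  · obtain rfl | ⟨M, hM, h₁, h₂⟩ := h
    · exact Iff.rfl
    · refine hM.mod u h₁ v h₂ w fun h => hw ⟨hr, Or.inr ⟨hc, Or.inr ⟨M, hM, h₁, h⟩⟩⟩

/-- With disconnected complement, the co-component of the root and the rest are both nonempty.
Otherwise a largest proper module around `u` omits some `w`, and a proper module containing `u` and
`w` would enlarge it by `ProperMod.union`. -/
theorem exists_not_same (huv : G.Reachable u v) (hne : u ≠ v) :
    ∃ w, G.Reachable u w ∧ ¬ Same G u w := by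
  by_contra hall
  simp only [not_exists, not_and, not_not] at hall
  by_cases hc : CoD G u
  · obtain ⟨a, h₁, h₂⟩ := id hc
    obtain ⟨-, ⟨-, r, hr, hroot, hiff⟩ | ⟨h, -⟩⟩ := hall a h₁
    · obtain ⟨-, ⟨-, r', hr', hroot', hiff'⟩ | ⟨h, -⟩⟩ := hall r hr.symm
      · obtain rfl := hroot.unique hroot' (hr.trans hr'.symm)
        have hu := hiff'.2 (.refl _)
        exact h₂ (hu.symm.trans (hiff.1 hu))
      · exact h hc
    · exact h hc
  · classical
    let A : Finset (Finset (Fin n)) :=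
      Finset.univ.filter fun s => ProperMod G u (s : Set (Fin n)) ∧ u ∈ s
    have hA : A.Nonempty := ⟨{u}, by simpa [A] using ProperMod.singleton huv hne⟩
    obtain ⟨s, hs, hmax⟩ := A.exists_max_image Finset.card hA
    simp only [A, Finset.mem_filter, Finset.mem_univ, true_and] at hs hmax
    obtain ⟨w, hw, hws⟩ := hs.1.proper
    obtain ⟨-, ⟨h, -⟩ | ⟨-, rfl | ⟨N, hN, h₁, h₂⟩⟩⟩ := hall w hw
    · exact hc h
    · exact hws (by simpa using hs.2)
    · have hU := hs.1.union hc hN (by simpa using hs.2) h₁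
      have := hmax (s ∪ N.toFinset) ⟨by simpa using hU, by simp [hs.2]⟩
      have hlt : s.card < (s ∪ N.toFinset).card := by
        refine Finset.card_lt_card ⟨Finset.subset_union_left, fun h => hws ?_⟩
        exact h (by simp [h₂])
      omega

theorem isModRel_same : IsModRel G (Same G) where
  equiv := ⟨same_refl, Same.symm, Same.trans⟩
  reach h := h.1
  mod h hw := h.adj_iff hw
  out {u v} h hne := by
    obtain ⟨w, hw, hn⟩ := exists_not_same h.1 hne
    -- Some edge leaves the class on the way to `w`; by modularity its outer end is a neighbour of
    -- `u` too.
    obtain ⟨a, b, h₁, h₂, h₃, h₄⟩ :=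
      exists_leaving_edge (M := {x | Same G u x}) hw (same_refl u) hn
    exact ⟨b, (Same.adj_iff h₃.symm fun h => h₄ (h₃.trans h)).1 h₂, h₄⟩

open Classical in
/-- The least vertices of the modules in the component of `r`. -/
noncomputable def modReps (G : SimpleGraph (Fin n)) (r : Fin n) : Finset (Fin n) :=
  Finset.univ.filter fun x => G.Reachable r x ∧ ∀ w, Same G w x → x ≤ w

theorem mem_modReps {x : Fin n} :
    x ∈ modReps G r ↔ G.Reachable r x ∧ ∀ w, Same G w x → x ≤ w := by
  simp [modReps]

theorem modReps_unique {x y : Fin n} (hx : x ∈ modReps G r) (hy : y ∈ modReps G r)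
    (h : Same G x y) : x = y :=
  le_antisymm ((mem_modReps.1 hx).2 y h.symm) ((mem_modReps.1 hy).2 x h)

/-- The infimum defining `topModuleNumber` is attained: the partition into singletons shows that `n`
is admissible. -/
theorem exists_component_partition (G : SimpleGraph (Fin n)) (C : G.ConnectedComponent)
    (hC : C.supp.Nontrivial) : ∃ P : Set (Set C.supp),
      IsModulePartition (G.induce C.supp) P ∧ 2 ≤ P.ncard ∧ P.ncard ≤ topModuleNumber G := by
  classical
  have hne : {p | ∀ C : G.ConnectedComponent, C.supp.Nontrivial → ∃ P : Set (Set C.supp),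
      IsModulePartition (G.induce C.supp) P ∧ 2 ≤ P.ncard ∧ P.ncard ≤ p}.Nonempty := by
    refine ⟨n, fun C hC => ⟨Set.range fun x => {x}, ⟨⟨?_, fun a => ?_⟩, ?_⟩, ?_, ?_⟩⟩
    · rintro ⟨x, hx⟩
      exact (Set.singleton_nonempty x).ne_empty hx
    · exact ⟨{a}, ⟨⟨a, rfl⟩, rfl⟩, by rintro _ ⟨⟨b, rfl⟩, hb⟩; rw [Set.mem_singleton_iff.1 hb]⟩
    · rintro _ ⟨x, rfl⟩ u hu v hv
      rw [hu, hv]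
    · rw [Set.ncard_range_of_injective Set.singleton_injective, Nat.card_coe_set_eq]
      exact (Set.one_lt_ncard (Set.toFinite _)).2 (by
        obtain ⟨x, hx, y, hy, h⟩ := hC
        exact ⟨x, hx, y, hy, h⟩)
    · rw [Set.ncard_range_of_injective Set.singleton_injective]
      exact (Nat.card_le_card_of_injective (Subtype.val : C.supp → Fin n)
        Subtype.val_injective).trans (by simp)
  exact Nat.sInf_mem hne C hC

/-- The extra 1 covers an isolated vertex, which forms one class even if `topModuleNumber G` is 0.
With disconnected complement there are at most two classes; otherwise each part of an optimal
partition is a proper module and thus lies in a single class. -/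
theorem card_modReps_le (G : SimpleGraph (Fin n)) (r : Fin n) :
    (modReps G r).card ≤ topModuleNumber G + 1 := by
  classical
  by_cases htriv : ∀ x, G.Reachable r x → x = r
  · have : modReps G r ⊆ {r} := fun x hx => by
      simpa using htriv x (mem_modReps.1 hx).1
    have := Finset.card_le_card this
    simp only [Finset.card_singleton] at this
    omega
  simp only [not_forall] at htriv
  obtain ⟨x, hx, hne⟩ := htriv
  have hmem : ∀ {y}, G.Reachable r y → y ∈ (G.connectedComponentMk r).supp := fun h => by
    simpa using h.symm
  have hmem' : ∀ {y}, y ∈ (G.connectedComponentMk r).supp → G.Reachable r y := fun h => by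
    simpa using SimpleGraph.Reachable.symm (by simpa using h)
  obtain ⟨P, ⟨hP, hmod⟩, h2, hp⟩ := exists_component_partition G (G.connectedComponentMk r)
    ⟨x, hmem hx, r, hmem (.refl _), hne⟩
  refine le_trans ?_ (Nat.le_succ_of_le hp)
  by_cases hc : CoD G r
  · refine le_trans ?_ h2
    obtain ⟨r₀, hr₀, hroot⟩ := exists_root (G := G) r
    -- One bit determines the class here.
    have hinj : Set.InjOn (fun y => decide ((coGraph G).Reachable r₀ y)) (modReps G r) := by
      intro y hy z hz hyz
      refine modReps_unique hy hz ?_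
      have h₁ := (mem_modReps.1 hy).1
      have h₂ := (mem_modReps.1 hz).1
      refine ⟨h₁.symm.trans h₂, Or.inl ⟨hc.congr h₁, r₀, hr₀.trans h₁, hroot, ?_⟩⟩
      simpa using hyz
    simpa using Finset.card_le_card_of_injOn (t := Finset.univ) _
      (fun _ _ => Finset.mem_coe.2 (Finset.mem_univ _)) hinj
  · have part : ∀ y : Fin n, ∃ B : Set (Fin n), G.Reachable r y →
        y ∈ B ∧ ProperMod G r B ∧ ∃ b ∈ P, B = Subtype.val '' b := by
      intro y
      by_cases hy : G.Reachable r y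
      swap
      · exact ⟨∅, fun h => absurd h hy⟩
      obtain ⟨b, ⟨hbP, hyb⟩, -⟩ := hP.2 ⟨y, hmem hy⟩
      refine ⟨Subtype.val '' b, fun _ => ⟨⟨_, hyb, rfl⟩, ⟨?_, ?_, ?_⟩, b, hbP, rfl⟩⟩
      · rintro _ ⟨z, -, rfl⟩
        exact hmem' z.2
      · rintro _ ⟨u, hu, rfl⟩ _ ⟨v, hv, rfl⟩ w hw
        by_cases hrw : G.Reachable r w
        · have hw' : (⟨w, hmem hrw⟩ : (G.connectedComponentMk r).supp) ∉ b :=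
            fun h => hw ⟨_, h, rfl⟩
          have := congrArg (⟨w, hmem hrw⟩ ∈ ·) (hmod b hbP u hu v hv)
          simpa [hw'] using this
        · exact ⟨fun h => absurd ((hmem' u.2).trans h.reachable) hrw,
            fun h => absurd ((hmem' v.2).trans h.reachable) hrw⟩
      -- A part that fills the component would be the only one, but there are at least two.
      · by_contra hall
        simp only [not_exists, not_and, not_not] at hall
        have : P ⊆ {b} := by
          intro b' hb'
          obtain ⟨z, hz⟩ : b'.Nonempty := by
            rw [Set.nonempty_iff_ne_empty]; rintro rfl; exact hP.1 hb'
          obtain ⟨z', hz', h⟩ := hall z.1 (hmem' z.2)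
          obtain rfl := Subtype.ext h
          exact (hP.2 z').unique ⟨hb', hz⟩ ⟨hbP, hz'⟩
        have := Set.ncard_le_ncard this
        rw [Set.ncard_singleton] at this
        omega
    choose B hB using part
    have hinj : Set.InjOn B (modReps G r : Set (Fin n)) := by
      intro y hy z hz hyz
      refine modReps_unique hy hz ?_
      have h₁ := (mem_modReps.1 hy).1
      have h₂ := (mem_modReps.1 hz).1
      refine ⟨h₁.symm.trans h₂, Or.inr ⟨fun h => hc (h.congr h₁.symm), Or.inr ⟨B y, ?_, ?_, ?_⟩⟩⟩
      · exact (hB y h₁).2.1.congr h₁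
      · exact (hB y h₁).1
      · rw [hyz]; exact (hB z h₂).1
    have hPfin : P.Finite := Set.toFinite _
    calc (modReps G r).card = (modReps G r : Set (Fin n)).ncard := by simp
      _ ≤ ((Subtype.val '' ·) '' P : Set (Set (Fin n))).ncard := by
        refine Set.ncard_le_ncard_of_injOn B (fun y hy => ?_) hinj (hPfin.image _)
        obtain ⟨b, hb, h⟩ := (hB y (mem_modReps.1 hy).1).2.2
        exact ⟨b, hb, h.symm⟩
      _ ≤ P.ncard := Set.ncard_image_le hPfin

end Modules

end HGI

namespace HGI

/-! ### Solutions in a component -/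

section Solutions

variable {n : ℕ}

/-- The set `S` hits all pairs in the component of `r`. -/
def Solves (T d : Fin n → Fin n → ℕ) (r : Fin n) (S : Finset (Fin n)) : Prop :=
  ∀ u v, T u v ≠ 0 → d r u < n → d r v < n → ∃ x ∈ S, d u x + d x v = d u v

/-- The least size of a set that hits all pairs in the component of `r`. -/
noncomputable def opt (T d : Fin n → Fin n → ℕ) (r : Fin n) : ℕ :=
  sInf {c | ∃ S, Solves T d r S ∧ S.card = c}

/-- The matrices `A`, `d` and `sm` hold the adjacency, the distances and the modules of `G`. -/
structure Setup (G : SimpleGraph (Fin n)) (A d sm : Fin n → Fin n → ℕ) : Prop where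
  adj : ∀ u v, A u v ≠ 0 ↔ G.Adj u v
  dist : d = dt G
  rel : IsModRel G fun u v => sm u v ≠ 0

variable {G : SimpleGraph (Fin n)} {A T d sm X S H W : Fin n → Fin n → ℕ} {r u v w x y : Fin n}

theorem solves_univ (hd : d = dt G) : Solves T d r Finset.univ :=
  fun u v _ _ _ => ⟨u, Finset.mem_univ _, by simp [hd, dt_self]⟩

theorem exists_solves_opt (hd : d = dt G) : ∃ S, Solves T d r S ∧ S.card = opt T d r :=
  Nat.sInf_mem (s := {c | ∃ S, Solves T d r S ∧ S.card = c}) ⟨_, _, solves_univ hd, rfl⟩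

theorem opt_le {S : Finset (Fin n)} (h : Solves T d r S) : opt T d r ≤ S.card :=
  Nat.sInf_le ⟨S, h, rfl⟩

/-- Stop the walk when it first enters the class of `w`. The vertex before that is outside the
class, hence adjacent to `x` as well. -/
theorem IsModRel.exists_walk {R : Fin n → Fin n → Prop} (hR : IsModRel G R) (p : G.Walk u w)
    (h : R w x) (hu : ¬ R u w) : ∃ q : G.Walk u x, q.length ≤ p.length := by
  induction p with
  | nil => exact absurd (hR.equiv.refl _) hu
  | @cons u y w huy p ih =>
    by_cases hy : R y w
    · have hyx := hR.equiv.trans hy h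
      have hyu : ¬ R y u := fun h' => hu (hR.equiv.trans (hR.equiv.symm h') hy)
      have : G.Adj u x := ((hR.mod hyx hyu).1 huy.symm).symm
      exact ⟨this.toWalk, by simp⟩
    · obtain ⟨q, hq⟩ := ih h hy
      exact ⟨.cons huy q, by simpa using hq⟩

theorem IsModRel.dt_le {R : Fin n → Fin n → Prop} (hR : IsModRel G R) (h : R w x)
    (hu : ¬ R u w) : dt G u x ≤ dt G u w := by
  by_cases hr : G.Reachable u w
  · obtain ⟨p, hp⟩ := hr.exists_walk_length_eq_dist
    obtain ⟨q, hq⟩ := hR.exists_walk p h hu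
    rw [dt_of_reachable hr, dt_of_reachable q.reachable]
    exact (G.dist_le q).trans (hq.trans_eq hp)
  · have : ¬ G.Reachable u x := fun h' => hr (h'.trans (hR.reach h).symm)
    simp [dt, hr, this]

/-- This makes it irrelevant which vertex of a module hits a pair that has no end in it, so guessing
modules is enough for such pairs. -/
theorem IsModRel.dt_eq {R : Fin n → Fin n → Prop} (hR : IsModRel G R) (h : R w x)
    (hu : ¬ R u w) : dt G u x = dt G u w :=
  le_antisymm (hR.dt_le h hu)
    (hR.dt_le (hR.equiv.symm h) fun h' => hu (hR.equiv.trans h' (hR.equiv.symm h)))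

namespace Setup

variable (hs : Setup G A d sm)

theorem refl (hs : Setup G A d sm) (u : Fin n) : sm u u ≠ 0 := hs.rel.equiv.refl u

theorem symm (hs : Setup G A d sm) (h : sm u v ≠ 0) : sm v u ≠ 0 := hs.rel.equiv.symm h

theorem trans (hs : Setup G A d sm) (h : sm u v ≠ 0) (h' : sm v w ≠ 0) : sm u w ≠ 0 :=
  hs.rel.equiv.trans h h'

theorem zero_symm (hs : Setup G A d sm) (h : sm u v = 0) : sm v u = 0 := by
  by_contra h'; exact hs.symm h' h

theorem zero_congr (hs : Setup G A d sm) (h : sm u v = 0) (huw : sm u w ≠ 0) : sm w v = 0 := by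
  by_contra h'; exact hs.trans huw h' h

theorem reach (hs : Setup G A d sm) (hu : d r u < n) (hv : d r v < n) : G.Reachable u v := by
  rw [hs.dist, dt_lt_iff] at hu hv
  exact hu.symm.trans hv

theorem comm (hs : Setup G A d sm) (u v : Fin n) : d u v = d v u := by
  rw [hs.dist, dt_comm]

theorem d_eq (hs : Setup G A d sm) (h : sm w x ≠ 0) (hu : sm u w = 0) : d u x = d u w := by
  rw [hs.dist, hs.rel.dt_eq h (by simpa using hu)]

theorem d_eq' (hs : Setup G A d sm) (h : sm w x ≠ 0) (hu : sm w u = 0) : d x u = d w u := by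
  rw [hs.comm, hs.d_eq h (hs.zero_symm hu), hs.comm]

theorem comp_congr (hs : Setup G A d sm) (h : sm u v ≠ 0) (hu : d r u < n) : d r v < n := by
  rw [hs.dist, dt_lt_iff] at hu ⊢
  exact hu.trans (hs.rel.reach h)

/-- Every set that meets all modules of `X` hits the pairs that are hit by `X`. -/
theorem sat_hit (hs : Setup G A d sm) (h : Sat d sm X u v) {Z : Finset (Fin n)}
    (hZ : ∀ x, X x x ≠ 0 → ∃ z ∈ Z, sm x z ≠ 0) : ∃ z ∈ Z, d u z + d z v = d u v := by
  obtain ⟨x, hx, hd, hu, hv⟩ := h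
  obtain ⟨z, hz, hxz⟩ := hZ x hx
  exact ⟨z, hz, by rw [hs.d_eq hxz (hs.zero_symm hu), hs.d_eq' hxz hv, hd]⟩

theorem exists_rep (hs : Setup G A d sm) (hu : d r u < n) :
    ∃ x, IsRep d sm r x ∧ sm x u ≠ 0 := by
  classical
  have hne : (Finset.univ.filter fun w => sm w u ≠ 0).Nonempty := ⟨u, by simpa using hs.refl u⟩
  have hmem := (Finset.mem_filter.1 (Finset.min'_mem _ hne)).2
  refine ⟨_, ⟨hs.comp_congr (hs.symm hmem) hu, fun w hw => ?_⟩, hmem⟩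
  exact Finset.min'_le _ w (by simpa using hs.trans hw hmem)

theorem rep_unique (hs : Setup G A d sm) (hx : IsRep d sm r x) (hy : IsRep d sm r y)
    (h : sm x y ≠ 0) : x = y :=
  le_antisymm (hx.2 y (hs.symm h)) (hy.2 x h)

/-- Soundness: add to `S` the completing vertex of each missed module of `X`. Then every module of
`X` is met, which settles the pairs in `Sat`; `S` covers the hard pairs, and the other two clauses
of `Valid` settle the soft ones. Nothing is assumed about how `X` and `S` were guessed. -/
theorem exists_solves_of_valid (hs : Setup G A d sm)
    (hX : ∀ a, X a a ≠ 0 → ∃ x, IsRep d sm r x ∧ sm x a ≠ 0 ∧ X x x ≠ 0)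
    (hH : ∀ u v, H u v ≠ 0 ↔ Hard A T d sm X r u v)
    (hW : ∀ u v, W u v ≠ 0 ↔ Soft A T d sm X r u v) (hv : Valid d sm X S H W r) :
    ∃ Z, Solves T d r Z ∧ Z.card ≤ solSize d sm X S r := by
  classical
  obtain ⟨h₁, h₂, h₃⟩ := hv
  let Y := Finset.univ.filter fun x => IsRep d sm r x ∧ X x x ≠ 0 ∧ Misses sm S x
  have : ∀ x, ∃ s, x ∈ Y → sm s x ≠ 0 ∧ ∀ u v, W u v ≠ 0 → sm u x ≠ 0 → d u s + d s v = d u v := by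
    intro x
    by_cases hx : x ∈ Y
    · obtain ⟨hr, hx, hm⟩ := (Finset.mem_filter.1 hx).2
      obtain ⟨s, hs⟩ := h₃ x hr hx hm
      exact ⟨s, fun _ => hs⟩
    · exact ⟨x, fun h => absurd h hx⟩
  choose f hf using this
  let Z := (Finset.univ.filter fun a => S a a ≠ 0) ∪ Y.image f
  have hSZ : ∀ a, S a a ≠ 0 → a ∈ Z := fun a ha =>
    Finset.mem_union_left _ (Finset.mem_filter.2 ⟨Finset.mem_univ _, ha⟩)
  have hfZ : ∀ x ∈ Y, f x ∈ Z := fun x hx =>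
    Finset.mem_union_right _ (Finset.mem_image_of_mem _ hx)
  have hY : ∀ a, X a a ≠ 0 → Misses sm S a → ∃ x ∈ Y, sm x a ≠ 0 := by
    intro a ha hm
    obtain ⟨x, hx, hxa, hxX⟩ := hX a ha
    refine ⟨x, Finset.mem_filter.2 ⟨Finset.mem_univ _, hx, hxX, fun w hw => ?_⟩, hxa⟩
    by_contra h
    exact hs.trans h hxa (hm w hw)
  have hXZ : ∀ x, X x x ≠ 0 → ∃ z ∈ Z, sm x z ≠ 0 := by
    intro x hx
    by_cases hm : Misses sm S x
    · obtain ⟨y, hy, hyx⟩ := hY x hx hm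
      exact ⟨f y, hfZ y hy, hs.symm (hs.trans (hf y hy).1 hyx)⟩
    · simp only [Misses, not_forall] at hm
      obtain ⟨w, hw, hwx⟩ := hm
      exact ⟨w, hSZ w hw, hs.symm hwx⟩
  refine ⟨Z, fun u v hT hu hv => ?_, ?_⟩
  · by_cases hsat : Sat d sm X u v
    · exact hs.sat_hit hsat hXZ
    by_cases hhard : sm u v = 0 ∨ A u v ≠ 0 ∨ u = v
    · obtain h | h := h₁ u v ((hH u v).2 ⟨hT, hu, hv, hhard, hsat⟩)
      · exact ⟨u, hSZ u h, by simp [hs.dist, dt_self]⟩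
      · exact ⟨v, hSZ v h, by simp [hs.dist, dt_self]⟩
    · simp only [not_or, not_not] at hhard
      have hw := (hW u v).2 ⟨hT, hu, hv, hhard.1, hhard.2.1, hhard.2.2, hsat⟩
      obtain ⟨w, hw', h⟩ | ⟨hXu, hm⟩ := h₂ u v hw
      · exact ⟨w, hSZ w hw', h⟩
      · obtain ⟨x, hx, hxu⟩ := hY u hXu hm
        exact ⟨f x, hfZ x hx, (hf x hx).2 u v hw (hs.symm hxu)⟩
  · refine (Finset.card_union_le _ _).trans (add_le_add ?_ (Finset.card_image_le.trans ?_))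
    · rw [Finset.card_filter]
    · rw [Finset.card_filter]

/-- A pair that is not hit by other modules is hit in one of its own. -/
theorem hit_in_module (hs : Setup G A d sm) {Z : Finset (Fin n)} (hZ : Solves T d r Z)
    (hX : ∀ a, X a a ≠ 0 ↔ ∃ z ∈ Z, sm z a ≠ 0) (hT : T u v ≠ 0) (hu : d r u < n)
    (hv : d r v < n) (hsat : ¬ Sat d sm X u v) :
    ∃ z ∈ Z, d u z + d z v = d u v ∧ (sm z u ≠ 0 ∨ sm z v ≠ 0) := by
  obtain ⟨z, hz, h⟩ := hZ u v hT hu hv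
  refine ⟨z, hz, h, ?_⟩
  by_contra hn
  simp only [not_or, not_not] at hn
  exact hsat ⟨z, (hX z).2 ⟨z, hz, hs.refl z⟩, h, hn.1, hn.2⟩

theorem d_pos (hs : Setup G A d sm) (hr : G.Reachable u v) : d u v = 0 ↔ u = v := by
  rw [hs.dist, dt_eq_zero hr]

theorem d_adj (hs : Setup G A d sm) (h : G.Adj u v) : d u v = 1 := by
  rw [hs.dist, dt_of_reachable h.reachable, SimpleGraph.dist_eq_one_iff_adj.2 h]

/-- The hitting vertex `z` lies in the module of `u` or `v`. If these modules differ and `z` is with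
`u`, then `z` is as far from `v` as `u` is, so `z = u`; the other side is symmetric. For adjacent or
equal ends the interval contains nothing else. -/
theorem hard_hit (hs : Setup G A d sm) {Z : Finset (Fin n)} (hZ : Solves T d r Z)
    (hX : ∀ a, X a a ≠ 0 ↔ ∃ z ∈ Z, sm z a ≠ 0) (h : Hard A T d sm X r u v) :
    u ∈ Z ∨ v ∈ Z := by
  obtain ⟨hT, hu, hv, hhard, hsat⟩ := h
  obtain ⟨z, hz, hd, hm⟩ := hs.hit_in_module hZ hX hT hu hv hsat
  have huv := hs.reach hu hv
  have huz : G.Reachable u z := reachable_of_dt_add huv (by rw [← hs.dist]; exact hd)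
  have hzv := huz.symm.trans huv
  suffices h : d u z = 0 ∨ d z v = 0 by
    obtain h | h := h
    · left; rwa [(hs.d_pos huz).1 h]
    · right; rwa [← (hs.d_pos hzv).1 h]
  obtain h | h | h := hhard
  · obtain hm | hm := hm
    · left
      have := hs.d_eq' (u := v) (hs.symm hm) h
      omega
    · right
      have := hs.d_eq (u := u) (hs.symm hm) h
      omega
  · have := hs.d_adj ((hs.adj u v).1 h)
    omega
  · have := (hs.d_pos huv).2 h
    omega

theorem soft_hit (hs : Setup G A d sm) {Z : Finset (Fin n)} (hZ : Solves T d r Z)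
    (hX : ∀ a, X a a ≠ 0 ↔ ∃ z ∈ Z, sm z a ≠ 0) (h : Soft A T d sm X r u v) :
    ∃ z ∈ Z, d u z + d z v = d u v ∧ sm z u ≠ 0 := by
  obtain ⟨hT, hu, hv, hsm, -, -, hsat⟩ := h
  obtain ⟨z, hz, hd, hm⟩ := hs.hit_in_module hZ hX hT hu hv hsat
  exact ⟨z, hz, hd, hm.elim id fun h => hs.trans h (hs.symm hsm)⟩

/-- The geodesic interval of a soft pair contains all neighbours of its module. -/
theorem soft_nbr (hs : Setup G A d sm) (h : Soft A T d sm X r u v) {t : Fin n} (hx : sm u x ≠ 0)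
    (ht : G.Adj x t) (hxt : sm x t = 0) : d u t + d t v = d u v ∧ X t t = 0 := by
  obtain ⟨hT, hu, hv, hsm, hA, hne, hsat⟩ := h
  have hut : G.Adj u t := (hs.rel.mod (hs.symm hx) (by simpa using hxt)).1 ht
  have hvt : G.Adj v t :=
    (hs.rel.mod (hs.trans (hs.symm hx) hsm) (by simpa using hxt)).1 ht
  have hut' : sm u t = 0 := hs.zero_congr hxt (hs.symm hx)
  have hvt' : sm v t = 0 := hs.zero_congr hut' hsm
  have huv := hs.reach hu hv
  -- The distance is exactly two: the ends are distinct and nonadjacent, and `t` is a common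
  -- neighbour.
  have h0 : d u v ≠ 0 := fun h => hne ((hs.d_pos huv).1 h)
  have h1 : d u v ≠ 1 := by
    rw [hs.dist, dt_of_reachable huv]
    intro h
    exact (hs.adj u v).2 (SimpleGraph.dist_eq_one_iff_adj.1 h) hA
  have h2 : d u v ≤ d u t + 1 := by
    rw [hs.dist, dt_of_reachable huv, dt_of_reachable hut.reachable]
    exact dist_le_succ hut.reachable hvt.symm
  have h3 := hs.d_adj hut
  have h4 := hs.d_adj hvt.symm
  have h5 : d u t + d t v = d u v := by omega
  -- If the module of `t` were in `X`, then `t` would witness `Sat` for this pair.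
  refine ⟨h5, ?_⟩
  by_contra hX
  exact hsat ⟨t, hX, h5, hs.zero_symm hut', hs.zero_symm hvt'⟩

open Classical in
/-- The vertices in the modules that meet `Z`. -/
noncomputable def hull (sm : Fin n → Fin n → ℕ) (Z : Finset (Fin n)) : Finset (Fin n) :=
  Finset.univ.filter fun a => ∃ z ∈ Z, sm z a ≠ 0

theorem mem_hull {Z : Finset (Fin n)} {a : Fin n} : a ∈ hull sm Z ↔ ∃ z ∈ Z, sm z a ≠ 0 := by
  simp [hull]

/-- If a vertex outside of the cover shares its module with another vertex of the solution, then
the solution can be improved. -/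
theorem exists_better (hs : Setup G A d sm) {Z : Finset (Fin n)} (hZ : Solves T d r Z)
    (hX : ∀ a, X a a ≠ 0 ↔ ∃ z ∈ Z, sm z a ≠ 0) (hS : ∀ a, S a a ≠ 0 → a ∈ Z)
    (hcov : ∀ u v, Hard A T d sm X r u v → S u u ≠ 0 ∨ S v v ≠ 0) {s s' : Fin n} (hsZ : s ∈ Z)
    (hsS : S s s = 0) (hsZ' : s' ∈ Z) (hss : sm s' s ≠ 0) (hne : s' ≠ s) :
    ∃ Z', Solves T d r Z' ∧ (Z'.card < Z.card ∨
      Z'.card ≤ Z.card ∧ (hull sm Z).card < (hull sm Z').card) := by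
  classical
  -- Removing `s` does not lose its module, because `s'` remains there.
  have herase : ∀ x, X x x ≠ 0 → ∃ z ∈ Z.erase s, sm x z ≠ 0 := by
    intro x hx
    obtain ⟨z, hz, hzx⟩ := (hX x).1 hx
    by_cases h : z = s
    · exact ⟨s', Finset.mem_erase.2 ⟨hne, hsZ'⟩, hs.symm (hs.trans hss (h ▸ hzx))⟩
    · exact ⟨z, Finset.mem_erase.2 ⟨h, hz⟩, hs.symm hzx⟩
  -- which sets are solutions
  have solves : ∀ Z', Z.erase s ⊆ Z' → (∀ u v, Soft A T d sm X r u v → sm u s ≠ 0 →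
      ∃ z ∈ Z', d u z + d z v = d u v) → Solves T d r Z' := by
    intro Z' hsub hsoft u v hT hu hv
    by_cases hsat : Sat d sm X u v
    · exact hs.sat_hit hsat fun x hx =>
        let ⟨z, hz, h⟩ := herase x hx
        ⟨z, hsub hz, h⟩
    have hS' : ∀ a, S a a ≠ 0 → a ∈ Z' := fun a ha =>
      hsub (Finset.mem_erase.2 ⟨fun h => ha (h ▸ hsS), hS a ha⟩)
    by_cases hhard : sm u v = 0 ∨ A u v ≠ 0 ∨ u = v
    · obtain h | h := hcov u v ⟨hT, hu, hv, hhard, hsat⟩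
      · exact ⟨u, hS' u h, by simp [hs.dist, dt_self]⟩
      · exact ⟨v, hS' v h, by simp [hs.dist, dt_self]⟩
    · simp only [not_or, not_not] at hhard
      have hw : Soft A T d sm X r u v := ⟨hT, hu, hv, hhard.1, hhard.2.1, hhard.2.2, hsat⟩
      by_cases hus : sm u s = 0
      · obtain ⟨z, hz, hd, hzu⟩ := hs.soft_hit hZ hX hw
        refine ⟨z, hsub (Finset.mem_erase.2 ⟨?_, hz⟩), hd⟩
        rintro rfl
        exact hs.symm hzu hus
      · exact hsoft u v hw hus
  by_cases hex : ∃ u v, Soft A T d sm X r u v ∧ sm u s ≠ 0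
  · obtain ⟨u, v, hsoft, hus⟩ := hex
    -- The neighbour `t` outside the module of `s` takes over all soft pairs of that module. Its own
    -- module was not met by `Z`, so the exchange keeps the size from growing and enlarges the hull.
    obtain ⟨t, ht, hst⟩ := hs.rel.out (hs.symm hss) hne.symm
    rw [not_not] at hst
    have htX := (hs.soft_nbr hsoft hus ht hst).2
    refine ⟨insert t (Z.erase s), solves _ (Finset.subset_insert _ _) ?_, Or.inr ⟨?_, ?_⟩⟩
    · intro u' v' h h'
      exact ⟨t, Finset.mem_insert_self _ _, (hs.soft_nbr h h' ht hst).1⟩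
    · refine (Finset.card_insert_le _ _).trans ?_
      rw [Finset.card_erase_add_one hsZ]
    · refine Finset.card_lt_card ⟨fun a ha => ?_, fun h => ?_⟩
      · obtain ⟨z, hz, h⟩ := herase a ((hX a).2 (mem_hull.1 ha))
        exact mem_hull.2 ⟨z, Finset.mem_insert_of_mem hz, hs.symm h⟩
      · have : t ∈ hull sm (insert t (Z.erase s)) :=
          mem_hull.2 ⟨t, Finset.mem_insert_self _ _, hs.refl t⟩
        exact (hX t).2 (mem_hull.1 (h this)) htX
  -- No soft pair depends on the module of `s`, so `s` is superfluous.
  · refine ⟨Z.erase s, solves _ subset_rfl ?_, Or.inl ?_⟩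
    · exact fun u v h h' => absurd ⟨u, v, h, h'⟩ hex
    · exact Finset.card_lt_card (Finset.erase_ssubset hsZ)

/-- Under `huniq`, the solution vertex of a missed module is unique and therefore hits all soft
pairs of that module on its own. Choosing these vertices embeds the missed modules into `Z` minus
the cover, which gives the bound on the size. -/
theorem valid_of_unique (hs : Setup G A d sm) {Z : Finset (Fin n)} (hZ : Solves T d r Z)
    (hX : ∀ a, X a a ≠ 0 ↔ ∃ z ∈ Z, sm z a ≠ 0) (hS : ∀ a, S a a ≠ 0 → a ∈ Z)
    (hW : ∀ u v, W u v ≠ 0 ↔ Soft A T d sm X r u v)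
    (hcov : ∀ u v, H u v ≠ 0 → S u u ≠ 0 ∨ S v v ≠ 0)
    (huniq : ∀ s ∈ Z, S s s = 0 → ∀ s' ∈ Z, sm s' s ≠ 0 → s' = s) :
    Valid d sm X S H W r ∧ solSize d sm X S r ≤ Z.card := by
  classical
  have hmiss : ∀ s ∈ Z, S s s = 0 → ∀ x, sm s x ≠ 0 → Misses sm S x := by
    intro s hsZ hsS x hsx w hw
    by_contra h
    rw [huniq s hsZ hsS w (hS w hw) (hs.trans h (hs.symm hsx))] at hw
    exact hw hsS
  have hrep : ∀ x, X x x ≠ 0 → Misses sm S x → ∃ s ∈ Z, sm s x ≠ 0 ∧ S s s = 0 := by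
    intro x hx hm
    obtain ⟨s, hsZ, hsx⟩ := (hX x).1 hx
    refine ⟨s, hsZ, hsx, ?_⟩
    by_contra h
    exact hsx (hm s h)
  refine ⟨⟨hcov, ?_, ?_⟩, ?_⟩
  · intro u v huv
    obtain ⟨z, hz, hd, hzu⟩ := hs.soft_hit hZ hX ((hW u v).1 huv)
    by_cases hzS : S z z = 0
    · exact Or.inr ⟨(hX u).2 ⟨z, hz, hzu⟩, hmiss z hz hzS u hzu⟩
    · exact Or.inl ⟨z, hzS, hd⟩
  · intro x _ hx hm
    obtain ⟨s, hsZ, hsx, hsS⟩ := hrep x hx hm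
    refine ⟨s, hsx, fun u v huv hux => ?_⟩
    obtain ⟨z, hz, hd, hzu⟩ := hs.soft_hit hZ hX ((hW u v).1 huv)
    rwa [huniq s hsZ hsS z hz (hs.trans hzu (hs.trans hux (hs.symm hsx)))] at hd
  · have : ∀ x, ∃ s, X x x ≠ 0 → Misses sm S x → s ∈ Z ∧ sm s x ≠ 0 ∧ S s s = 0 := by
      intro x
      by_cases hx : X x x ≠ 0 ∧ Misses sm S x
      · obtain ⟨s, h⟩ := hrep x hx.1 hx.2
        exact ⟨s, fun _ _ => h⟩
      · exact ⟨x, fun h h' => absurd ⟨h, h'⟩ hx⟩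
    choose f hf using this
    have h1 : (∑ a, if S a a ≠ 0 then 1 else 0) = (Z.filter fun a => S a a ≠ 0).card := by
      rw [← Finset.card_filter]
      congr 1
      ext a
      simpa using hS a
    have h2 : (∑ x, if IsRep d sm r x ∧ X x x ≠ 0 ∧ Misses sm S x then 1 else 0) ≤
        (Z.filter fun a => ¬ S a a ≠ 0).card := by
      rw [← Finset.card_filter]
      refine Finset.card_le_card_of_injOn f ?_ ?_
      · intro x hx
        simp only [Finset.coe_filter, Finset.mem_univ, true_and, Set.mem_ofPred_eq] at hx
        have := hf x hx.2.1 hx.2.2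
        simp [this]
      · intro x hx y hy hxy
        simp only [Finset.coe_filter, Finset.mem_univ, true_and, Set.mem_ofPred_eq] at hx hy
        have h3 := hf x hx.2.1 hx.2.2
        have h4 := hf y hy.2.1 hy.2.2
        rw [← hxy] at h4
        exact hs.rep_unique hx.1 hy.1 (hs.trans (hs.symm h3.2.1) h4.2.1)
    have h3 := Finset.card_filter_add_card_filter_not (s := Z) (fun a => S a a ≠ 0)
    simp only [solSize]
    omega

/-- There is an optimal solution that is found with the right guesses. -/
theorem exists_good_solution (hs : Setup G A d sm) (T : Fin n → Fin n → ℕ) (r : Fin n) :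
    ∃ Z : Finset (Fin n), Solves T d r Z ∧ Z.card = opt T d r ∧ (∀ z ∈ Z, d r z < n) ∧
      ∀ X S H W : Fin n → Fin n → ℕ, (∀ a, X a a ≠ 0 ↔ ∃ z ∈ Z, sm z a ≠ 0) →
        (∀ a, S a a ≠ 0 → a ∈ Z) → (∀ u v, H u v ≠ 0 ↔ Hard A T d sm X r u v) →
        (∀ u v, W u v ≠ 0 ↔ Soft A T d sm X r u v) →
        (∀ u v, H u v ≠ 0 → S u u ≠ 0 ∨ S v v ≠ 0) →
        Valid d sm X S H W r ∧ solSize d sm X S r ≤ opt T d r := by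
  classical
  let O : Finset (Finset (Fin n)) :=
    Finset.univ.filter fun Z => Solves T d r Z ∧ Z.card = opt T d r
  have hO : O.Nonempty := by
    obtain ⟨Z, hZ⟩ := exists_solves_opt (T := T) (r := r) hs.dist
    exact ⟨Z, by simpa [O] using hZ⟩
  -- Minimal size and then maximal hull exclude the two outcomes of `exists_better`.
  obtain ⟨Z, hZ, hmax⟩ := O.exists_max_image (fun Z => (hull sm Z).card) hO
  simp only [O, Finset.mem_filter, Finset.mem_univ, true_and] at hZ hmax
  obtain ⟨hsol, hcard⟩ := hZ
  refine ⟨Z, hsol, hcard, ?_, ?_⟩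
  · have hsub : Solves T d r (Z.filter fun z => d r z < n) := by
      intro u v hT hu hv
      obtain ⟨z, hz, hd⟩ := hsol u v hT hu hv
      refine ⟨z, Finset.mem_filter.2 ⟨hz, ?_⟩, hd⟩
      have := reachable_of_dt_add (hs.reach hu hv) (w := z) (by rw [← hs.dist]; exact hd)
      rw [hs.dist, dt_lt_iff] at hu ⊢
      exact hu.trans this
    have := opt_le hsub
    rw [← hcard] at this
    have heq := Finset.eq_of_subset_of_card_le (Finset.filter_subset _ Z) this
    exact Finset.filter_eq_self.1 heq
  · intro X S H W hX hS hH hW hcov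
    rw [← hcard]
    refine hs.valid_of_unique hsol hX hS hW hcov ?_
    intro s hsZ hsS s' hsZ' hss
    by_contra hne
    obtain ⟨Z', hZ', h | ⟨h, h'⟩⟩ := hs.exists_better hsol hX hS
      (fun u v h => hcov u v ((hH u v).2 h)) hsZ hsS hsZ' hss hne
    · have := opt_le hZ'
      omega
    · have h₁ := opt_le hZ'
      have h₂ := hmax Z' ⟨hZ', by omega⟩
      omega

end Setup

end Solutions

end HGI

namespace HGI

/-! ### Correctness of the preparation -/

section Prep

variable {n : ℕ} {G : SimpleGraph (Fin n)}

/-- Each round before stabilisation adds a vertex, so after `n` rounds the set is stable or full. -/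
theorem iterate_fixed {F : Finset (Fin n) → Finset (Fin n)} (hF : ∀ s, s ⊆ F s)
    (s : Finset (Fin n)) : F (F^[n] s) = F^[n] s := by
  have key : ∀ j, F (F^[j] s) = F^[j] s ∨ j ≤ (F^[j] s).card := by
    intro j
    induction j with
    | zero => exact Or.inr (Nat.zero_le _)
    | succ j ih =>
      rw [Function.iterate_succ_apply']
      by_cases h : F (F^[j] s) = F^[j] s
      · exact Or.inl (by rw [h, h])
      · have := Finset.card_lt_card ((hF (F^[j] s)).ssubset_of_ne (Ne.symm h))
        exact Or.inr (by have := ih.resolve_left h; omega)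
  obtain h | h := key n
  · exact h
  · have hu : F^[n] s = Finset.univ := by
      rw [← Finset.card_eq_iff_eq_univ, Fintype.card_fin]
      exact le_antisymm (by simpa using Finset.card_le_univ (F^[n] s)) h
    exact subset_antisymm (by rw [hu]; exact Finset.subset_univ _) (hF _)

open Classical in
/-- Add the vertices that distinguish two vertices of `s`. -/
noncomputable def addSplitters (G : SimpleGraph (Fin n)) (u : Fin n) (s : Finset (Fin n)) :
    Finset (Fin n) :=
  Finset.univ.filter fun w => w ∈ s ∨
    (G.Reachable u w ∧ ∃ a b, a ∈ s ∧ b ∈ s ∧ G.Adj a w ∧ ¬ G.Adj b w)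

theorem mem_addSplitters {u w : Fin n} {s : Finset (Fin n)} :
    w ∈ addSplitters G u s ↔ w ∈ s ∨
      (G.Reachable u w ∧ ∃ a b, a ∈ s ∧ b ∈ s ∧ G.Adj a w ∧ ¬ G.Adj b w) := by
  simp [addSplitters]

/-- Every module containing `u` and `v` absorbs the vertices that distinguish two of its members, so
the closure under splitters is the least such module. A proper one exists exactly when this closure
is proper. -/
theorem exists_properMod_iff {u v : Fin n} (huv : G.Reachable u v) :
    (∃ M, ProperMod G u M ∧ u ∈ M ∧ v ∈ M) ↔
      ∃ w, G.Reachable u w ∧ w ∉ (addSplitters G u)^[n] {u, v} := by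
  constructor
  · rintro ⟨M, hM, hu, hv⟩
    obtain ⟨w, hw, hwM⟩ := hM.proper
    refine ⟨w, hw, fun h => hwM ?_⟩
    have : ∀ j, ∀ x ∈ (addSplitters G u)^[j] {u, v}, x ∈ M := by
      intro j
      induction j with
      | zero => simp [hu, hv]
      | succ j ih =>
        intro x hx
        rw [Function.iterate_succ_apply', mem_addSplitters] at hx
        obtain hx | ⟨-, a, b, ha, hb, hax, hbx⟩ := hx
        · exact ih x hx
        · by_contra hxM
          exact hbx ((hM.mod a (ih a ha) b (ih b hb) x hxM).1 hax)
    exact this n w h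
  · intro hproper
    have hfix := iterate_fixed (F := addSplitters G u)
      (fun s x hx => mem_addSplitters.2 (Or.inl hx)) {u, v}
    have hsub : ∀ j, ∀ x ∈ (addSplitters G u)^[j] {u, v}, G.Reachable u x := by
      intro j
      induction j with
      | zero => simp [huv]
      | succ j ih =>
        intro x hx
        rw [Function.iterate_succ_apply', mem_addSplitters] at hx
        exact hx.elim (ih x) fun h => h.1
    have hmem : ∀ j, ∀ x ∈ ({u, v} : Finset (Fin n)), x ∈ (addSplitters G u)^[j] {u, v} := by
      intro j x hx
      induction j with
      | zero => exact hx
      | succ j ih =>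
        rw [Function.iterate_succ_apply', mem_addSplitters]
        exact Or.inl ih
    refine ⟨((addSplitters G u)^[n] {u, v} : Finset (Fin n)), ⟨hsub n, ?_, by simpa using hproper⟩,
      hmem n u (by simp), hmem n v (by simp)⟩
    have key : ∀ a ∈ (addSplitters G u)^[n] {u, v}, ∀ b ∈ (addSplitters G u)^[n] {u, v},
        ∀ w ∉ (addSplitters G u)^[n] {u, v}, G.Adj a w → G.Adj b w := by
      intro a ha b hb w hw haw
      by_contra hbw
      refine hw ?_
      rw [← hfix, mem_addSplitters]
      exact Or.inr ⟨(hsub n a ha).trans haw.reachable, a, b, ha, hb, haw, hbw⟩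
    exact fun a ha b hb w hw => ⟨key a ha b hb w hw, key b hb a ha w hw⟩

theorem closureStep_spec {D : Data n} (hA : ∀ u v, D.ar 0 u v ≠ 0 ↔ G.Adj u v)
    (hd : D.ar 2 = dt G) (u v : Fin n) :
    (∀ b, b ≠ 5 → b ≠ 6 → (closureStep u v D).ar b = D.ar b) ∧ (closureStep u v D).sc = D.sc ∧
    (∀ a b, ¬ (a = u ∧ b = v) → (closureStep u v D).ar 5 a b = D.ar 5 a b) ∧
    (G.Reachable u v → ((closureStep u v D).ar 5 u v ≠ 0 ↔
      ∃ M, ProperMod G u M ∧ u ∈ M ∧ v ∈ M)) := by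
  classical
  unfold closureStep andThen
  set D₁ := D.setAr 6 fun w _ => if w = u ∨ w = v then 1 else 0 with hD₁
  set D₂ := forV _ D₁ with hD₂
  have h : (∀ b, b ≠ 6 → D₂.ar b = D.ar b) ∧ D₂.sc = D.sc ∧
      ∀ w, D₂.ar 6 w w ≠ 0 ↔ w ∈ (addSplitters G u)^[n] {u, v} := by
    rw [hD₂]
    refine forV_induction (fun j D' => (∀ b, b ≠ 6 → D'.ar b = D.ar b) ∧ D'.sc = D.sc ∧
      ∀ w, D'.ar 6 w w ≠ 0 ↔ w ∈ (addSplitters G u)^[j] {u, v}) ?_ ?_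
    · refine ⟨fun b hb => by simp [hD₁, hb], rfl, fun w => by simp [hD₁]; tauto⟩
    · rintro j D' ⟨h₁, h₂, h₃⟩
      refine ⟨fun b hb => by simp [hb, h₁], by simp [h₂], fun w => ?_⟩
      rw [Function.iterate_succ_apply', mem_addSplitters]
      have e : ∀ a, D'.ar 0 a w = 0 ↔ ¬ G.Adj a w := fun a => by
        rw [h₁ 0 (by omega), ← hA, not_not]
      have e' : ∀ a, D'.ar 0 a w ≠ 0 ↔ G.Adj a w := fun a => by
        rw [h₁ 0 (by omega), ← hA]
      simp only [setAr_ar, if_true, h₃, e, e', h₁ 2 (by omega), hd, dt_lt_iff]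
      simp only [ne_eq, ite_eq_right_iff, one_ne_zero, imp_false, not_not]
  obtain ⟨h₁, h₂, h₃⟩ := h
  refine ⟨fun b hb hb' => by simp [hb, h₁ b hb'], by simp [h₂], fun a b hab => ?_, fun hr => ?_⟩
  · simp only [setAr_ar, if_true, if_neg hab, h₁ 5 (by omega)]
  · rw [exists_properMod_iff hr]
    have e : ∀ w, D₂.ar 6 w w = 0 ↔ w ∉ (addSplitters G u)^[n] {u, v} := fun w => by
      rw [← h₃, not_not]
    simp only [setAr_ar, if_true, and_self, e, h₁ 2 (by omega), hd, dt_lt_iff]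
    simp only [ne_eq, ite_eq_right_iff, one_ne_zero, imp_false, not_not]

theorem sameMod_iff {c C : Fin n → Fin n → ℕ} {u v : Fin n} (hc : c = dt (coGraph G))
    (hC : G.Reachable u v → (C u v ≠ 0 ↔ ∃ M, ProperMod G u M ∧ u ∈ M ∧ v ∈ M)) :
    SameMod (dt G) u v c C ↔ Same G u v := by
  have hroot : ∀ r, IsRoot (dt G) r ↔ Root G r := fun r => by simp [IsRoot, Root, dt_lt_iff]
  have hcod : CoDisc (dt G) u c ↔ CoD G u := by simp [CoDisc, CoD, dt_lt_iff, hc]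
  unfold SameMod Same
  rw [dt_lt_iff, hcod]
  refine and_congr_right fun h => ?_
  rw [hC h]
  simp only [dt_lt_iff, hroot, hc]

theorem prepStep_spec {D : Data n} (hA : ∀ u v, D.ar 0 u v ≠ 0 ↔ G.Adj u v) :
    (prepStep D).sc = D.sc ∧ (prepStep D).ar 1 = D.ar 1 ∧
      Setup G ((prepStep D).ar 0) ((prepStep D).ar 2) ((prepStep D).ar 5) ∧
      ∀ u v, (prepStep D).ar 5 u v ≠ 0 ↔ Same G u v := by
  classical
  unfold prepStep andThen
  rw [distStep_eq (by omega) hA, distStep_eq (G := coGraph G) (by omega)]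
  swap
  · intro u v
    simp only [setAr_ar]
    have : D.ar 0 u v = 0 ↔ ¬ G.Adj u v := by rw [← hA, not_not]
    simp [dt_lt_iff, this, coGraph]
  set D₁ := ((D.setAr 2 (dt G)).setAr 3 _).setAr 4 (dt (coGraph G)) with hD₁
  have h0 : D₁.ar 0 = D.ar 0 := by simp [hD₁]
  have h1 : D₁.ar 1 = D.ar 1 := by simp [hD₁]
  have h2 : D₁.ar 2 = dt G := by simp [hD₁]
  have h4 : D₁.ar 4 = dt (coGraph G) := by simp [hD₁]
  have hsc : D₁.sc = D.sc := rfl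
  clear_value D₁
  set D₂ := forV _ D₁ with hD₂
  have h : (∀ b, b ≠ 5 → b ≠ 6 → D₂.ar b = D₁.ar b) ∧ D₂.sc = D₁.sc ∧
      ∀ a b : Fin n, (a : ℕ) < n → G.Reachable a b →
        (D₂.ar 5 a b ≠ 0 ↔ ∃ M, ProperMod G a M ∧ a ∈ M ∧ b ∈ M) := by
    rw [hD₂]
    refine forV_induction (fun j D' => (∀ b, b ≠ 5 → b ≠ 6 → D'.ar b = D₁.ar b) ∧
      D'.sc = D₁.sc ∧ ∀ a b : Fin n, (a : ℕ) < j → G.Reachable a b →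
        (D'.ar 5 a b ≠ 0 ↔ ∃ M, ProperMod G a M ∧ a ∈ M ∧ b ∈ M)) ?_ ?_
    · exact ⟨fun _ _ _ => rfl, rfl, fun a b ha => absurd ha (by omega)⟩
    rintro u D' ⟨g₁, g₂, g₃⟩
    have := forV_induction (f := fun v => closureStep u v) (D := D') (fun j D' =>
      (∀ b, b ≠ 5 → b ≠ 6 → D'.ar b = D₁.ar b) ∧
      D'.sc = D₁.sc ∧ ∀ a b : Fin n, a < u ∨ a = u ∧ (b : ℕ) < j → G.Reachable a b →
        (D'.ar 5 a b ≠ 0 ↔ ∃ M, ProperMod G a M ∧ a ∈ M ∧ b ∈ M)) ?_ ?_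
    · obtain ⟨f₁, f₂, f₃⟩ := this
      refine ⟨f₁, f₂, fun a b hab => f₃ a b ?_⟩
      rcases lt_trichotomy a u with h | h | h
      · exact Or.inl h
      · exact Or.inr ⟨h, b.2⟩
      · rw [Fin.lt_def] at h; omega
    · refine ⟨g₁, g₂, fun a b hab => g₃ a b ?_⟩
      simpa using hab
    · rintro v D'' ⟨f₁, f₂, f₃⟩
      obtain ⟨e₁, e₂, e₃, e₄⟩ := closureStep_spec (D := D'') (G := G)
        (by rw [f₁ 0 (by omega) (by omega), h0]; exact hA)
        (by rw [f₁ 2 (by omega) (by omega), h2]) u v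
      refine ⟨fun b hb hb' => (e₁ b hb hb').trans (f₁ b hb hb'), e₂.trans f₂, ?_⟩
      intro a b hab hr
      by_cases huv : a = u ∧ b = v
      · obtain ⟨rfl, rfl⟩ := huv
        exact e₄ hr
      · rw [e₃ a b huv]
        refine f₃ a b ?_ hr
        simp only [Fin.lt_def, Fin.ext_iff] at hab huv ⊢
        omega
  obtain ⟨g₁, g₂, g₃⟩ := h
  clear_value D₂
  have hsame : ∀ u v, SameMod (D₂.ar 2) u v (D₂.ar 4) (D₂.ar 5) ↔ Same G u v := fun u v => by
    rw [g₁ 2 (by omega) (by omega), h2]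
    exact sameMod_iff (by rw [g₁ 4 (by omega) (by omega), h4]) (g₃ u v u.2)
  have e5 : ∀ u v, (if SameMod (D₂.ar 2) u v (D₂.ar 4) (D₂.ar 5) then 1 else 0) ≠ 0 ↔
      Same G u v := fun u v => by simp [hsame]
  refine ⟨by simp [g₂, hsc], by simp [g₁, h1], ⟨?_, ?_, ?_⟩, by simpa using e5⟩
  · simpa [g₁, h0] using hA
  · simp [g₁, h2]
  · simp only [setAr_ar, if_true, e5]
    exact isModRel_same

end Prep

end HGI

namespace HGI

/-! ### Correctness of a guess -/

section Guess

variable {n : ℕ}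

/-- A guess is one number, read bit by bit from the low end. Completeness proofs build it from the
last decision backwards, as `2 * w` or `2 * w + 1`. -/
theorem lastBit_double (w : ℕ) : lastBit (2 * w) = 0 := by unfold lastBit; omega

theorem lastBit_double_add (w : ℕ) : lastBit (2 * w + 1) = 1 := by unfold lastBit; omega

open Classical in
/-- One round of `guessX`. -/
noncomputable def guessXRound (r v : Fin n) (D : Data n) : Data n :=
  if IsRep (D.ar 2) (D.ar 5) r v then
    andThen (fun D => D.setAr 7 fun a _ => if a = v then lastBit (D.sc 3) else D.ar 7 a a)
      (fun D => D.setSc 3 (D.sc 3 / 2)) D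
  else D.setAr 7 fun a _ => if a = v then 0 else D.ar 7 a a

theorem guessXRound_ar {r v : Fin n} {D : Data n} {b : ℕ} (hb : b ≠ 7) :
    (guessXRound r v D).ar b = D.ar b := by
  unfold guessXRound; split_ifs <;> simp [andThen, hb]

theorem guessXRound_sc {r v : Fin n} {D : Data n} {i : ℕ} (hi : i ≠ 3) :
    (guessXRound r v D).sc i = D.sc i := by
  unfold guessXRound; split_ifs <;> simp [andThen, hi]

theorem guessXRound_other {r v a : Fin n} {D : Data n} (ha : a ≠ v) :
    (guessXRound r v D).ar 7 a a = D.ar 7 a a := by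
  unfold guessXRound; split_ifs <;> simp [andThen, ha]

open Classical in
theorem guessX_eq (r : Fin n) (D : Data n) : guessX r D =
    (forV (guessXRound r) D).setAr 7 fun a _ =>
      if ∃ x, IsRep ((forV (guessXRound r) D).ar 2) ((forV (guessXRound r) D).ar 5) r x ∧
        (forV (guessXRound r) D).ar 5 x a ≠ 0 ∧ (forV (guessXRound r) D).ar 7 x x ≠ 0
      then 1 else 0 := rfl

theorem forV_guessX_ar {r : Fin n} {D : Data n} {b : ℕ} (hb : b ≠ 7) :
    (forV (guessXRound r) D).ar b = D.ar b :=
  forV_induction (fun _ D' => D'.ar b = D.ar b) rfl fun _ _ h => (guessXRound_ar hb).trans h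

theorem guessX_ar {r : Fin n} {D : Data n} {b : ℕ} (hb : b ≠ 7) :
    (guessX r D).ar b = D.ar b := by
  rw [guessX_eq, setAr_ar, if_neg hb, forV_guessX_ar hb]

theorem guessX_sc {r : Fin n} {D : Data n} {i : ℕ} (hi : i ≠ 3) :
    (guessX r D).sc i = D.sc i := by
  rw [guessX_eq, setAr_sc]
  exact forV_induction (fun _ D' => D'.sc i = D.sc i) rfl fun _ _ h => (guessXRound_sc hi).trans h

-- The number `w'` is what remains unread after the module bits; it is prescribed so that the guess
-- of the cover can follow. The factor `w' + 1` in the bound makes the two guesses combine.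
open Classical in
theorem exists_guessX_list (d sm : Fin n → Fin n → ℕ) (r : Fin n) (Z : Finset (Fin n))
    (l : List (Fin n)) (hl : l.Nodup) (w' : ℕ) :
    ∃ w, w < 2 ^ l.countP (fun v => IsRep d sm r v) * (w' + 1) ∧ ∀ D : Data n, D.ar 2 = d →
      D.ar 5 = sm → D.sc 3 = w → (l.foldl (fun D v => guessXRound r v D) D).sc 3 = w' ∧
        ∀ v, (v ∈ l → IsRep d sm r v →
          ((l.foldl (fun D v => guessXRound r v D) D).ar 7 v v ≠ 0 ↔ v ∈ Z)) ∧
        (v ∉ l → (l.foldl (fun D v => guessXRound r v D) D).ar 7 v v = D.ar 7 v v) := by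
  induction l with
  | nil => exact ⟨w', by simp, fun D _ _ h => by simp [h]⟩
  | cons v l ih =>
    obtain ⟨hvl, hl⟩ := List.nodup_cons.1 hl
    obtain ⟨w, hw, h⟩ := ih hl
    by_cases hv : IsRep d sm r v
    · refine ⟨2 * w + if v ∈ Z then 1 else 0, ?_, fun D h2 h5 h3 => ?_⟩
      · rw [List.countP_cons_of_pos (by simpa using hv), pow_succ]
        split_ifs <;> nlinarith
      · have hr : guessXRound r v D = (D.setAr 7 fun a _ => if a = v then lastBit (D.sc 3)
            else D.ar 7 a a).setSc 3 (D.sc 3 / 2) := by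
          unfold guessXRound
          rw [if_pos (by rwa [h2, h5])]
          rfl
        obtain ⟨g₁, g₂⟩ := h (guessXRound r v D) (by rw [guessXRound_ar (by omega), h2])
          (by rw [guessXRound_ar (by omega), h5])
          (by rw [hr]; simp only [setSc_sc, if_true, h3]; split_ifs <;> omega)
        refine ⟨g₁, fun x => ⟨fun hx hxr => ?_, fun hx => ?_⟩⟩
        · by_cases hxv : x = v
          · subst hxv
            rw [List.foldl_cons, (g₂ x).2 hvl, hr]
            simp only [setSc_ar, setAr_ar, if_true, h3]
            split_ifs with hZ
            · simp [lastBit_double_add, hZ]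
            · simp [lastBit_double, hZ]
          · exact (g₂ x).1 ((List.mem_cons.1 hx).resolve_left hxv) hxr
        · rw [List.mem_cons, not_or] at hx
          rw [List.foldl_cons, (g₂ x).2 hx.2, guessXRound_other hx.1]
    · refine ⟨w, ?_, fun D h2 h5 h3 => ?_⟩
      · rwa [List.countP_cons_of_neg (by simpa using hv)]
      · have hr : guessXRound r v D = D.setAr 7 fun a _ => if a = v then 0 else D.ar 7 a a := by
          unfold guessXRound
          rw [if_neg (by rwa [h2, h5])]
        obtain ⟨g₁, g₂⟩ := h (guessXRound r v D) (by rw [guessXRound_ar (by omega), h2])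
          (by rw [guessXRound_ar (by omega), h5]) (by rw [hr]; exact h3)
        refine ⟨g₁, fun x => ⟨fun hx hxr => ?_, fun hx => ?_⟩⟩
        · have hxv : x ≠ v := by rintro rfl; exact hv hxr
          exact (g₂ x).1 ((List.mem_cons.1 hx).resolve_left hxv) hxr
        · rw [List.mem_cons, not_or] at hx
          rw [List.foldl_cons, (g₂ x).2 hx.2, guessXRound_other hx.1]

open Classical in
/-- Every set of modules is guessed. -/
theorem exists_guessX (d sm : Fin n → Fin n → ℕ) (r : Fin n) (Z : Finset (Fin n)) (w' : ℕ) :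
    ∃ w, w < 2 ^ (List.finRange n).countP (fun v => IsRep d sm r v) * (w' + 1) ∧
      ∀ D : Data n, D.ar 2 = d → D.ar 5 = sm → D.sc 3 = w → (guessX r D).sc 3 = w' ∧
        (guessX r D).ar 7 = fun a _ =>
          if ∃ x, IsRep d sm r x ∧ sm x a ≠ 0 ∧ x ∈ Z then 1 else 0 := by
  obtain ⟨w, hw, h⟩ := exists_guessX_list d sm r Z _ (List.nodup_finRange n) w'
  refine ⟨w, hw, fun D h2 h5 h3 => ?_⟩
  obtain ⟨g₁, g₂⟩ := h D h2 h5 h3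
  rw [guessX_eq]
  refine ⟨g₁, ?_⟩
  simp only [setAr_ar, if_true]
  funext a _
  rw [forV_guessX_ar (b := 2) (by omega), forV_guessX_ar (b := 5) (by omega), h2, h5]
  congr 1
  refine propext (exists_congr fun x => and_congr_right fun hx => and_congr_right fun _ => ?_)
  exact (g₂ x).1 (List.mem_finRange x) hx

theorem guessX_rep {r a : Fin n} {D : Data n} (ha : (guessX r D).ar 7 a a ≠ 0)
    (hrefl : ∀ u, D.ar 5 u u ≠ 0) : ∃ x, IsRep (D.ar 2) (D.ar 5) r x ∧ D.ar 5 x a ≠ 0 ∧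
      (guessX r D).ar 7 x x ≠ 0 := by
  rw [guessX_eq] at ha ⊢
  simp only [setAr_ar, if_true, ne_eq, ite_eq_right_iff, one_ne_zero, imp_false, not_not] at ha ⊢
  rw [forV_guessX_ar (b := 2) (by omega), forV_guessX_ar (b := 5) (by omega)] at ha ⊢
  obtain ⟨x, h₁, h₂, h₃⟩ := ha
  exact ⟨x, h₁, h₂, x, h₁, hrefl x, h₃⟩

theorem exists_firstUnc {S H : Fin n → Fin n → ℕ} (h : ∃ u v, Unc S H u v) :
    ∃ u v, FirstUnc S H u v := by
  classical
  obtain ⟨u, v, h⟩ := h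
  have hne : (Finset.univ.filter fun p : Fin n × Fin n => Unc S H p.1 p.2).Nonempty :=
    ⟨(u, v), by simpa using h⟩
  obtain ⟨p, hp, hmin⟩ := Finset.exists_min_image _ (fun p : Fin n × Fin n => toLex p) hne
  simp only [Finset.mem_filter, Finset.mem_univ, true_and] at hp hmin
  exact ⟨p.1, p.2, hp, fun u' v' h' => Prod.Lex.toLex_le_toLex.1 (hmin (u', v') h')⟩

theorem FirstUnc.unique {S H : Fin n → Fin n → ℕ} {u v u' v' : Fin n} (h : FirstUnc S H u v)
    (h' : FirstUnc S H u' v') : u' = u ∧ v' = v := by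
  have h₁ := h.2 u' v' h'.1
  have h₂ := h'.2 u v h.1
  simp only [Fin.lt_def, Fin.le_def, Fin.ext_iff] at *
  omega

open Classical in
/-- One round of `guessS`. -/
noncomputable def guessSRound (v : Fin n) (D : Data n) : Data n :=
  if (v : ℕ) < D.sc 0 then
    andThen (fun D => D.setAr 8 fun a _ => if D.ar 8 a a ≠ 0 ∨
        ∃ u v, FirstUnc (D.ar 8) (D.ar 9) u v ∧
          (lastBit (D.sc 3) ≠ 0 ∧ a = u ∨ lastBit (D.sc 3) = 0 ∧ a = v) then 1 else 0)
      (fun D => D.setSc 3 (D.sc 3 / 2)) D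
  else D

theorem guessS_eq (D : Data n) :
    guessS D = forV guessSRound (D.setAr 8 fun _ _ => 0) := rfl

theorem guessSRound_ar {v : Fin n} {D : Data n} {b : ℕ} (hb : b ≠ 8) :
    (guessSRound v D).ar b = D.ar b := by
  unfold guessSRound; split_ifs <;> simp [andThen, hb]

theorem guessSRound_sc {v : Fin n} {D : Data n} {i : ℕ} (hi : i ≠ 3) :
    (guessSRound v D).sc i = D.sc i := by
  unfold guessSRound; split_ifs <;> simp [andThen, hi]

theorem guessS_ar {D : Data n} {b : ℕ} (hb : b ≠ 8) : (guessS D).ar b = D.ar b := by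
  rw [guessS_eq]
  exact forV_induction (fun _ D' => D'.ar b = D.ar b) (by simp [hb])
    fun _ _ h => (guessSRound_ar hb).trans h

theorem guessS_sc {D : Data n} {i : ℕ} (hi : i ≠ 3) : (guessS D).sc i = D.sc i := by
  rw [guessS_eq]
  exact forV_induction (fun _ D' => D'.sc i = D.sc i) rfl
    fun _ _ h => (guessSRound_sc hi).trans h

theorem unc_congr {S S' H : Fin n → Fin n → ℕ} (h : ∀ a, S a a ≠ 0 ↔ S' a a ≠ 0) (u v : Fin n) :
    Unc S H u v ↔ Unc S' H u v := by
  unfold Unc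
  have hu := not_iff_not.2 (h u)
  have hv := not_iff_not.2 (h v)
  rw [not_not, not_not] at hu hv
  rw [hu, hv]

theorem firstUnc_congr {S S' H : Fin n → Fin n → ℕ} (h : ∀ a, S a a ≠ 0 ↔ S' a a ≠ 0)
    (u v : Fin n) : FirstUnc S H u v ↔ FirstUnc S' H u v := by
  simp only [FirstUnc, unc_congr h]

-- Bounded search tree: `Z` contains an end of the first uncovered pair, and the next bit selects
-- it. So in every round `S` gains a vertex of `Z`, unless all pairs are covered already.
open Classical in
theorem exists_guessS_list (H : Fin n → Fin n → ℕ) (K : ℕ) (Z : Finset (Fin n))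
    (hZ : ∀ u v, H u v ≠ 0 → u ∈ Z ∨ v ∈ Z) (l : List (Fin n)) (S₀ : Finset (Fin n))
    (hS₀ : S₀ ⊆ Z) :
    ∃ w, w < 2 ^ l.countP (fun v : Fin n => (v : ℕ) < K) ∧ ∀ D : Data n, D.sc 0 = K → D.sc 3 = w →
      D.ar 9 = H → (∀ a, D.ar 8 a a ≠ 0 ↔ a ∈ S₀) →
      ∃ S₁ ⊆ Z, (∀ a, (l.foldl (fun D v => guessSRound v D) D).ar 8 a a ≠ 0 ↔ a ∈ S₁) ∧
        S₀ ⊆ S₁ ∧ ((∀ u v, H u v ≠ 0 → u ∈ S₁ ∨ v ∈ S₁) ∨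
          S₀.card + l.countP (fun v : Fin n => (v : ℕ) < K) ≤ S₁.card) := by
  induction l generalizing S₀ with
  | nil => exact ⟨0, by simp, fun D _ _ _ h => ⟨S₀, hS₀, h, subset_rfl, Or.inr (by simp)⟩⟩
  | cons v l ih =>
    by_cases hv : (v : ℕ) < K
    swap
    · obtain ⟨w, hw, h⟩ := ih S₀ hS₀
      refine ⟨w, by rwa [List.countP_cons_of_neg (by simpa using hv)], fun D h0 h3 h9 h8 => ?_⟩
      have hr : guessSRound v D = D := by
        unfold guessSRound
        rw [if_neg (by rwa [h0])]
      rw [List.foldl_cons, hr, List.countP_cons_of_neg (by simpa using hv)]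
      exact h D h0 h3 h9 h8
    rw [List.countP_cons_of_pos (by simpa using hv), pow_succ]
    let S' : Fin n → Fin n → ℕ := fun a _ => if a ∈ S₀ then 1 else 0
    have hS' : ∀ a, S' a a ≠ 0 ↔ a ∈ S₀ := fun a => by simp [S']
    -- what a round does
    have round : ∀ D : Data n, D.sc 0 = K → D.ar 9 = H → (∀ a, D.ar 8 a a ≠ 0 ↔ a ∈ S₀) →
        (guessSRound v D).sc 3 = D.sc 3 / 2 ∧ ∀ a, (guessSRound v D).ar 8 a a ≠ 0 ↔
          a ∈ S₀ ∨ ∃ u v, FirstUnc S' H u v ∧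
            (lastBit (D.sc 3) ≠ 0 ∧ a = u ∨ lastBit (D.sc 3) = 0 ∧ a = v) := by
      intro D h0 h9 h8
      unfold guessSRound
      rw [if_pos (by rwa [h0])]
      refine ⟨by simp [andThen], fun a => ?_⟩
      have e := firstUnc_congr (H := H) (fun a => (h8 a).trans (hS' a).symm)
      simp only [andThen, setSc_ar, setAr_ar, if_true, h8, h9, e]
      simp only [ne_eq, ite_eq_right_iff, one_ne_zero, imp_false, not_not]
    by_cases hcov : ∃ u v, Unc S' H u v
    · obtain ⟨u₀, v₀, hf⟩ := exists_firstUnc hcov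
      have hx : ∃ b x, (b = 0 ∨ b = 1) ∧ x ∈ Z ∧ x ∉ S₀ ∧ ∀ w a,
          (∃ u v, FirstUnc S' H u v ∧ (lastBit (2 * w + b) ≠ 0 ∧ a = u ∨
            lastBit (2 * w + b) = 0 ∧ a = v)) ↔ a = x := by
        have hu₀ : u₀ ∉ S₀ := fun h => (hS' u₀).2 h hf.1.2.1
        have hv₀ : v₀ ∉ S₀ := fun h => (hS' v₀).2 h hf.1.2.2
        obtain h | h := hZ u₀ v₀ hf.1.1
        · refine ⟨1, u₀, Or.inr rfl, h, hu₀, fun w a => ?_⟩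
          rw [lastBit_double_add]
          constructor
          · rintro ⟨u, v, huv, h | h⟩
            · rw [h.2, (hf.unique huv).1]
            · exact absurd h.1 one_ne_zero
          · rintro rfl
            exact ⟨a, v₀, hf, Or.inl ⟨one_ne_zero, rfl⟩⟩
        · refine ⟨0, v₀, Or.inl rfl, h, hv₀, fun w a => ?_⟩
          rw [add_zero, lastBit_double]
          constructor
          · rintro ⟨u, v, huv, h | h⟩
            · exact absurd rfl h.1
            · rw [h.2, (hf.unique huv).2]
          · rintro rfl
            exact ⟨u₀, a, hf, Or.inr ⟨rfl, rfl⟩⟩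
      obtain ⟨b, x, hb, hxZ, hxS, hx⟩ := hx
      obtain ⟨w, hw, h⟩ := ih (insert x S₀) (Finset.insert_subset hxZ hS₀)
      refine ⟨2 * w + b, by omega, fun D h0 h3 h9 h8 => ?_⟩
      obtain ⟨e₁, e₂⟩ := round D h0 h9 h8
      obtain ⟨S₁, f₁, f₂, f₃, f₄⟩ := h (guessSRound v D) (by rw [guessSRound_sc (by omega), h0])
        (by rw [e₁, h3]; omega) (by rw [guessSRound_ar (by omega), h9])
        (fun a => by rw [e₂, h3, hx, Finset.mem_insert, or_comm])
      refine ⟨S₁, f₁, f₂, (Finset.subset_insert _ _).trans f₃, f₄.imp id fun h => ?_⟩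
      rw [Finset.card_insert_of_notMem hxS] at h
      omega
    · obtain ⟨w, hw, h⟩ := ih S₀ hS₀
      refine ⟨2 * w, by omega, fun D h0 h3 h9 h8 => ?_⟩
      obtain ⟨e₁, e₂⟩ := round D h0 h9 h8
      have hno : ∀ u v, ¬ FirstUnc S' H u v := fun u v h => hcov ⟨u, v, h.1⟩
      obtain ⟨S₁, f₁, f₂, f₃, -⟩ := h (guessSRound v D) (by rw [guessSRound_sc (by omega), h0])
        (by rw [e₁, h3]; omega) (by rw [guessSRound_ar (by omega), h9])
        (fun a => by rw [e₂]; simp [hno])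
      refine ⟨S₁, f₁, f₂, f₃, Or.inl fun u v huv => ?_⟩
      by_contra hn
      rw [not_or] at hn
      refine hcov ⟨u, v, huv, ?_, ?_⟩
      · by_contra h; exact hn.1 (f₃ ((hS' u).1 h))
      · by_contra h; exact hn.2 (f₃ ((hS' v).1 h))

theorem countP_lt (K : ℕ) : (List.finRange n).countP (fun v : Fin n => (v : ℕ) < K) = min K n := by
  have : (List.finRange n).countP (fun v : Fin n => (v : ℕ) < K) =
      (List.range n).countP (fun i => i < K) := by
    rw [← List.map_coe_finRange_eq_range, List.countP_map]
    rfl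
  rw [this]
  clear this
  induction n with
  | zero => simp
  | succ n ih =>
    rw [List.range_succ, List.countP_append, ih, List.countP_singleton]
    by_cases h : n < K
    · simp only [h, decide_true, if_true]; omega
    · simp only [h, decide_false, Bool.false_eq_true, if_false]; omega

open Classical in
/-- The cover is guessed if the budget is large enough. -/
theorem exists_guessS (H : Fin n → Fin n → ℕ) (K : ℕ) (Z : Finset (Fin n))
    (hZ : ∀ u v, H u v ≠ 0 → u ∈ Z ∨ v ∈ Z) (hK : Z.card ≤ K) :
    ∃ w, w < 2 ^ min K n ∧ ∀ D : Data n, D.sc 0 = K → D.sc 3 = w → D.ar 9 = H →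
      (∀ a, (guessS D).ar 8 a a ≠ 0 → a ∈ Z) ∧
      ∀ u v, H u v ≠ 0 → (guessS D).ar 8 u u ≠ 0 ∨ (guessS D).ar 8 v v ≠ 0 := by
  obtain ⟨w, hw, h⟩ := exists_guessS_list H K Z hZ (List.finRange n) ∅ (by simp)
  rw [countP_lt] at hw h
  refine ⟨w, hw, fun D h0 h3 h9 => ?_⟩
  obtain ⟨S₁, f₁, f₂, -, f₄⟩ := h (D.setAr 8 fun _ _ => 0) h0 h3 (by simpa using h9) (by simp)
  change ∀ a, (guessS D).ar 8 a a ≠ 0 ↔ a ∈ S₁ at f₂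
  simp only [f₂]
  refine ⟨fun a ha => f₁ ha, ?_⟩
  obtain h | h := f₄
  · exact h
  -- All `min K n` rounds added a vertex, and `Z` has no more than that many, so the guessed set is
  -- `Z` itself.
  · have hn : Z.card ≤ n := by simpa using Finset.card_le_univ Z
    have : S₁ = Z := Finset.eq_of_subset_of_card_le f₁ (by simp at h; omega)
    rwa [this]

end Guess

end HGI

namespace HGI

/-! ### Correctness of the algorithm -/

section Component

variable {n : ℕ} {G : SimpleGraph (Fin n)} {A T d sm : Fin n → Fin n → ℕ} {r : Fin n}

/-- The data before a guess is checked. -/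
noncomputable def beforeCheck (r : Fin n) (D : Data n) : Data n :=
  guessS (pairStep r (guessX r (D.setSc 3 (D.sc 2))))

open Classical in
theorem tryStep_eq (r : Fin n) (D : Data n) : tryStep r D =
    if Valid ((beforeCheck r D).ar 2) ((beforeCheck r D).ar 5) ((beforeCheck r D).ar 7)
        ((beforeCheck r D).ar 8) ((beforeCheck r D).ar 9) ((beforeCheck r D).ar 10) r ∧
        solSize ((beforeCheck r D).ar 2) ((beforeCheck r D).ar 5) ((beforeCheck r D).ar 7)
          ((beforeCheck r D).ar 8) r < (beforeCheck r D).sc 4 then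
      (beforeCheck r D).setSc 4 (solSize ((beforeCheck r D).ar 2) ((beforeCheck r D).ar 5)
        ((beforeCheck r D).ar 7) ((beforeCheck r D).ar 8) r)
    else beforeCheck r D := rfl

theorem beforeCheck_ar {D : Data n} {b : ℕ} (hb : b < 7) :
    (beforeCheck r D).ar b = D.ar b := by
  unfold beforeCheck pairStep andThen
  rw [guessS_ar (by omega), setAr_ar, if_neg (by omega), setAr_ar, if_neg (by omega),
    guessX_ar (by omega), setSc_ar]

theorem beforeCheck_sc {D : Data n} {i : ℕ} (hi : i ≠ 3) :
    (beforeCheck r D).sc i = D.sc i := by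
  unfold beforeCheck pairStep andThen
  rw [guessS_sc hi, setAr_sc, setAr_sc, guessX_sc hi, setSc_sc, if_neg hi]

theorem beforeCheck_seven (D : Data n) :
    (beforeCheck r D).ar 7 = (guessX r (D.setSc 3 (D.sc 2))).ar 7 := by
  unfold beforeCheck pairStep andThen
  rw [guessS_ar (by omega), setAr_ar, if_neg (by omega), setAr_ar, if_neg (by omega)]

open Classical in
theorem beforeCheck_nine (D : Data n) : (beforeCheck r D).ar 9 = fun u v =>
    if Hard (D.ar 0) (D.ar 1) (D.ar 2) (D.ar 5) ((beforeCheck r D).ar 7) r u v then 1 else 0 := by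
  rw [beforeCheck_seven]
  unfold beforeCheck pairStep andThen
  rw [guessS_ar (by omega), setAr_ar, if_neg (by omega), setAr_ar, if_pos rfl]
  rw [guessX_ar (b := 0) (by omega), guessX_ar (b := 1) (by omega), guessX_ar (b := 2) (by omega),
    guessX_ar (b := 5) (by omega), setSc_ar]

open Classical in
theorem beforeCheck_ten (D : Data n) : (beforeCheck r D).ar 10 = fun u v =>
    if Soft (D.ar 0) (D.ar 1) (D.ar 2) (D.ar 5) ((beforeCheck r D).ar 7) r u v then 1 else 0 := by
  rw [beforeCheck_seven]
  unfold beforeCheck pairStep andThen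
  rw [guessS_ar (by omega), setAr_ar, if_pos rfl]
  simp only [setAr_ar, Nat.reduceEqDiff, if_false]
  rw [guessX_ar (b := 0) (by omega), guessX_ar (b := 1) (by omega), guessX_ar (b := 2) (by omega),
    guessX_ar (b := 5) (by omega), setSc_ar]

theorem tryStep_ar {D : Data n} {b : ℕ} (hb : b < 7) : (tryStep r D).ar b = D.ar b := by
  rw [tryStep_eq]
  split_ifs
  · rw [setSc_ar, beforeCheck_ar hb]
  · rw [beforeCheck_ar hb]

theorem tryStep_sc {D : Data n} {i : ℕ} (hi : i ≠ 3) (hi' : i ≠ 4) :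
    (tryStep r D).sc i = D.sc i := by
  rw [tryStep_eq]
  split_ifs
  · rw [setSc_sc, if_neg hi', beforeCheck_sc hi]
  · rw [beforeCheck_sc hi]

theorem tryStep_le (D : Data n) : (tryStep r D).sc 4 ≤ D.sc 4 := by
  rw [tryStep_eq]
  split_ifs with h
  · rw [setSc_sc, if_pos rfl, ← beforeCheck_sc (r := r) (D := D) (i := 4) (by omega)]
    exact h.2.le
  · rw [beforeCheck_sc (by omega)]

/-- A recorded value bounds the size of a genuine solution, whether or not the guess was right. The
guard excludes the initial value `n + 1`, which means that nothing was found. -/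
theorem tryStep_sound {D : Data n} (hs : Setup G (D.ar 0) (D.ar 2) (D.ar 5))
    (h : D.sc 4 ≤ n → opt (D.ar 1) (D.ar 2) r ≤ D.sc 4) :
    (tryStep r D).sc 4 ≤ n → opt (D.ar 1) (D.ar 2) r ≤ (tryStep r D).sc 4 := by
  rw [tryStep_eq]
  split_ifs with hv
  · intro _
    rw [setSc_sc, if_pos rfl]
    have hv := hv.1
    rw [beforeCheck_ar (b := 2) (by omega), beforeCheck_ar (b := 5) (by omega)] at hv ⊢
    obtain ⟨Z, hZ, hcard⟩ := hs.exists_solves_of_valid (T := D.ar 1) (r := r)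
      (fun a ha => by
        rw [beforeCheck_seven] at ha ⊢
        exact guessX_rep ha hs.refl)
      (fun u v => by rw [beforeCheck_nine]; simp)
      (fun u v => by rw [beforeCheck_ten]; simp) hv
    exact (opt_le hZ).trans hcard
  · rwa [beforeCheck_sc (by omega)]

-- The right guess encodes the modules met by the solution of `exists_good_solution`, followed by
-- the choices of the search tree inside that solution.
open Classical in
theorem tryStep_complete (hs : Setup G A d sm) (T : Fin n → Fin n → ℕ) (r : Fin n) {K : ℕ}
    (hK : opt T d r ≤ K) :
    ∃ z, z < 2 ^ (List.finRange n).countP (fun v => IsRep d sm r v) * 2 ^ min K n ∧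
      ∀ D : Data n, D.ar 0 = A → D.ar 1 = T → D.ar 2 = d → D.ar 5 = sm → D.sc 0 = K →
        D.sc 2 = z → (tryStep r D).sc 4 ≤ opt T d r := by
  obtain ⟨Z, hZ, hcard, hcomp, hgood⟩ := hs.exists_good_solution T r
  let X : Fin n → Fin n → ℕ := fun a _ =>
    if ∃ x, IsRep d sm r x ∧ sm x a ≠ 0 ∧ x ∈ Setup.hull sm Z then 1 else 0
  have hX : ∀ a, X a a ≠ 0 ↔ ∃ z ∈ Z, sm z a ≠ 0 := by
    intro a
    simp only [X, ne_eq, ite_eq_right_iff, one_ne_zero, imp_false, not_not, Setup.mem_hull]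
    constructor
    · rintro ⟨x, -, hxa, z, hz, hzx⟩
      exact ⟨z, hz, hs.trans hzx hxa⟩
    · rintro ⟨z, hz, hza⟩
      obtain ⟨x, hx, hxz⟩ := hs.exists_rep (hcomp z hz)
      exact ⟨x, hx, hs.trans hxz hza, z, hz, hs.symm hxz⟩
  let H : Fin n → Fin n → ℕ := fun u v => if Hard A T d sm X r u v then 1 else 0
  have hH : ∀ u v, H u v ≠ 0 ↔ Hard A T d sm X r u v := fun u v => by simp [H]
  obtain ⟨w', hw', hS⟩ := exists_guessS H K Z
    (fun u v huv => hs.hard_hit hZ hX ((hH u v).1 huv)) (hcard.trans_le hK)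
  obtain ⟨w, hw, hG⟩ := exists_guessX d sm r (Setup.hull sm Z) w'
  refine ⟨w, hw.trans_le (Nat.mul_le_mul_left _ hw'), ?_⟩
  intro D h0 h1 h2 h5 hK0 hz
  obtain ⟨g₁, g₂⟩ := hG (D.setSc 3 (D.sc 2)) h2 h5 (by rw [setSc_sc, if_pos rfl, hz])
  have e7 : (beforeCheck r D).ar 7 = X := (beforeCheck_seven D).trans g₂
  have e9 : (beforeCheck r D).ar 9 = H := by
    rw [beforeCheck_nine, e7, h0, h1, h2, h5]
  obtain ⟨f₁, f₂⟩ := hS (pairStep r (guessX r (D.setSc 3 (D.sc 2))))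
    (by unfold pairStep andThen
        rw [setAr_sc, setAr_sc, guessX_sc (by omega), setSc_sc, if_neg (by omega), hK0])
    (by unfold pairStep andThen
        rw [setAr_sc, setAr_sc, g₁])
    (by rw [← e9, beforeCheck, guessS_ar (by omega)])
  obtain ⟨k₁, k₂⟩ := hgood X ((beforeCheck r D).ar 8) H ((beforeCheck r D).ar 10) hX f₁ hH
    (fun u v => by rw [beforeCheck_ten, e7, h0, h1, h2, h5]; simp) f₂
  rw [tryStep_eq, beforeCheck_ar (b := 2) (by omega), beforeCheck_ar (b := 5) (by omega), h2, h5,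
    e7, e9]
  split_ifs with h
  · simpa using k₂
  · have : ¬ solSize d sm X ((beforeCheck r D).ar 8) r < (beforeCheck r D).sc 4 :=
      fun h' => h ⟨k₁, h'⟩
    omega

theorem foldl_double (q : Fin n → Data n → Prop) [∀ v D, Decidable (q v D)]
    (hq : ∀ v D x, q v (D.setSc 1 x) ↔ q v D) (l : List (Fin n)) (D : Data n) :
    l.foldl (fun D v => if q v D then D.setSc 1 (D.sc 1 + D.sc 1) else D) D =
      D.setSc 1 (2 ^ l.countP (fun v => q v D) * D.sc 1) := by
  have hset : ∀ (D : Data n) x y, (D.setSc 1 x).setSc 1 y = D.setSc 1 y := fun D x y => by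
    simp [Data.setSc]
  induction l generalizing D with
  | nil => simp [Data.setSc]
  | cons v l ih =>
    rw [List.foldl_cons]
    by_cases hv : q v D
    · rw [if_pos hv, ih, hset, List.countP_cons_of_pos (by simpa using hv), setSc_sc, if_pos rfl]
      simp only [hq]
      congr 1
      ring
    · rw [if_neg hv, ih, List.countP_cons_of_neg (by simpa using hv)]

open Classical in
theorem countStep_eq (r : Fin n) (D : Data n) : countStep r D =
    (D.setSc 4 (n + 1)).setSc 1 (2 ^ (List.finRange n).countP
      (fun v => IsRep (D.ar 2) (D.ar 5) r v) * 2 ^ min (D.sc 0) n) := by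
  have hset : ∀ (D : Data n) x y, (D.setSc 1 x).setSc 1 y = D.setSc 1 y := fun D x y => by
    simp [Data.setSc]
  unfold countStep andThen forV
  rw [foldl_double (fun v D => IsRep (D.ar 2) (D.ar 5) r v) (fun _ _ _ => Iff.rfl),
    foldl_double (fun v D => (v : ℕ) < D.sc 0) (fun v D x => by simp), hset, hset]
  simp only [setSc_sc, setSc_ar, if_true, if_neg (show (0 : ℕ) ≠ 1 by omega),
    if_neg (show (0 : ℕ) ≠ 4 by omega)]
  rw [countP_lt, mul_one, mul_comm]
  rfl

open Classical in
theorem skipStep_sc_le (r : Fin n) (D : Data n) : (skipStep r D).sc 1 ≤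
    2 ^ (List.finRange n).countP (fun v => IsRep (D.ar 2) (D.ar 5) r v) * 2 ^ min (D.sc 0) n := by
  unfold skipStep andThen
  split_ifs
  · simp [countStep_eq]
  · simp

/-- The price of the component of `r`, charged to its root. -/
noncomputable def price (T d : Fin n → Fin n → ℕ) (r : Fin n) : ℕ :=
  open Classical in if IsRoot d r then opt T d r else 0

theorem payStep_ar (D : Data n) : (payStep D).ar = D.ar := by
  unfold payStep; split_ifs <;> rfl

/-- If the optimum is within the budget, the cover guess has enough bits and the optimum is
recorded. If not, every recorded value is at least the optimum by soundness, so the payment fails.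
-/
theorem compStep_spec {D : Data n} (hs : Setup G (D.ar 0) (D.ar 2) (D.ar 5)) (r : Fin n) :
    (∀ b < 7, (compStep r D).ar b = D.ar b) ∧
    (price (D.ar 1) (D.ar 2) r ≤ D.sc 0 → (compStep r D).sc 5 = D.sc 5 ∧
      (compStep r D).sc 0 = D.sc 0 - price (D.ar 1) (D.ar 2) r) ∧
    (D.sc 0 < price (D.ar 1) (D.ar 2) r → (compStep r D).sc 5 = 1) ∧
    (compStep r D).sc 0 ≤ D.sc 0 := by
  classical
  have hpay : ∀ E : Data n, E.sc 0 = D.sc 0 → E.sc 5 = D.sc 5 →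
      (E.sc 4 ≤ D.sc 0 ↔ price (D.ar 1) (D.ar 2) r ≤ D.sc 0) →
      (E.sc 4 ≤ D.sc 0 → E.sc 4 = price (D.ar 1) (D.ar 2) r) →
      (price (D.ar 1) (D.ar 2) r ≤ D.sc 0 → (payStep E).sc 5 = D.sc 5 ∧
        (payStep E).sc 0 = D.sc 0 - price (D.ar 1) (D.ar 2) r) ∧
      (D.sc 0 < price (D.ar 1) (D.ar 2) r → (payStep E).sc 5 = 1) ∧
      (payStep E).sc 0 ≤ D.sc 0 := by
    intro E h0 h5 h4 h4'
    unfold payStep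
    rw [h0]
    split_ifs with h
    · simp [h5, h4' h, h4.1 h]
    · have := h4.not.1 h
      simp only [setSc_sc, h0]
      simp [this]
  unfold compStep andThen skipStep
  by_cases hr : IsRoot (D.ar 2) r
  · rw [if_pos hr, countStep_eq]
    set L := 2 ^ (List.finRange n).countP (fun v => IsRep (D.ar 2) (D.ar 5) r v) *
      2 ^ min (D.sc 0) n with hL
    set D₁ := (D.setSc 4 (n + 1)).setSc 1 L with hD₁
    have hprice : price (D.ar 1) (D.ar 2) r = opt (D.ar 1) (D.ar 2) r := if_pos hr
    have hoptn : opt (D.ar 1) (D.ar 2) r ≤ n := by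
      simpa using opt_le (solves_univ (T := D.ar 1) (r := r) hs.dist)
    -- The quantification over `E` is needed because the right guess is tried amid leftovers of
    -- earlier ones.
    let Good : ℕ → Prop := fun z => ∀ E : Data n, (∀ b < 7, E.ar b = D.ar b) →
      E.sc 0 = D.sc 0 → E.sc 2 = z → (tryStep r E).sc 4 ≤ opt (D.ar 1) (D.ar 2) r
    have inv := whileLt_induction (z := 2) (l := 1) (f := tryStep r) (D := D₁)
      (fun j E => (∀ b < 7, E.ar b = D.ar b) ∧ E.sc 0 = D.sc 0 ∧ E.sc 5 = D.sc 5 ∧ E.sc 2 = j ∧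
        (E.sc 4 ≤ n → opt (D.ar 1) (D.ar 2) r ≤ E.sc 4) ∧
        ∀ z < j, Good z → E.sc 4 ≤ opt (D.ar 1) (D.ar 2) r) ?_ ?_
    · have hL' : D₁.sc 1 = L := by simp [hD₁]
      rw [hL'] at inv
      obtain ⟨h1, h2, h3, -, h5, h6⟩ := inv
      refine ⟨fun b hb => by rw [payStep_ar, h1 b hb], hpay _ h2 h3 ?_ ?_⟩ <;> rw [hprice]
      · constructor
        · intro h
          by_cases hn : (whileLt 2 1 (tryStep r) D₁).sc 4 ≤ n
          · exact (h5 hn).trans h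
          · omega
        · intro h
          obtain ⟨z, hz, hgood⟩ := tryStep_complete hs (D.ar 1) r h
          exact (h6 z hz fun E hE h0 h2 => hgood E (hE 0 (by omega)) (hE 1 (by omega))
            (hE 2 (by omega)) (hE 5 (by omega)) h0 h2).trans h
      · intro h
        by_cases hle : opt (D.ar 1) (D.ar 2) r ≤ D.sc 0
        · obtain ⟨z, hz, hgood⟩ := tryStep_complete hs (D.ar 1) r hle
          have := h6 z hz fun E hE h0 h2 => hgood E (hE 0 (by omega)) (hE 1 (by omega))
            (hE 2 (by omega)) (hE 5 (by omega)) h0 h2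
          exact le_antisymm this (h5 (this.trans hoptn))
        · have := h5 (by omega)
          omega
    · refine ⟨fun b _ => rfl, by simp [hD₁], by simp [hD₁], by simp, fun h => ?_, by simp⟩
      simp [hD₁] at h
    · rintro j E ⟨h1, h2, h3, h4, h5, h6⟩ -
      refine ⟨fun b hb => by rw [setSc_ar, tryStep_ar hb, h1 b hb], ?_, ?_, by simp, ?_, ?_⟩
      · rw [setSc_sc, if_neg (by omega), tryStep_sc (by omega) (by omega), h2]
      · rw [setSc_sc, if_neg (by omega), tryStep_sc (by omega) (by omega), h3]
      · rw [setSc_sc, if_neg (by omega)]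
        have := tryStep_sound (G := G) (D := E) (r := r)
        rw [h1 0 (by omega), h1 1 (by omega), h1 2 (by omega), h1 5 (by omega)] at this
        exact this hs h5
      · intro z hz hgood
        rw [setSc_sc, if_neg (by omega)]
        by_cases hzj : z = j
        · exact hgood E h1 h2 (h4.trans hzj.symm)
        · exact (tryStep_le E).trans (h6 z (by omega) hgood)
  · rw [if_neg hr, andThen]
    have hprice : price (D.ar 1) (D.ar 2) r = 0 := if_neg hr
    -- At a vertex that is not a root, the loop makes no round and there is nothing to pay.
    have hw : whileLt 2 1 (tryStep r) ((D.setSc 1 0).setSc 4 0) =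
        ((D.setSc 1 0).setSc 4 0).setSc 2 0 := by
      unfold whileLt
      simp
    rw [hw]
    refine ⟨fun b _ => by rw [payStep_ar]; rfl, hpay _ (by simp) (by simp) ?_ ?_⟩ <;>
      simp [hprice]

/-- Until a failure, money paid and money left add up to the initial budget; a failure proves that
the prices exceed it. In both cases the budget never grows, which bounds the number of guesses. -/
theorem comps_prefix {D : Data n} (hs : Setup G (D.ar 0) (D.ar 2) (D.ar 5)) (h5 : D.sc 5 = 0) :
    ∀ j ≤ n, (∀ b < 7, (forPrefix compStep D j).ar b = D.ar b) ∧
      (forPrefix compStep D j).sc 0 ≤ D.sc 0 ∧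
      (((forPrefix compStep D j).sc 5 = 0 ∧ (forPrefix compStep D j).sc 0 +
        ∑ r : Fin n with r.val < j, price (D.ar 1) (D.ar 2) r = D.sc 0) ∨
      ((forPrefix compStep D j).sc 5 ≠ 0 ∧
        D.sc 0 < ∑ r : Fin n with r.val < j, price (D.ar 1) (D.ar 2) r)) := by
  refine forPrefix_induction (fun j E => (∀ b < 7, E.ar b = D.ar b) ∧ E.sc 0 ≤ D.sc 0 ∧
    ((E.sc 5 = 0 ∧ E.sc 0 + ∑ r : Fin n with r.val < j, price (D.ar 1) (D.ar 2) r = D.sc 0) ∨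
    (E.sc 5 ≠ 0 ∧ D.sc 0 < ∑ r : Fin n with r.val < j, price (D.ar 1) (D.ar 2) r))) ?_ ?_
  · exact ⟨fun _ _ => rfl, le_rfl, Or.inl ⟨h5, by simp⟩⟩
  · rintro j E ⟨h₁, h₂, h₃⟩
    have hsum : ∑ r : Fin n with r.val < (j : ℕ) + 1, price (D.ar 1) (D.ar 2) r =
        price (D.ar 1) (D.ar 2) j + ∑ r : Fin n with r.val < (j : ℕ), price (D.ar 1) (D.ar 2) r := by
      have : (Finset.univ.filter fun i : Fin n => i.val < (j : ℕ) + 1) =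
          insert j (Finset.univ.filter fun i : Fin n => i.val < j) := by
        ext i; simp [Fin.ext_iff]; omega
      rw [this, Finset.sum_insert (by simp)]
    obtain ⟨g₁, g₂, g₃, g₄⟩ := compStep_spec (G := G) (D := E)
      (by rwa [h₁ 0 (by omega), h₁ 2 (by omega), h₁ 5 (by omega)]) j
    rw [h₁ 1 (by omega), h₁ 2 (by omega)] at g₂ g₃
    refine ⟨fun b hb => (g₁ b hb).trans (h₁ b hb), g₄.trans h₂, ?_⟩
    rw [hsum]
    by_cases hle : price (D.ar 1) (D.ar 2) j ≤ E.sc 0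
    · obtain ⟨e₁, e₂⟩ := g₂ hle
      rw [e₁, e₂]
      obtain h | h := h₃
      · exact Or.inl ⟨h.1, by omega⟩
      · exact Or.inr ⟨h.1, by omega⟩
    · rw [g₃ (by omega)]
      refine Or.inr ⟨one_ne_zero, ?_⟩
      obtain h | h := h₃ <;> omega

open Classical in
theorem algorithm_spec {D : Data n} (hA : ∀ u v, D.ar 0 u v ≠ 0 ↔ G.Adj u v) (h5 : D.sc 5 = 0) :
    (algorithm D).sc 6 = if (∑ r, price (D.ar 1) (dt G) r) ≤ D.sc 0 ∧
      ∀ u v, D.ar 1 u v ≠ 0 → G.Reachable u v then 1 else 0 := by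
  obtain ⟨h₁, h₂, h₃, -⟩ := prepStep_spec hA
  have h := comps_prefix h₃ (by rw [h₁, h5]) n le_rfl
  rw [forPrefix_last, h₁, h₂, h₃.dist] at h
  obtain ⟨e₁, -, e₂⟩ := h
  unfold algorithm andThen answerStep
  rw [setSc_sc, if_pos rfl, e₁ 1 (by omega), e₁ 2 (by omega), h₂, h₃.dist]
  simp only [dt_lt_iff]
  congr 1
  refine propext (and_congr_left fun _ => ?_)
  have hall : ∑ r : Fin n with r.val < n, price (D.ar 1) (dt G) r =
      ∑ r, price (D.ar 1) (dt G) r := by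
    congr 1
    ext i; simp
  rw [hall] at e₂
  obtain h | h := e₂
  · exact iff_of_true h.1 (by omega)
  · exact iff_of_false h.1 (by omega)

end Component

/-! ### Reduction of the problem to the components -/

section Specification

/-- A pair in two components has an empty interval and cannot be hit. Every other interval stays in
one component, so optimal sizes add up. -/
theorem hittingGeodesicIntervals_iff (I : HGIInstance) {T : Fin I.n → Fin I.n → ℕ}
    (hT : ∀ u v, T u v ≠ 0 ↔ s(u, v) ∈ I.T) :
    HittingGeodesicIntervals I ↔ (∑ r, price T (dt I.G) r) ≤ I.k ∧
      ∀ u v, T u v ≠ 0 → I.G.Reachable u v := by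
  classical
  have hroot : ∀ r, IsRoot (dt I.G) r ↔ Root I.G r := fun r => by simp [IsRoot, Root, dt_lt_iff]
  constructor
  · rintro ⟨S, hS, h⟩
    have hreach : ∀ u v, T u v ≠ 0 → I.G.Reachable u v := by
      intro u v huv
      obtain ⟨x, -, q, -⟩ := h u v ((hT u v).1 huv)
      exact q.reachable
    refine ⟨le_trans ?_ hS, hreach⟩
    have h1 : ∀ r, price T (dt I.G) r ≤
        ∑ x ∈ S, if Root I.G r ∧ I.G.Reachable r x then 1 else 0 := by
      intro r
      unfold price
      rw [hroot]
      split_ifs with hr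
      · have hsol : Solves T (dt I.G) r (S.filter fun x => I.G.Reachable r x) := by
          intro u v huv hu hv
          obtain ⟨x, hx, hxI⟩ := h u v ((hT u v).1 huv)
          have hd := (mem_geodesicInterval_iff (hreach u v huv)).1 hxI
          refine ⟨x, Finset.mem_filter.2 ⟨hx, ?_⟩, hd⟩
          exact (dt_lt_iff.1 hu).trans (reachable_of_dt_add (hreach u v huv) hd)
        refine (opt_le hsol).trans_eq ?_
        rw [Finset.card_filter]
        simp [hr]
      · exact Nat.zero_le _
    refine (Finset.sum_le_sum fun r _ => h1 r).trans ?_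
    -- Counted the other way round, each vertex of `S` is charged only to the unique root of its
    -- component.
    rw [Finset.sum_comm, Finset.card_eq_sum_ones]
    refine Finset.sum_le_sum fun x _ => ?_
    rw [← Finset.card_filter, Finset.card_le_one]
    intro a ha b hb
    simp only [Finset.mem_filter, Finset.mem_univ, true_and] at ha hb
    exact ha.1.unique hb.1 (ha.2.trans hb.2.symm)
  · rintro ⟨hsum, hreach⟩
    have : ∀ r, ∃ Z, Solves T (dt I.G) r Z ∧ Z.card = opt T (dt I.G) r :=
      fun r => exists_solves_opt rfl
    choose Z hZ hcard using this
    refine ⟨(Finset.univ.filter fun r => Root I.G r).biUnion Z, ?_, fun u v huv => ?_⟩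
    · refine Finset.card_biUnion_le.trans (le_trans ?_ hsum)
      rw [Finset.sum_filter]
      refine Finset.sum_le_sum fun r _ => ?_
      unfold price
      rw [hroot, hcard]
    · have hr := hreach u v ((hT u v).2 huv)
      obtain ⟨r, h1, h2⟩ := exists_root (G := I.G) u
      obtain ⟨x, hx, hd⟩ := hZ r u v ((hT u v).2 huv) (dt_lt_iff.2 h1)
        (dt_lt_iff.2 (h1.trans hr))
      refine ⟨x, ?_, (mem_geodesicInterval_iff hr).2 hd⟩
      exact Finset.mem_coe.2 (Finset.mem_biUnion.2 ⟨r, by simpa using h2, hx⟩)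

end Specification

end HGI

namespace HGI

/-! ### The running time -/

/-- Everything but the loops over guesses is polynomial. There are `n` such loops, and the largest
number of rounds among them bounds each. -/
theorem timed_algorithm : ∃ (a b : ℕ → ℕ), PolyBdd a ∧ PolyBdd b ∧
    Timed (m := 0) (fun _ _ D => algorithm D) fun n _ D => a n + (Finset.univ.sup fun j : Fin n =>
      (skipStep j (forPrefix compStep (prepStep D) j)).sc 1) * b n := by
  obtain ⟨τ, hτ, hprep⟩ := (inferInstance : Poly (m := 0) fun n _ D => prepStep D).out
  obtain ⟨σ, hσ, hskip⟩ := (inferInstance : Poly (m := 1) fun n γ D => skipStep γ.2 D).out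
  obtain ⟨ρ, hρ, htry⟩ := (inferInstance : Poly (m := 1) fun n γ D => tryStep γ.2 D).out
  obtain ⟨π, hπ, hpay⟩ := (inferInstance : Poly (m := 1) fun n _ D => payStep D).out
  obtain ⟨α, hα, hans⟩ := (inferInstance : Poly (m := 0) fun n _ D => answerStep D).out
  have hloop := Timed.whileLt (z := 2) (l := 1) (by omega) htry
    (fun n γ D => tryStep_sc (by omega) (by omega)) fun n γ D => tryStep_sc (by omega) (by omega)
  have hcomp := hskip.andThen (hloop.andThen hpay)
  let B : ∀ n, Ctx 0 n → Data n → ℕ := fun n _ D => σ n + (2 + ((Finset.univ.sup fun j : Fin n =>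
    (skipStep j (forPrefix compStep D j)).sc 1) + 1) * (ρ n + 4 + 3 + 1) + π n)
  have hfor := Timed.forV (m := 0) (f := fun n _ => compStep) (B := B) hcomp fun n γ D j => by
    have : (skipStep j (forPrefix compStep D j)).sc 1 ≤ Finset.univ.sup fun j : Fin n =>
        (skipStep j (forPrefix compStep D j)).sc 1 :=
      Finset.le_sup (f := fun j : Fin n => (skipStep j (forPrefix compStep D j)).sc 1)
        (Finset.mem_univ j)
    have := Nat.mul_le_mul_right (ρ n + 4 + 3 + 1) (Nat.add_le_add_right this 1)
    simp only [B]
    omega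
  have hn : PolyBdd fun n => n + 1 := PolyBdd.id.add (.const _)
  have hρ' : PolyBdd fun n => ρ n + 4 + 3 + 1 :=
    ((hρ.add (.const _)).add (.const _)).add (.const _)
  refine ⟨fun n => τ n + (2 + (n + 1) * (σ n + (2 + (ρ n + 4 + 3 + 1) + π n) + 4 + 3 + 1) + α n),
    fun n => (n + 1) * (ρ n + 4 + 3 + 1), ?_, hn.mul hρ', ?_⟩
  · refine hτ.add (((PolyBdd.const _).add (hn.mul ?_)).add hα)
    exact (((hσ.add (((PolyBdd.const _).add hρ').add hπ)).add (.const _)).add (.const _)).add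
      (.const _)
  · obtain ⟨P, hP⟩ := hprep.andThen (hfor.andThen hans)
    refine ⟨P, fun n γ D s hD hγ => (hP n γ D s hD hγ).mono (le_of_eq ?_) fun _ h => h⟩
    simp only [B]
    ring

theorem countP_isRep_le {n : ℕ} {G : SimpleGraph (Fin n)} {sm : Fin n → Fin n → ℕ}
    (hsm : ∀ u v, sm u v ≠ 0 ↔ Same G u v) (r : Fin n) :
    open Classical in (List.finRange n).countP (fun v => IsRep (dt G) sm r v) ≤
      topModuleNumber G + 1 := by
  classical
  refine le_trans (le_of_eq ?_) (card_modReps_le G r)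
  rw [List.countP_eq_length_filter, ← List.toFinset_card_of_nodup
    ((List.nodup_finRange n).filter _)]
  congr 1
  ext x
  simp [mem_modReps, IsRep, dt_lt_iff, ← hsm]

theorem inputData_adj (I : HGIInstance) (u v : Fin I.n) :
    (inputData I).ar 0 u v ≠ 0 ↔ I.G.Adj u v := by
  simp [inputData, matrixOf_apply]

theorem inputData_pairs (I : HGIInstance) (u v : Fin I.n) :
    (inputData I).ar 1 u v ≠ 0 ↔ s(u, v) ∈ I.T := by
  simp [inputData, matrixOf_apply]

/-- There are at most `topModuleNumber I.G + 1` module bits, and at most `I.k` cover bits because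
the budget never grows. -/
theorem skipStep_bound (I : HGIInstance) (j : Fin I.n) :
    (skipStep j (forPrefix compStep (prepStep (inputData I)) j)).sc 1 ≤
      2 * 2 ^ (topModuleNumber I.G + I.k) := by
  obtain ⟨h₁, h₂, h₃, h₄⟩ := prepStep_spec (inputData_adj I)
  obtain ⟨e₁, e₂, -⟩ := comps_prefix h₃ (by rw [h₁]; rfl) j j.2.le
  refine (skipStep_sc_le _ _).trans ?_
  rw [e₁ 2 (by omega), e₁ 5 (by omega), h₃.dist]
  rw [h₁] at e₂
  have hk : (inputData I).sc 0 = I.k := rfl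
  have h := countP_isRep_le h₄ j
  calc _ ≤ 2 ^ (topModuleNumber I.G + 1) * 2 ^ I.k :=
        Nat.mul_le_mul (Nat.pow_le_pow_right (by omega) h)
          (Nat.pow_le_pow_right (by omega) (by omega))
    _ = _ := by ring

theorem solvable : SolvableInOStar HittingGeodesicIntervals
    (fun I => 2 ^ (topModuleNumber I.G + I.k)) := by
  obtain ⟨P₀, τ, ⟨C₀, h₀⟩, hP₀⟩ := runs_init
  obtain ⟨a, b, ⟨C₁, h₁⟩, ⟨C₂, h₂⟩, P, hP⟩ := timed_algorithm
  -- Register `21 = 3 * 6 + 3` holds the answer, scalar 6. In the constant, `2 * C₂` absorbs the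
  -- factor 2 from the extra module bit, and the final 2 pays for the last assignment.
  refine ⟨.seq P₀ (.seq P (.assign 0 (.reg 21))), C₀ + C₁ + 2 * C₂ + 2, fun I => ?_⟩
  have hrun : Runs (.seq P₀ (.seq P (.assign 0 (.reg 21)))) I.input (τ I.n + (a I.n +
      (Finset.univ.sup fun j : Fin I.n =>
        (skipStep j (forPrefix compStep (prepStep (inputData I)) j)).sc 1) * b I.n + 2))
      fun s => s.reg 0 = open Classical in if HittingGeodesicIntervals I then 1 else 0 := by
    refine Runs.seq ((hP₀ I).mono le_rfl fun s hs => Runs.seq ?_)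
    refine (hP I.n () (inputData I) s hs (fun l hl => absurd hl (by omega))).mono le_rfl ?_
    rintro s' ⟨hs', -⟩
    refine Runs.assign ?_
    have := hs'.sc 6
    simp only [State.setReg, Function.update_self, RAM.Expr.eval]
    rw [show 21 = 3 * 6 + 3 from rfl, this, algorithm_spec (inputData_adj I) rfl]
    congr 1
    exact propext (hittingGeodesicIntervals_iff I (inputData_pairs I)).symm
  obtain ⟨t, s, ht, hE, hs⟩ := hrun
  refine ⟨t, s, ht.trans ?_, hE, hs⟩
  have hsup : (Finset.univ.sup fun j : Fin I.n =>
      (skipStep j (forPrefix compStep (prepStep (inputData I)) j)).sc 1) ≤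
      2 * 2 ^ (topModuleNumber I.G + I.k) := Finset.sup_le fun j _ => skipStep_bound I j
  set M := 2 ^ (topModuleNumber I.G + I.k) with hM
  have hM1 : 1 ≤ M := Nat.one_le_two_pow
  set c := C₀ + C₁ + 2 * C₂ + 2 with hc
  have hsize : I.n ≤ I.size := by
    unfold HGIInstance.size
    nlinarith [Nat.zero_le (Nat.size I.n), Nat.zero_le (Nat.size I.k)]
  have hpow : ∀ C ≤ c, (I.n + 1) ^ C ≤ (I.size + 1) ^ c := fun C hC =>
    (Nat.pow_le_pow_left (by omega) C).trans (Nat.pow_le_pow_right (by omega) hC)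
  set Y := (I.size + 1) ^ c
  have hY : 1 ≤ Y := Nat.one_le_pow _ _ (by omega)
  have hMY : Y ≤ M * Y := Nat.le_mul_of_pos_left _ hM1
  have k₀ : τ I.n ≤ C₀ * (M * Y) :=
    (h₀ _).trans (Nat.mul_le_mul_left _ ((hpow _ (by omega)).trans hMY))
  have k₁ : a I.n ≤ C₁ * (M * Y) :=
    (h₁ _).trans (Nat.mul_le_mul_left _ ((hpow _ (by omega)).trans hMY))
  have k₂ : b I.n ≤ C₂ * Y := (h₂ _).trans (Nat.mul_le_mul_left _ (hpow _ (by omega)))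
  have k₃ := Nat.mul_le_mul hsup k₂
  have k₄ : 2 ≤ 2 * (M * Y) := by omega
  calc _ ≤ C₀ * (M * Y) + (C₁ * (M * Y) + 2 * M * (C₂ * Y) + 2 * (M * Y)) := by omega
    _ = c * M * Y := by rw [hc]; ring

/-! ### The number of top-level modules and the modular-width -/

section Width

/-- Fibres of a map are nonempty and distinct by construction, which avoids the empty traces that
arise when a partition is restricted to a subset. -/
theorem exists_partition_of_coloring {V : Type} {α : Type*} (G : SimpleGraph V) (c : V → α)
    (hc : ∀ u v w, c u = c v → c u ≠ c w → (G.Adj u w ↔ G.Adj v w)) :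
    ∃ P, IsModulePartition G P ∧ P.ncard = (Set.range c).ncard := by
  refine ⟨(Setoid.ker c).classes, ⟨Setoid.isPartition_classes _, ?_⟩, ?_⟩
  · rintro M ⟨x, rfl⟩ u hu v hv
    have huv : c u = c v := Eq.trans hu (Eq.symm hv)
    ext w
    simp only [Set.mem_sdiff, SimpleGraph.mem_neighborSet]
    refine and_congr_left fun hw => hc u v w huv fun h => hw (Eq.trans h.symm hu)
  · have : (Setoid.ker c).classes = (fun a => c ⁻¹' {a}) '' Set.range c := by
      ext M
      constructor
      · rintro ⟨x, rfl⟩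
        exact ⟨c x, ⟨x, rfl⟩, rfl⟩
      · rintro ⟨_, ⟨x, rfl⟩, rfl⟩
        exact ⟨x, rfl⟩
    rw [this]
    refine Set.InjOn.ncard_image ?_
    rintro _ ⟨x, rfl⟩ b _ h
    have : x ∈ c ⁻¹' {b} := by
      simp only at h
      rw [← h]; rfl
    exact this

theorem exists_part {V : Type} {P : Set (Set V)} (hP : Setoid.IsPartition P) :
    ∃ c : V → Set V, ∀ v, c v ∈ P ∧ v ∈ c v ∧ ∀ M ∈ P, v ∈ M → c v = M := by
  choose c hc huniq using fun v => hP.2 v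
  exact ⟨c, fun v => ⟨(hc v).1, (hc v).2, fun M hM hv => (huniq v M ⟨hM, hv⟩).symm⟩⟩

/-- Connectedness of `C` plays no role, and arbitrary sets are what the induction needs. If one part
contains `C`, descend into that part; otherwise the parts that meet `C` cut it into at least two
modules. -/
theorem exists_partition_of_modularWidthLE {μ : ℕ} {V : Type} {G : SimpleGraph V}
    (h : ModularWidthLE μ G) [Finite V] (C : Set V) (hC : C.Nontrivial) :
    ∃ P : Set (Set C), IsModulePartition (G.induce C) P ∧ 2 ≤ P.ncard ∧ P.ncard ≤ μ := by
  induction h with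
  | small G _ hcard =>
    obtain ⟨P, hP, hn⟩ := exists_partition_of_coloring (G.induce C) (fun x : C => x.1)
      fun u v w huv _ => by rw [Subtype.ext huv]
    refine ⟨P, hP, ?_, ?_⟩
    · rw [hn]
      obtain ⟨x, hx, y, hy, hxy⟩ := hC
      exact (Set.one_lt_ncard (Set.finite_range _)).2 ⟨_, ⟨⟨x, hx⟩, rfl⟩, _, ⟨⟨y, hy⟩, rfl⟩, hxy⟩
    · rw [hn]
      refine le_trans ?_ hcard
      rw [← Set.ncard_univ]
      exact Set.ncard_le_ncard (Set.subset_univ _)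
  | @partition V G P hP h2 hμ _ ih =>
    by_cases hM : ∃ M ∈ P, C ⊆ M
    · obtain ⟨M, hMP, hCM⟩ := hM
      -- The map `e` identifies `C` with its copy inside `M`, so that the partition found there can
      -- be pulled back.
      let e : C → (Subtype.val ⁻¹' C : Set M) := fun x => ⟨⟨x.1, hCM x.2⟩, x.2⟩
      have he : Function.Surjective e := fun y => ⟨⟨y.1.1, y.2⟩, rfl⟩
      obtain ⟨Q, hQ, h2, hle⟩ := ih M hMP (Subtype.val ⁻¹' C) (by
          obtain ⟨x, hx, y, hy, hxy⟩ := hC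
          exact ⟨⟨x, hCM hx⟩, hx, ⟨y, hCM hy⟩, hy, fun h => hxy (congrArg Subtype.val h)⟩)
      obtain ⟨c, hc⟩ := exists_part hQ.1
      have hrange : Set.range (c ∘ e) = Q := by
        ext B
        constructor
        · rintro ⟨x, rfl⟩
          exact (hc _).1
        · intro hB
          obtain ⟨y, hy⟩ : B.Nonempty := by
            rw [Set.nonempty_iff_ne_empty]; rintro rfl; exact hQ.1.1 hB
          obtain ⟨x, rfl⟩ := he y
          exact ⟨x, (hc _).2.2 B hB hy⟩
      obtain ⟨P', hP', hn⟩ := exists_partition_of_coloring (G.induce C) (c ∘ e) (by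
        intro u v w huv huw
        have := hQ.2 (c (e u)) (hc _).1 (e u) (hc _).2.1 (e v) (by
          simp only [Function.comp] at huv
          rw [huv]; exact (hc _).2.1)
        have hw : e w ∉ c (e u) := fun h => huw ((hc (e w)).2.2 _ (hc (e u)).1 h).symm
        have := congrArg (e w ∈ ·) this
        simp only [Set.mem_sdiff, hw, not_false_eq_true, and_true, eq_iff_iff] at this
        exact this)
      rw [hrange] at hn
      exact ⟨P', hP', by omega, by omega⟩
    -- Colour each vertex of `C` by its part; a single colour would place `C` inside one part.
    · obtain ⟨c, hc⟩ := exists_part hP.1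
      obtain ⟨P', hP', hn⟩ := exists_partition_of_coloring (G.induce C) (fun x : C => c x.1) (by
        intro u v w huv huw
        have := hP.2 (c u.1) (hc _).1 u.1 (hc _).2.1 v.1 (by rw [huv]; exact (hc _).2.1)
        have hw : w.1 ∉ c u.1 := fun h => huw ((hc w.1).2.2 _ (hc u.1).1 h).symm
        have := congrArg (w.1 ∈ ·) this
        simp only [Set.mem_sdiff, hw, not_false_eq_true, and_true, eq_iff_iff] at this
        exact this)
      have hfin : P.Finite := Set.finite_of_ncard_pos (by omega)
      have hsub : Set.range (fun x : C => c x.1) ⊆ P := by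
        rintro _ ⟨x, rfl⟩
        exact (hc _).1
      refine ⟨P', hP', ?_, ?_⟩
      · rw [hn]
        by_contra hlt
        have hall : ∀ x y : C, c x.1 = c y.1 := fun x y => by
          by_contra h
          exact hlt ((Set.one_lt_ncard (hfin.subset hsub)).2 ⟨_, ⟨x, rfl⟩, _, ⟨y, rfl⟩, h⟩)
        obtain ⟨x, hx⟩ := hC.nonempty
        refine hM ⟨c x, (hc x).1, fun y hy => ?_⟩
        have : c x = c y := hall ⟨x, hx⟩ ⟨y, hy⟩
        rw [this]
        exact (hc y).2.1
      · rw [hn]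
        exact (Set.ncard_le_ncard hsub hfin).trans hμ

theorem topModuleNumber_le_modularWidth {n : ℕ} (G : SimpleGraph (Fin n)) :
    topModuleNumber G ≤ modularWidth G := by
  have h : ModularWidthLE (modularWidth G) G :=
    -- The value `n` is always admissible, so the infimum is attained.
    Nat.sInf_mem (s := {μ | ModularWidthLE μ G}) ⟨n, .small G inferInstance (by simp)⟩
  exact Nat.sInf_le fun C hC => exists_partition_of_modularWidthLE h C.supp hC

end Width

theorem computable_two_pow : Computable fun n : ℕ => 2 ^ n := by
  have : Primrec fun n : ℕ => 2 ^ n := by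
    refine (Primrec.nat_rec₁ (f := fun _ b => b + b) 1
      (Primrec.nat_add.comp₂ Primrec₂.right Primrec₂.right)).of_eq fun n => ?_
    induction n with
    | zero => rfl
    | succ n ih => rw [pow_succ, ← ih]; simp only; ring
  exact this.to_comp

end HGI

theorem mainTheorem5 :
    IsFixedParameterTractable HittingGeodesicIntervals (fun I => I.k + modularWidth I.G) ∧
    SolvableInOStar HittingGeodesicIntervals (fun I => 2 ^ (topModuleNumber I.G + I.k)) ∧
    ∀ (n : ℕ) (G : SimpleGraph (Fin n)), topModuleNumber G ≤ modularWidth G := by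
  refine ⟨⟨fun x => 2 ^ x, HGI.computable_two_pow, ?_⟩, HGI.solvable,
    fun n G => HGI.topModuleNumber_le_modularWidth G⟩
  obtain ⟨prog, c, h⟩ := HGI.solvable
  refine ⟨prog, c, fun I => ?_⟩
  obtain ⟨t, s, ht, hE, hs⟩ := h I
  refine ⟨t, s, ht.trans ?_, hE, hs⟩
  have := HGI.topModuleNumber_le_modularWidth I.G
  have : 2 ^ (topModuleNumber I.G + I.k) ≤ 2 ^ (I.k + modularWidth I.G) :=
    Nat.pow_le_pow_right (by omega) (by omega)
  gcongr
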